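/- Let $\Gamma$ be the graph with exactly two vertices $v\neq w$ and exactly two edges $e,\tilde e$, where $s(e)=v=r(\tilde e)$, $r(e)=w=s(\tilde e)$, with a weight $\mu:\{v,w\}\to(0,\infty)$ satisfying $\mu(v)^2+\mu(w)^2=1$ and $\mu(w)\le\mu(v)$. Let $F(\Gamma)$ be the complex vector space with basis the paths $[\xi]$ of $\Gamma$ of all lengths $\ge 0$ (paths of length $0$ are vertices). For paths $\xi=\xi_1\cdots\xi_m$, $\eta=\eta_1\cdots\eta_n$ put $[\xi]\#[\eta]=\sum_{k=0}^{\min(m,n)}\zeta_k$, where $\zeta_k=\frac{\mu(r(\xi))}{\mu(v^\xi_{m-k})}[\xi_1\cdots\xi_{m-k}\eta_{k+1}\cdots\eta_n]$ if $r(\xi)=s(\eta)$ and $\xi_{m-j+1}=\tilde\eta_j$ for $1\le j\le k$, and $\zeta_k=0$ otherwise; here $v^\xi_i$ is the $i$-th vertex of $\xi$ ($v^\xi_0=s(\xi)$, $v^\xi_m=r(\xi)$). Put $[\xi]^*=[\tilde\xi_m\cdots\tilde\xi_1]$, and let $\tau([\xi])=0$ for paths of positive length and $\tau([u])=\mu(u)^2$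 for vertices $u$. Left multiplication defines a representation $\lambda$ of $F(\Gamma)$ by bounded operators on $\mathcal H=L^2(F(\Gamma),\tau)$; put $M(\Gamma,\mu)=\lambda(F(\Gamma))''$ and write $\tau$ also for the trace on it. Let $p_v=\lambda([v])$, $p_w=\lambda([w])$, $\mathcal H_v=\operatorname{ran}p_v$, $\mathcal H_w=\operatorname{ran}p_w$. Operators between $\mathcal H_v$ and $\mathcal H_w$ (or on one of them) are regarded as operators on $\mathcal H=\mathcal H_v\oplus\mathcal H_w$ with a single non-zero block. Let $L\mathbb Z$ be the group von Neumann algebra of $\mathbb Z$ on $\ell^2(\mathbb Z)$. Then $\lambda(e)=\begin{pmatrix}0&t\\0&0\end{pmatrix}$ for some $t:\mathcal H_w\to\mathcal H_v$. Let $t=u|t|$ be its polar decomposition and $z$ the projection onto $\mathcal H_v\ominus\overline{\operatorname{ran}t}$. Then: (0) $t^*t$ has absolutely continuous spectrum (all its scalar spectral measures are absolutely continuous with respect to Lebesgue measure); (i) $u$ maps $\mathcal H_w$ isometrically onto $\overline{\operatorname{ran}t}$, and $\tau(z)=\mu(v)^2-\mu(w)^2$; (ii) $W^*(|t|)\cong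 L\mathbb Z$; (iii) $z,u,|t|\in M(\Gamma,\mu)$. If $\mu(w)<\mu(v)$, there is a positive $a\in L\mathbb Z$ with absolutely continuous spectrum, generating $L\mathbb Z$ as a von Neumann algebra, such that there is a unique $*$-isomorphism $M(\Gamma,\mu)\to\mathbb C\oplus M_2(L\mathbb Z)$ with $$p_v\mapsto\Bigl(1,\begin{pmatrix}1&0\\0&0\end{pmatrix}\Bigr),\quad p_w\mapsto\Bigl(0,\begin{pmatrix}0&0\\0&1\end{pmatrix}\Bigr),\quad z\mapsto(1,0),\quad u\mapsto\Bigl(0,\begin{pmatrix}0&1\\0&0\end{pmatrix}\Bigr),\quad |t|\mapsto\Bigl(0,\begin{pmatrix}0&0\\0&a\end{pmatrix}\Bigr).$$ If $\mu(w)=\mu(v)$, then $z=0$ and the same holds without the summand $\mathbb C$: for some positive $a\in L\mathbb Z$ with absolutely continuous spectrum, generating $L\mathbb Z$ as a von Neumann algebra, there is a unique $*$-isomorphism $M(\Gamma,\mu)\to M_2(L\mathbb Z)$ with $p_v\mapsto\begin{pmatrix}1&0\\0&0\end{pmatrix}$, $p_w\mapsto\begin{pmatrix}0&0\\0&1\end{pmatrix}$,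 $u\mapsto\begin{pmatrix}0&1\\0&0\end{pmatrix}$, $|t|\mapsto\begin{pmatrix}0&0\\0&a\end{pmatrix}$. -/

import Mathlib

open scoped ComplexInnerProductSpace InnerProduct

noncomputable section

/-! ### Hilbert space preliminaries -/

/-- The Hilbert space `ℓ²(ι)` of square-summable complex families indexed by `ι`. -/
abbrev EllTwo (ι : Type*) : Type _ := lp (fun _ : ι => ℂ) 2

namespace EllTwo

open Classical in
/-- The standard orthonormal basis vector `δ_i` of `ℓ²(ι)`. -/
def delta {ι : Type*} (i : ι) : EllTwo ι := lp.single 2 i (1 : ℂ)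

open Classical in
theorem inner_delta {ι : Type*} (i j : ι) :
    (inner ℂ (delta i) (delta j) : ℂ) = if i = j then 1 else 0 := by
  unfold delta
  rw [lp.inner_single_left, lp.single_apply, Pi.single_apply]
  by_cases h : i = j <;> simp [h]

theorem orthonormal_delta {ι : Type*} : Orthonormal ℂ (delta : ι → EllTwo ι) := by
  classical
  rw [orthonormal_iff_ite]
  intro i j
  rw [inner_delta]

/-- Vectors of `ℓ²(ι)` orthogonal to all `δ_i` vanish. -/
theorem eq_zero_of_inner_delta {ι : Type*} (x : EllTwo ι)
    (h : ∀ i, (inner ℂ (delta i) x : ℂ) = 0) : x = 0 := by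
  classical
  ext i
  have := h i
  unfold delta at this
  rw [lp.inner_single_left] at this
  simpa using this

/-- The isometry `ℓ²(ι) → ℓ²(κ)`, `δ_i ↦ δ_{f i}`, induced by an injection `f : ι → κ`. -/
def mapInj {ι κ : Type*} (f : ι → κ) (hf : Function.Injective f) :
    EllTwo ι →ₗᵢ[ℂ] EllTwo κ :=
  (Orthonormal.orthogonalFamily (orthonormal_delta.comp f hf)).linearIsometry

theorem mapInj_delta {ι κ : Type*} (f : ι → κ) (hf : Function.Injective f) (i : ι) :
    mapInj f hf (delta i) = delta (f i) := by
  classical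
  unfold mapInj
  rw [show (delta i : EllTwo ι) = lp.single 2 i (1 : ℂ) by unfold delta; congr!]
  rw [OrthogonalFamily.linearIsometry_apply_single]
  simp

/-- A partially defined injection induces a bounded operator between `ℓ²`-spaces. -/
theorem exists_partial {ι κ : Type*} (p : ι → Prop) (f : ∀ i, p i → κ)
    (hf : ∀ i j hi hj, f i hi = f j hj → i = j) :
    ∃ T : EllTwo ι →L[ℂ] EllTwo κ,
      (∀ i (hi : p i), T (delta i) = delta (f i hi)) ∧ ∀ i, ¬ p i → T (delta i) = 0 := by
  classical
  let J : EllTwo {i // p i} →ₗᵢ[ℂ] EllTwo ι := mapInj Subtype.val Subtype.val_injective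
  let K : EllTwo {i // p i} →ₗᵢ[ℂ] EllTwo κ :=
    mapInj (fun i => f i.1 i.2) (fun i j h => Subtype.ext (hf _ _ _ _ h))
  have key : ∀ (x : EllTwo ι) (y : EllTwo {i // p i}),
      (∀ i, (inner ℂ (delta i.1) x : ℂ) = inner ℂ (delta i) y) →
      ContinuousLinearMap.adjoint J.toContinuousLinearMap x = y := by
    intro x y h
    rw [← sub_eq_zero]
    apply eq_zero_of_inner_delta
    intro i
    rw [inner_sub_right, ContinuousLinearMap.adjoint_inner_right, ← h i]
    simp [J, mapInj_delta]
  refine ⟨K.toContinuousLinearMap ∘L ContinuousLinearMap.adjoint J.toContinuousLinearMap,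
    fun i hi => ?_, fun i hi => ?_⟩
  · have := key (delta i) (delta ⟨i, hi⟩) (fun j => by simp [inner_delta, Subtype.ext_iff])
    rw [ContinuousLinearMap.comp_apply, this]
    exact mapInj_delta _ (fun i j h => Subtype.ext (hf _ _ _ _ h)) _
  · have := key (delta i) 0 (fun j => by
      have : j.1 ≠ i := fun h => hi (h ▸ j.2)
      simp [inner_delta, this])
    simp [this]

end EllTwo

section Operators

variable {H : Type*} [NormedAddCommGroup H] [InnerProductSpace ℂ H] [CompleteSpace H]

/-- The von Neumann algebra `W*(S)` generated by a set `S` of bounded operators: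
the double commutant of `S ∪ S*`. -/
def generatedVN (S : Set (H →L[ℂ] H)) : VonNeumannAlgebra H where
  toStarSubalgebra :=
    StarSubalgebra.centralizer ℂ (StarSubalgebra.centralizer ℂ S : Set (H →L[ℂ] H))
  centralizer_centralizer' := by
    have h : ∀ T : StarSubalgebra ℂ (H →L[ℂ] H), ((T : Set (H →L[ℂ] H)) ∪ star (T : Set _)) = T := by
      intro T
      apply Set.union_eq_self_of_subset_right
      intro x hx
      simpa using star_mem (S := StarSubalgebra ℂ (H →L[ℂ] H)) (s := T) hx
    change Set.centralizer (Set.centralizer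
      ((StarSubalgebra.centralizer ℂ (StarSubalgebra.centralizer ℂ S : Set (H →L[ℂ] H)) :
        StarSubalgebra ℂ (H →L[ℂ] H)) : Set (H →L[ℂ] H))) =
      ((StarSubalgebra.centralizer ℂ (StarSubalgebra.centralizer ℂ S : Set (H →L[ℂ] H)) :
        StarSubalgebra ℂ (H →L[ℂ] H)) : Set (H →L[ℂ] H))
    rw [StarSubalgebra.coe_centralizer, h, Set.centralizer_centralizer_centralizer]

theorem coe_generatedVN (S : Set (H →L[ℂ] H)) :
    (generatedVN S : Set (H →L[ℂ] H)) = Set.centralizer (Set.centralizer (S ∪ star S)) := by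
  have h : ∀ T : StarSubalgebra ℂ (H →L[ℂ] H), ((T : Set (H →L[ℂ] H)) ∪ star (T : Set _)) = T := by
    intro T
    apply Set.union_eq_self_of_subset_right
    intro x hx
    simpa using star_mem (S := StarSubalgebra ℂ (H →L[ℂ] H)) (s := T) hx
  change ((StarSubalgebra.centralizer ℂ (StarSubalgebra.centralizer ℂ S : Set (H →L[ℂ] H)) :
        StarSubalgebra ℂ (H →L[ℂ] H)) : Set (H →L[ℂ] H)) = _
  rw [StarSubalgebra.coe_centralizer, h, StarSubalgebra.coe_centralizer]

theorem subset_generatedVN (S : Set (H →L[ℂ] H)) {T : H →L[ℂ] H} (hT : T ∈ S) :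
    T ∈ generatedVN S := by
  rw [← SetLike.mem_coe, coe_generatedVN]
  exact Set.subset_centralizer_centralizer (Or.inl hT)

/-- `ν` is the scalar spectral measure of the self-adjoint operator `a` at the vector `h`:
a finite measure carried by the spectrum with `∫ f dν = ⟨h, f(a) h⟩` for all continuous `f`. -/
def IsScalarSpectralMeasure (a : H →L[ℂ] H) (h : H) (ν : MeasureTheory.Measure ℝ) : Prop :=
  MeasureTheory.IsFiniteMeasure ν ∧ ν (spectrum ℝ a)ᶜ = 0 ∧
    ∀ f : ℝ → ℝ, Continuous f → ((∫ x, f x ∂ν : ℝ) : ℂ) = inner ℂ h (cfc f a h)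

/-- A self-adjoint operator has absolutely continuous spectrum if all its scalar spectral
measures are absolutely continuous with respect to Lebesgue measure. -/
def HasAbsContSpectrum (a : H →L[ℂ] H) : Prop :=
  IsSelfAdjoint a ∧ ∀ h : H, ∃ ν : MeasureTheory.Measure ℝ,
    IsScalarSpectralMeasure a h ν ∧ ν.AbsolutelyContinuous MeasureTheory.volume

variable {K : Type*} [NormedAddCommGroup K] [InnerProductSpace ℂ K] [CompleteSpace K]

/-- `|t| = (t* t)^{1/2}` for a bounded operator `t : H → K`. -/
def opAbs (t : H →L[ℂ] K) : H →L[ℂ] H := CFC.sqrt (ContinuousLinearMap.adjoint t ∘L t)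

/-- `t = u |t|` is the polar decomposition of `t`: `u` is the partial isometry with
initial space `(ker t)ᗮ`. -/
structure IsPolarDecomposition (t u : H →L[ℂ] K) : Prop where
  eq_comp : t = u ∘L opAbs t
  norm_eq : ∀ x ∈ (LinearMap.ker (t : H →ₗ[ℂ] K))ᗮ, ‖u x‖ = ‖x‖
  eq_zero : ∀ x ∈ LinearMap.ker (t : H →ₗ[ℂ] K), u x = 0

/-- For closed subspaces `A`, `B` of `H` and `T : B → A`, the operator on `H` which equals `T`
on `B`, and vanishes on `Bᗮ`; i.e. the block matrix whose only non-zero entry is `T`. -/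
def corner (A B : Submodule ℂ H) [B.HasOrthogonalProjection] (T : B →L[ℂ] A) : H →L[ℂ] H :=
  A.subtypeL ∘L T ∘L B.orthogonalProjectionOnto

/-- For closed subspaces `A`, `B` of `H`, the block `B → A` of an operator on `H`. -/
def blockEntry (A B : Submodule ℂ H) [A.HasOrthogonalProjection] (x : H →L[ℂ] H) :
    B →L[ℂ] A :=
  A.orthogonalProjectionOnto ∘L x ∘L B.subtypeL

end Operators

/-- The left regular representation of `G` on `ℓ²(G)`: `δ_h ↦ δ_{g h}`. -/
def leftRegular {G : Type*} [Group G] (g : G) : EllTwo G →L[ℂ] EllTwo G :=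
  (EllTwo.mapInj (fun h => g * h) (mul_right_injective g)).toContinuousLinearMap

/-- The group von Neumann algebra `LG`. -/
def groupVN (G : Type*) [Group G] : VonNeumannAlgebra (EllTwo G) :=
  generatedVN (Set.range (leftRegular : G → _))

/-- The group von Neumann algebra `Lℤ`, acting on `ℓ²(ℤ)`. -/
def LZ : VonNeumannAlgebra (EllTwo (Multiplicative ℤ)) := groupVN (Multiplicative ℤ)

/-! ### Weighted graphs -/

/-- A weighted graph: source and range maps, an orientation reversal involution on the edges
and a positive weight on the (finitely many) vertices with `∑ μ(u)² = 1`. -/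
structure WeightedGraph (V E : Type*) [Fintype V] where
  s : E → V
  r : E → V
  rev : E → E
  rev_rev : ∀ e, rev (rev e) = e
  s_rev : ∀ e, s (rev e) = r e
  r_rev : ∀ e, r (rev e) = s e
  μ : V → ℝ
  μ_pos : ∀ u, 0 < μ u
  sum_sq : ∑ u, μ u ^ 2 = 1

namespace WeightedGraph

variable {V E : Type*} [Fintype V] (Γ : WeightedGraph V E)

/-- The edges in the list can be traversed one after the other starting at the given vertex. -/
def IsWalk : V → List E → Prop
  | _, [] => True
  | x, f :: l => Γ.s f = x ∧ IsWalk (Γ.r f) l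

/-- The vertex reached from the given vertex by traversing the edges of the list. -/
def endpoint : V → List E → V
  | x, [] => x
  | _, f :: l => endpoint (Γ.r f) l

/-- The reversed list of reversed edges. -/
def revList (l : List E) : List E := (l.map Γ.rev).reverse

theorem isWalk_append (x : V) (l m : List E) :
    Γ.IsWalk x (l ++ m) ↔ Γ.IsWalk x l ∧ Γ.IsWalk (Γ.endpoint x l) m := by
  induction l generalizing x with
  | nil => simp [IsWalk, endpoint]
  | cons f l ih => simp [IsWalk, endpoint, ih, and_assoc]

theorem endpoint_append (x : V) (l m : List E) :
    Γ.endpoint x (l ++ m) = Γ.endpoint (Γ.endpoint x l) m := by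
  induction l generalizing x with
  | nil => simp [endpoint]
  | cons f l ih => simp [endpoint, ih]

theorem revList_revList (l : List E) : Γ.revList (Γ.revList l) = l := by
  simp [revList, List.map_reverse, Function.comp_def, Γ.rev_rev]

theorem walk_revList (x : V) (l : List E) (h : Γ.IsWalk x l) :
    Γ.IsWalk (Γ.endpoint x l) (Γ.revList l) ∧
      Γ.endpoint (Γ.endpoint x l) (Γ.revList l) = x := by
  induction l generalizing x with
  | nil => simp [IsWalk, endpoint, revList]
  | cons f l ih =>
    obtain ⟨h1, h2⟩ := h
    obtain ⟨h3, h4⟩ := ih _ h2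
    have : Γ.revList (f :: l) = Γ.revList l ++ [Γ.rev f] := by simp [revList]
    simp only [endpoint, this, isWalk_append, endpoint_append, h3, h4, true_and]
    simp [IsWalk, Γ.s_rev, Γ.r_rev, h1]

/-- A path in the graph; its length is the length of its list of edges, and the paths of
length `0` are the vertices. -/
@[ext]
structure Path where
  start : V
  edges : List E
  isWalk : Γ.IsWalk start edges

variable {Γ}

/-- The source of a path. -/
abbrev Path.src (ξ : Γ.Path) : V := ξ.start

/-- The range of a path. -/
def Path.rng (ξ : Γ.Path) : V := Γ.endpoint ξ.start ξ.edges

/-- The length of a path. -/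
def Path.length (ξ : Γ.Path) : ℕ := ξ.edges.length

/-- The reversed path. -/
def Path.reverse (ξ : Γ.Path) : Γ.Path := ⟨ξ.rng, Γ.revList ξ.edges, (Γ.walk_revList _ _ ξ.isWalk).1⟩

variable (Γ)

/-- The path of length `0` at a vertex. -/
def vertexPath (u : V) : Γ.Path := ⟨u, [], trivial⟩

/-- The path of length `1` given by an edge. -/
def edgePath (f : E) : Γ.Path := ⟨Γ.s f, [f], rfl, trivial⟩

variable {Γ}

/-- `ξ` and `η` are composable and the last `k` edges of `ξ` are the reversals of the first `k`
edges of `η`, in opposite order. -/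
def Cancels (ξ η : Γ.Path) (k : ℕ) : Prop :=
  ξ.rng = η.src ∧ ξ.edges.drop (ξ.length - k) = Γ.revList (η.edges.take k)

theorem Cancels.endpoint_eq {ξ η : Γ.Path} {k : ℕ} (h : Cancels ξ η k) :
    Γ.endpoint ξ.start (ξ.edges.take (ξ.length - k)) = Γ.endpoint η.start (η.edges.take k) := by
  obtain ⟨h1, h2⟩ := h
  have hw := ξ.isWalk
  have h3 := h1
  unfold Path.rng at h3
  rw [← List.take_append_drop (ξ.length - k) ξ.edges] at h3 hw
  rw [isWalk_append] at hw
  rw [endpoint_append] at h3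
  have := (Γ.walk_revList _ _ hw.2).2
  rw [h3, h2, revList_revList] at this
  exact this.symm

/-- The path `ξ₁ ⋯ ξ_{m-k} η_{k+1} ⋯ η_n`. -/
def join (ξ η : Γ.Path) (k : ℕ) (h : Cancels ξ η k) : Γ.Path where
  start := ξ.start
  edges := ξ.edges.take (ξ.length - k) ++ η.edges.drop k
  isWalk := by
    have h1 := ξ.isWalk
    have h2 := η.isWalk
    rw [← List.take_append_drop (ξ.length - k) ξ.edges, isWalk_append] at h1
    rw [← List.take_append_drop k η.edges, isWalk_append] at h2
    rw [isWalk_append, h.endpoint_eq]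
    exact ⟨h1.1, h2.2⟩

theorem join_rng (ξ η : Γ.Path) (k : ℕ) (h : Cancels ξ η k) : (join ξ η k h).rng = η.rng := by
  unfold Path.rng join
  simp only
  rw [endpoint_append, h.endpoint_eq, ← endpoint_append, List.take_append_drop]

theorem join_inj (ξ : Γ.Path) (k : ℕ) (η η' : Γ.Path) (h : Cancels ξ η k) (h' : Cancels ξ η' k)
    (e : join ξ η k h = join ξ η' k h') : η = η' := by
  have e2 : (join ξ η k h).edges = (join ξ η' k h').edges := by rw [e]
  have e3 : η.edges.drop k = η'.edges.drop k := List.append_cancel_left e2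
  have e4 : η.edges.take k = η'.edges.take k := by
    rw [← Γ.revList_revList (η.edges.take k), ← h.2, h'.2, revList_revList]
  refine Path.ext (h.1.symm.trans h'.1) ?_
  rw [← List.take_append_drop k η.edges, e3, e4, List.take_append_drop]

variable (Γ)

/-- The vector space `F(Γ) = ⨁ₙ Pₙ(Γ)` with basis the set of all paths. -/
abbrev PathSpace : Type _ := Γ.Path →₀ ℂ

/-- The basis element `[ξ]` of `F(Γ)`. -/
abbrev basisElem {Γ : WeightedGraph V E} (ξ : Γ.Path) : Γ.PathSpace := Finsupp.single ξ 1

open Classical in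
/-- The term `ζ_k` of the product `[ξ] # [η]`. -/
def mulTerm {Γ : WeightedGraph V E} (ξ η : Γ.Path) (k : ℕ) : Γ.PathSpace :=
  if h : Cancels ξ η k then
    ((Γ.μ ξ.rng / Γ.μ (Γ.endpoint ξ.start (ξ.edges.take (ξ.length - k))) : ℝ) : ℂ) •
      basisElem (join ξ η k h)
  else 0

/-- The product `[ξ] # [η] = ∑_{k=0}^{min(m,n)} ζ_k` of two basis elements of `F(Γ)`. -/
def mulBasis {Γ : WeightedGraph V E} (ξ η : Γ.Path) : Γ.PathSpace :=
  ∑ k ∈ Finset.range (min ξ.length η.length + 1), mulTerm ξ η k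

/-- The multiplication `#` of `F(Γ)`, the bilinear extension of `mulBasis`. -/
def mul : Γ.PathSpace →ₗ[ℂ] Γ.PathSpace →ₗ[ℂ] Γ.PathSpace :=
  Finsupp.linearCombination ℂ fun ξ => Finsupp.linearCombination ℂ fun η => mulBasis ξ η

theorem mul_basisElem (ξ η : Γ.Path) : Γ.mul (basisElem ξ) (basisElem η) = mulBasis ξ η := by
  simp [mul]

/-- The involution of `F(Γ)`: the conjugate-linear extension of reversal of paths. -/
def starF (x : Γ.PathSpace) : Γ.PathSpace :=
  x.sum fun ξ a => Finsupp.single ξ.reverse (starRingEnd ℂ a)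

/-- The trace `τ = μ² ∘ φ` on `F(Γ)`. -/
def traceF : Γ.PathSpace →ₗ[ℂ] ℂ :=
  ∑ u, ((Γ.μ u ^ 2 : ℝ) : ℂ) • Finsupp.lapply (Γ.vertexPath u)

/-- The Hilbert space `L²(F(Γ), τ)`, realised as `ℓ²` over its orthonormal basis
`{ξ} = (μ(s(ξ)) μ(r(ξ)))^{-1/2} [ξ]`; see `toL2`, `inner_toL2` and `denseRange_toL2`. -/
abbrev L2 : Type _ := EllTwo Γ.Path

/-- The norm of `[ξ]` in `L²(F(Γ), τ)`. -/
def pathNorm {Γ : WeightedGraph V E} (ξ : Γ.Path) : ℝ := √(Γ.μ ξ.src * Γ.μ ξ.rng)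

/-- The canonical map `F(Γ) → L²(F(Γ), τ)`. -/
def toL2 : Γ.PathSpace →ₗ[ℂ] Γ.L2 :=
  Finsupp.linearCombination ℂ fun ξ => ((pathNorm ξ : ℝ) : ℂ) • EllTwo.delta ξ

theorem toL2_basisElem (ξ : Γ.Path) :
    Γ.toL2 (basisElem ξ) = ((pathNorm ξ : ℝ) : ℂ) • EllTwo.delta ξ := by
  simp [toL2]

theorem pathNorm_pos {Γ : WeightedGraph V E} (ξ : Γ.Path) : 0 < pathNorm ξ :=
  Real.sqrt_pos.2 (mul_pos (Γ.μ_pos _) (Γ.μ_pos _))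

theorem reverse_rng {Γ : WeightedGraph V E} (ξ : Γ.Path) : ξ.reverse.rng = ξ.src :=
  (Γ.walk_revList _ _ ξ.isWalk).2

open Classical in
theorem traceF_basisElem (ζ : Γ.Path) :
    Γ.traceF (basisElem ζ) = if ζ.edges = [] then ((Γ.μ ζ.src ^ 2 : ℝ) : ℂ) else 0 := by
  have h : ∀ u, ζ = Γ.vertexPath u ↔ ζ.edges = [] ∧ ζ.src = u := by
    intro u
    rw [Path.ext_iff]
    simp [vertexPath, and_comm]
  simp only [traceF, LinearMap.sum_apply, LinearMap.smul_apply, Finsupp.lapply_apply,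
    Finsupp.single_apply, h, smul_eq_mul]
  by_cases h2 : ζ.edges = [] <;> simp [h2]

open Classical in
theorem traceF_mul_basis (ξ η : Γ.Path) :
    Γ.traceF (mulBasis ξ.reverse η) = if ξ = η then ((Γ.μ ξ.src * Γ.μ ξ.rng : ℝ) : ℂ) else 0 := by
  have hlen : ξ.reverse.length = ξ.length := by
    simp [Path.reverse, Path.length, revList]
  have hz : ∀ k ∈ Finset.range (min ξ.reverse.length η.length + 1),
      Γ.traceF (mulTerm ξ.reverse η k) ≠ 0 → ξ = η ∧ k = η.length := by
    intro k hk hne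
    have hk' : k ≤ ξ.length ∧ k ≤ η.length := by
      rw [hlen, Finset.mem_range] at hk
      omega
    unfold mulTerm at hne
    split_ifs at hne with h
    · rw [map_smul, traceF_basisElem] at hne
      split_ifs at hne with h2
      · have h3 : (ξ.reverse.edges.take (ξ.reverse.length - k)).length = 0 ∧
            (η.edges.drop k).length = 0 := by
          rw [List.length_eq_zero_iff, List.length_eq_zero_iff]
          exact List.append_eq_nil_iff.1 h2
        rw [List.length_take, List.length_drop] at h3
        change min (ξ.reverse.length - k) ξ.reverse.length = 0 ∧ η.length - k = 0 at h3
        have h4 : k = ξ.length ∧ k = η.length := by omega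
        have h5 := h.2
        rw [hlen, h4.1, Nat.sub_self, List.drop_zero] at h5
        rw [List.take_of_length_le (show η.edges.length ≤ ξ.length from
          (h4.2.symm.trans h4.1).le)] at h5
        have h6 : ξ.edges = η.edges := by
          rw [← Γ.revList_revList ξ.edges, ← Γ.revList_revList η.edges, ← h5]
          rfl
        refine ⟨Path.ext ?_ h6, h4.2⟩
        exact (reverse_rng ξ).symm.trans h.1
      · simp at hne
    · simp at hne
  unfold mulBasis
  rw [map_sum]
  split_ifs with heq
  · subst heq
    rw [Finset.sum_eq_single ξ.length]
    · have hc : Cancels ξ.reverse ξ ξ.length := by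
        refine ⟨reverse_rng ξ, ?_⟩
        rw [hlen, Nat.sub_self, List.drop_zero]
        rw [List.take_of_length_le (show ξ.edges.length ≤ ξ.length from le_rfl)]
        rfl
      have hj : (join ξ.reverse ξ ξ.length hc).edges = [] := by
        simp only [join]
        rw [hlen, Nat.sub_self, List.take_zero,
          List.drop_of_length_le (show ξ.edges.length ≤ ξ.length from le_rfl)]
        rfl
      unfold mulTerm
      rw [dif_pos hc, map_smul, traceF_basisElem, if_pos hj, hlen, Nat.sub_self, List.take_zero,
        reverse_rng]
      have h0 : Γ.μ ξ.rng ≠ 0 := (Γ.μ_pos _).ne'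
      change ((Γ.μ ξ.src / Γ.μ ξ.rng : ℝ) : ℂ) * ((Γ.μ ξ.rng ^ 2 : ℝ) : ℂ) = _
      rw [← Complex.ofReal_mul]
      congr 1
      field_simp
    · intro k hk hne
      by_contra h
      exact hne (hz k hk h).2
    · intro h
      rw [hlen] at h
      simp at h
  · refine Finset.sum_eq_zero fun k hk => ?_
    by_contra h
    exact heq (hz k hk h).1

/-- `toL2` realises `L2` as the completion of `F(Γ)` for the inner product of the trace. -/
theorem inner_toL2 (x y : Γ.PathSpace) :
    (inner ℂ (Γ.toL2 x) (Γ.toL2 y) : ℂ) = Γ.traceF (Γ.mul (Γ.starF x) y) := by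
  classical
  have hadd : ∀ x x' : Γ.PathSpace, Γ.starF (x + x') = Γ.starF x + Γ.starF x' := by
    intro x x'
    unfold starF
    rw [Finsupp.sum_add_index'] <;> simp
  induction x using Finsupp.induction_linear with
  | zero => simp [starF]
  | add x x' hx hx' => rw [map_add, inner_add_left, hx, hx', hadd]; simp
  | single ξ a =>
    induction y using Finsupp.induction_linear with
    | zero => simp
    | add y y' hy hy' => rw [map_add, inner_add_right, hy, hy']; simp
    | single η b =>
      have h1 : Γ.starF (Finsupp.single ξ a) = starRingEnd ℂ a • basisElem ξ.reverse := by
        simp [starF]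
      have h2 : Finsupp.single η b = b • basisElem η := by simp
      have h3 : Finsupp.single ξ a = a • basisElem ξ := by simp
      rw [h1, h2, h3, map_smul, map_smul, map_smul, map_smul, map_smul, LinearMap.smul_apply,
        map_smul, mul_basisElem, traceF_mul_basis, toL2_basisElem, toL2_basisElem]
      simp only [inner_smul_left, inner_smul_right, EllTwo.inner_delta, smul_eq_mul]
      by_cases h : ξ = η
      · subst h
        have : ((pathNorm ξ : ℝ) : ℂ) * ((pathNorm ξ : ℝ) : ℂ) =
            ((Γ.μ ξ.src * Γ.μ ξ.rng : ℝ) : ℂ) := by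
          rw [← Complex.ofReal_mul]
          congr 1
          exact Real.mul_self_sqrt (mul_pos (Γ.μ_pos _) (Γ.μ_pos _)).le
        simp only [if_true, ← this, Complex.conj_ofReal]
        ring
      · simp [h]

theorem denseRange_toL2 : DenseRange Γ.toL2 := by
  change Dense (Γ.toL2.range : Set Γ.L2)
  rw [Submodule.dense_iff_topologicalClosure_eq_top, Submodule.topologicalClosure_eq_top_iff,
    Submodule.eq_bot_iff]
  intro x hx
  refine EllTwo.eq_zero_of_inner_delta x fun ξ => ?_
  have h := (Submodule.mem_orthogonal _ _).1 hx (Γ.toL2 (basisElem ξ)) ⟨_, rfl⟩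
  rw [toL2_basisElem, inner_smul_left] at h
  have h0 : ((pathNorm ξ : ℝ) : ℂ) ≠ 0 := by
    exact_mod_cast (pathNorm_pos ξ).ne'
  simpa [h0] using h

/-- Left multiplication by an element of `F(Γ)` is bounded on `L²(F(Γ), τ)`. -/
theorem exists_leftMul (x : Γ.PathSpace) :
    ∃ T : Γ.L2 →L[ℂ] Γ.L2, ∀ y, T (Γ.toL2 y) = Γ.toL2 (Γ.mul x y) := by
  classical
  induction x using Finsupp.induction_linear with
  | zero => exact ⟨0, fun y => by simp⟩
  | add x x' hx hx' =>
    obtain ⟨T, hT⟩ := hx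
    obtain ⟨T', hT'⟩ := hx'
    exact ⟨T + T', fun y => by simp [hT, hT']⟩
  | single ξ a =>
    have key : ∀ k : ℕ, ∃ T : Γ.L2 →L[ℂ] Γ.L2, ∀ η : Γ.Path, T (Γ.toL2 (basisElem η)) =
        if k ≤ min ξ.length η.length then Γ.toL2 (mulTerm ξ η k) else 0 := by
      intro k
      obtain ⟨T, hT, hT'⟩ := EllTwo.exists_partial
        (fun η : Γ.Path => Cancels ξ η k ∧ k ≤ min ξ.length η.length)
        (fun η h => join ξ η k h.1) (fun η η' h h' e => join_inj ξ k η η' h.1 h'.1 e)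
      refine ⟨(((Γ.μ ξ.rng / Γ.μ (Γ.endpoint ξ.start (ξ.edges.take (ξ.length - k)))) *
        (√(Γ.μ ξ.src) / √(Γ.μ ξ.rng)) : ℝ) : ℂ) • T, fun η => ?_⟩
      rw [toL2_basisElem, _root_.smul_apply, map_smul]
      by_cases h2 : k ≤ min ξ.length η.length
      · rw [if_pos h2]
        by_cases h : Cancels ξ η k
        · rw [hT η ⟨h, h2⟩, mulTerm, dif_pos h, map_smul, toL2_basisElem, smul_smul, smul_smul]
          congr 1
          rw [← Complex.ofReal_mul, ← Complex.ofReal_mul]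
          congr 1
          unfold pathNorm
          rw [join_rng, ← h.1, Real.sqrt_mul (Γ.μ_pos _).le, Real.sqrt_mul (Γ.μ_pos _).le]
          have h0 : √(Γ.μ ξ.rng) ≠ 0 := (Real.sqrt_pos.2 (Γ.μ_pos _)).ne'
          change _ = Γ.μ ξ.rng / _ * (√(Γ.μ ξ.src) * _)
          field_simp
        · rw [hT' η (fun hh => h hh.1), mulTerm, dif_neg h]
          simp
      · rw [if_neg h2, hT' η (fun hh => h2 hh.2)]
        simp
    choose T hT using key
    refine ⟨a • ∑ k ∈ Finset.range (ξ.length + 1), T k, fun y => ?_⟩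
    induction y using Finsupp.induction_linear with
    | zero => simp
    | add y y' hy hy' => rw [map_add, map_add, hy, hy', map_add, map_add]
    | single η b =>
      have h2 : Finsupp.single η b = b • basisElem η := by simp
      have h3 : Finsupp.single ξ a = a • basisElem ξ := by simp
      rw [h2, h3]
      simp only [map_smul, LinearMap.smul_apply, _root_.smul_apply,
        mul_basisElem]
      congr 2
      rw [_root_.sum_apply, mulBasis, map_sum]
      simp only [hT]
      rw [← Finset.sum_filter]
      refine Finset.sum_congr ?_ fun _ _ => rfl
      ext k
      simp only [Finset.mem_filter, Finset.mem_range]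
      omega

/-- The left regular representation `λ` of `F(Γ)` on `L²(F(Γ), τ)`: `lam x` is the unique
bounded operator with `lam x (y) = x # y` for `y ∈ F(Γ)`. -/
def lam (x : Γ.PathSpace) : Γ.L2 →L[ℂ] Γ.L2 := (Γ.exists_leftMul x).choose

theorem lam_toL2 (x y : Γ.PathSpace) : Γ.lam x (Γ.toL2 y) = Γ.toL2 (Γ.mul x y) :=
  (Γ.exists_leftMul x).choose_spec y

theorem lam_unique (x : Γ.PathSpace) (T : Γ.L2 →L[ℂ] Γ.L2)
    (h : ∀ y, T (Γ.toL2 y) = Γ.toL2 (Γ.mul x y)) : T = Γ.lam x := by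
  apply ContinuousLinearMap.coeFn_injective
  refine Γ.denseRange_toL2.equalizer T.continuous (Γ.lam x).continuous ?_
  ext1 y
  simp [h, lam_toL2]

/-- The von Neumann algebra `M(Γ, μ) = λ(F(Γ))''`. -/
def vN : VonNeumannAlgebra Γ.L2 := generatedVN (Set.range Γ.lam)

theorem lam_mem (x : Γ.PathSpace) : Γ.lam x ∈ Γ.vN := subset_generatedVN _ ⟨x, rfl⟩

/-- The trace on `M(Γ, μ)` (as a functional on operators): the vector state given by the image
of the unit `∑ u, [u]` of `F(Γ)`, which extends `τ`. -/
def trace (T : Γ.L2 →L[ℂ] Γ.L2) : ℂ :=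
  inner ℂ (Γ.toL2 (∑ u, basisElem (Γ.vertexPath u)))
    (T (Γ.toL2 (∑ u, basisElem (Γ.vertexPath u))))

/-- The operator `p_u = λ([u])`. -/
def vertexProj (u : V) : Γ.L2 →L[ℂ] Γ.L2 := Γ.lam (basisElem (Γ.vertexPath u))

/-- The operator `λ(f)`, for an edge `f`. -/
def edgeOp (f : E) : Γ.L2 →L[ℂ] Γ.L2 := Γ.lam (basisElem (Γ.edgePath f))

open Classical in
theorem mulBasis_vertexPath_left (u : V) (η : Γ.Path) :
    mulBasis (Γ.vertexPath u) η = if u = η.src then basisElem η else 0 := by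
  have h0 : Γ.μ u ≠ 0 := (Γ.μ_pos _).ne'
  have hl : (Γ.vertexPath u).length = 0 := rfl
  unfold mulBasis
  rw [hl, Nat.zero_min, zero_add, Finset.sum_range_one, mulTerm]
  by_cases h : u = η.src
  · have hc : Cancels (Γ.vertexPath u) η 0 := ⟨h, by simp [vertexPath, revList]⟩
    have hj : join (Γ.vertexPath u) η 0 hc = η := by
      apply Path.ext
      · exact h
      · simp [join, vertexPath]
    rw [dif_pos hc, if_pos h, hj]
    simp [vertexPath, Path.rng, endpoint, h0]
  · rw [dif_neg (fun hc => h hc.1), if_neg h]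

open Classical in
theorem mulBasis_vertexPath_right (ξ : Γ.Path) (u : V) :
    mulBasis ξ (Γ.vertexPath u) = if ξ.rng = u then basisElem ξ else 0 := by
  have h0 : Γ.μ ξ.rng ≠ 0 := (Γ.μ_pos _).ne'
  have hl : (Γ.vertexPath u).length = 0 := rfl
  have ht : ξ.edges.take ξ.length = ξ.edges := List.take_length
  unfold mulBasis
  rw [hl, Nat.min_zero, zero_add, Finset.sum_range_one, mulTerm]
  by_cases h : ξ.rng = u
  · have hc : Cancels ξ (Γ.vertexPath u) 0 :=
      ⟨h, by rw [Nat.sub_zero, show ξ.length = ξ.edges.length from rfl]; simp [revList]⟩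
    have hj : join ξ (Γ.vertexPath u) 0 hc = ξ := by
      apply Path.ext
      · rfl
      · simp [join, vertexPath, ht]
    rw [dif_pos hc, if_pos h, hj, Nat.sub_zero, ht]
    change ((Γ.μ ξ.rng / Γ.μ ξ.rng : ℝ) : ℂ) • _ = _
    simp [h0]
  · rw [dif_neg (fun hc => h hc.1), if_neg h]

/-- `trace` extends `τ`. -/
theorem trace_lam (x : Γ.PathSpace) : Γ.trace (Γ.lam x) = Γ.traceF x := by
  classical
  unfold trace
  rw [lam_toL2, inner_toL2]
  have h1 : Γ.starF (∑ u, basisElem (Γ.vertexPath u)) = ∑ u, basisElem (Γ.vertexPath u) := by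
    unfold starF
    rw [← Finsupp.sum_finsetSum_index (by simp) (by simp)]
    refine Finset.sum_congr rfl fun u _ => ?_
    rw [Finsupp.sum_single_index (by simp)]
    simp only [map_one]
    rfl
  have hl : ∀ y, Γ.mul (∑ u, basisElem (Γ.vertexPath u)) y = y := by
    intro y
    induction y using Finsupp.induction_linear with
    | zero => simp
    | add y y' hy hy' => rw [map_add, hy, hy']
    | single η b =>
      have h2 : Finsupp.single η b = b • basisElem η := by simp
      rw [h2, map_smul, map_sum, LinearMap.sum_apply]
      simp only [mul_basisElem, mulBasis_vertexPath_left]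
      simp
  have hr : Γ.mul x (∑ u, basisElem (Γ.vertexPath u)) = x := by
    induction x using Finsupp.induction_linear with
    | zero => simp
    | add y y' hy hy' => rw [map_add, LinearMap.add_apply, hy, hy']
    | single η b =>
      have h2 : Finsupp.single η b = b • basisElem η := by simp
      rw [h2, map_smul, LinearMap.smul_apply, map_sum]
      simp only [mul_basisElem, mulBasis_vertexPath_right]
      simp
  rw [h1, hl, hr]

theorem isIdempotentElem_vertexProj (u : V) : IsIdempotentElem (Γ.vertexProj u) := by
  classical
  apply ContinuousLinearMap.coeFn_injective
  refine Γ.denseRange_toL2.equalizer (Γ.vertexProj u * Γ.vertexProj u).continuous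
    (Γ.vertexProj u).continuous ?_
  ext1 y
  change Γ.vertexProj u (Γ.vertexProj u (Γ.toL2 y)) = Γ.vertexProj u (Γ.toL2 y)
  unfold vertexProj
  rw [lam_toL2, lam_toL2]
  congr 1
  induction y using Finsupp.induction_linear with
  | zero => simp
  | add y y' hy hy' => rw [map_add, map_add, hy, hy']
  | single η b =>
    have h2 : Finsupp.single η b = b • basisElem η := by simp
    rw [h2]
    simp only [map_smul, mul_basisElem, mulBasis_vertexPath_left]
    by_cases h : u = η.src
    · rw [if_pos h, mul_basisElem, mulBasis_vertexPath_left, if_pos h]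
    · rw [if_neg h, map_zero]

/-- The closed subspace `H_u = ran p_u`. -/
def vertexSpace (u : V) : Submodule ℂ Γ.L2 := (Γ.vertexProj u).range

instance (u : V) : CompleteSpace (Γ.vertexSpace u) :=
  (ContinuousLinearMap.IsIdempotentElem.isClosed_range
    (Γ.isIdempotentElem_vertexProj u)).completeSpace_coe

end WeightedGraph

end

/-!
In the graph with the vertices `v`, `w` and the edges `e`, `ẽ` there is exactly one path of each
length at each vertex, the alternating path `altPath`. So `ran p_v` and `ran p_w` are copies of
`ℓ²(ℕ)`, and the edges generate `λ(F(Γ))` together with the vertices, because the product of an edge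
and an alternating path has at most two terms (`IsTwoCycle.mem_vN_iff`). With `α² = μ(v)/μ(w) ≥ 1`
one has `λ(e) δ_n = α δ_{n+1} + α⁻¹ δ_{n-1}` on the paths starting at `w`, and the same with `α`
and `α⁻¹` interchanged for `λ(ẽ) = λ(e)*` on the paths starting at `v` (`edgeOp_pathVec_rev`).

*The spectrum of `t*t`.* On the span of the odd paths at `w`, `t*t` is the Jacobi matrix with
constant diagonal `c = α² + α⁻² ≥ 2` and off-diagonal entries `1`. The sine functions
`√2 sin(π(k+1)x)` are an orthonormal basis of `L²(0,1]` in which `c + 2 cos(πx)` has the same matrix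
(`modelOp_sq_sineVec`, `edgeOp_edgeOp_oddIsometry`). As `L²(0,1]` is `L²` of the circle and hence
`ℓ²(ℤ)` (`fourierEquiv`), `|t|` acts there as `a`, multiplication by `√(c + 2 cos(πx))`, an element of
`Lℤ`. On the even paths at `w` the same holds: `tt*` acts on the odd paths at `v` by the same Jacobi
matrix, and `t*` maps these onto a dense subspace of the span of the even paths at `w`, because `t` is
injective. So `ran p_w` is a sum of two copies of `ℓ²(ℤ)` on which `|t|` is `a`
(`IsTwoCycle.exists_isDecomposition`). The function `cos(πx)` is injective on `(0,1]` and its inverse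
is absolutely continuous; so `a` has absolutely continuous spectrum, and the coordinate `e^{2πix}` is
a continuous function of `a` (`coordOp_eq_cfc`). As the commutant of the coordinate consists of
multiplication operators (`exists_eq_mulOp`), `a` generates `Lℤ`, which is maximal abelian.

*The kernels.* A vector killed by `t` or by `t*` has vanishing coordinates at the odd paths, and at
the even paths `x_{n+2} = -α^{±2} x_n`. By square summability `t` is injective, and `ker t*` is zero if
`α = 1` and is spanned by `∑ (-α⁻²)^j δ_{2j}` if `α > 1`. The norm of this vector gives the trace of
`z` (`IsTwoCycle.trace_cokerProj`).

*The algebra.* The two copies of `ℓ²(ℤ)` in `ran p_w` and their images under `u` decompose the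
complement of `ker t*` (`IsMatrixFrame`), and in this frame `λ(e)` is `a` times a matrix unit. An
operator commuting with the generators commutes with `z` and is constant along the matrix index, with
entries commuting with `a`. Since `z` has rank at most one, the double commutant consists of the
operators `λz + y` with `y ∈ M₂(Lℤ)` (`IsMatrixFrame.mem_iff`), which is the isomorphism
(`existsUnique_starAlgEquiv_prod`, `existsUnique_starAlgEquiv_matrix`).

*Uniqueness.* No normality is assumed, so it does not suffice that `a` generates `Lℤ` as a von Neumann
algebra. An automorphism of `Lℤ` fixing `a` fixes the coordinate and all continuous functions on the
circle. It fixes the indicator function of a closed set, which generates the annihilator of a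
continuous function. If it moved some function, the new and the old function would take values in
a disc and outside of it on a closed set of positive measure, against contractivity
(`starAlgEquiv_LZ_apply_eq`).
-/

open scoped ComplexInnerProductSpace InnerProduct
set_option linter.unusedSectionVars false

noncomputable section

/-! ### Multiplication operators on `L²` -/

section MulOp

open MeasureTheory
open scoped ENNReal

variable {α : Type*} [MeasurableSpace α] {μ : Measure α}

open Classical in
/-- The operator of multiplication by an essentially bounded function `f` on `L²(μ)`; it is set to
`0` when `f` is not essentially bounded. -/
def mulOp (μ : Measure α) (f : α → ℂ) : Lp ℂ 2 μ →L[ℂ] Lp ℂ 2 μ :=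
  if hf : MemLp f ∞ μ then
    LinearMap.mkContinuous
      { toFun := (hf.toLp f • · : Lp ℂ 2 μ → Lp ℂ 2 μ)
        map_add' := fun _ _ => Lp.add_smul _ _ _
        map_smul' := fun c _ => (Lp.smul_comm c _ _).symm } ‖hf.toLp f‖
      fun _ => Lp.norm_smul_le _ _
  else 0

theorem coeFn_mulOp {f : α → ℂ} (hf : MemLp f ∞ μ) (g : Lp ℂ 2 μ) :
    mulOp μ f g =ᵐ[μ] fun x => f x * g x := by
  rw [mulOp, dif_pos hf]
  change ((hf.toLp f • g : Lp ℂ 2 μ) : α → ℂ) =ᵐ[μ] _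
  filter_upwards [Lp.coeFn_lpSMul (r := 2) (hf.toLp f) g, hf.coeFn_toLp] with x h1 h2
  rw [h1, Pi.smul_apply', h2, smul_eq_mul]

theorem mulOp_eq_of_ae {f : α → ℂ} (hf : MemLp f ∞ μ) {T : Lp ℂ 2 μ →L[ℂ] Lp ℂ 2 μ}
    (h : ∀ g : Lp ℂ 2 μ, T g =ᵐ[μ] fun x => f x * g x) : mulOp μ f = T := by
  ext1 g
  apply Lp.ext
  exact (coeFn_mulOp hf g).trans (h g).symm

theorem mulOp_congr {f f' : α → ℂ} (hf : MemLp f ∞ μ) (h : f =ᵐ[μ] f') :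
    mulOp μ f = mulOp μ f' := by
  refine mulOp_eq_of_ae hf fun g => ?_
  filter_upwards [coeFn_mulOp ((memLp_congr_ae h).1 hf) g, h] with x h1 h2
  rw [h1, h2]

theorem mulOp_add {f f' : α → ℂ} (hf : MemLp f ∞ μ) (hf' : MemLp f' ∞ μ) :
    mulOp μ (fun x => f x + f' x) = mulOp μ f + mulOp μ f' := by
  refine mulOp_eq_of_ae (hf.add hf') fun g => ?_
  filter_upwards [coeFn_mulOp hf g, coeFn_mulOp hf' g,
    Lp.coeFn_add (mulOp μ f g) (mulOp μ f' g)] with x h1 h2 h3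
  rw [_root_.add_apply, h3, Pi.add_apply, h1, h2]
  exact (add_mul _ _ _).symm

theorem mulOp_mul {f f' : α → ℂ} (hf : MemLp f ∞ μ) (hf' : MemLp f' ∞ μ) :
    mulOp μ (fun x => f x * f' x) = mulOp μ f * mulOp μ f' := by
  refine mulOp_eq_of_ae (hf'.mul hf) fun g => ?_
  filter_upwards [coeFn_mulOp hf (mulOp μ f' g), coeFn_mulOp hf' g] with x h1 h2
  rw [mul_apply_eq_comp, h1, h2]
  exact (mul_assoc _ _ _).symm

theorem mulOp_const (c : ℂ) : mulOp μ (fun _ => c) = c • 1 := by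
  refine mulOp_eq_of_ae (memLp_top_const c) fun g => ?_
  filter_upwards [Lp.coeFn_smul c g] with x h1
  rw [_root_.smul_apply, one_apply_eq_self, h1, Pi.smul_apply, smul_eq_mul]

theorem mulOp_smul (c : ℂ) {f : α → ℂ} (hf : MemLp f ∞ μ) :
    mulOp μ (fun x => c * f x) = c • mulOp μ f := by
  rw [mulOp_mul (memLp_top_const c) hf, mulOp_const, smul_one_mul]

theorem mulOp_sub {f f' : α → ℂ} (hf : MemLp f ∞ μ) (hf' : MemLp f' ∞ μ) :
    mulOp μ (fun x => f x - f' x) = mulOp μ f - mulOp μ f' := by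
  refine mulOp_eq_of_ae (hf.sub hf') fun g => ?_
  filter_upwards [coeFn_mulOp hf g, coeFn_mulOp hf' g,
    Lp.coeFn_sub (mulOp μ f g) (mulOp μ f' g)] with x h1 h2 h3
  rw [_root_.sub_apply, h3, Pi.sub_apply, h1, h2]
  exact (sub_mul _ _ _).symm

theorem memLp_conj {f : α → ℂ} {p : ℝ≥0∞} (hf : MemLp f p μ) :
    MemLp (fun x => starRingEnd ℂ (f x)) p μ := hf.star

theorem star_mulOp {f : α → ℂ} (hf : MemLp f ∞ μ) :
    star (mulOp μ f) = mulOp μ (fun x => starRingEnd ℂ (f x)) := by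
  rw [ContinuousLinearMap.star_eq_adjoint, eq_comm, ContinuousLinearMap.eq_adjoint_iff]
  intro g g'
  rw [L2.inner_def, L2.inner_def]
  refine integral_congr_ae ?_
  filter_upwards [coeFn_mulOp hf g', coeFn_mulOp (memLp_conj hf) g] with x h1 h2
  rw [h1, h2]
  simp only [RCLike.inner_apply, map_mul, Complex.conj_conj]
  ring

theorem inner_mulOp {f : α → ℂ} (hf : MemLp f ∞ μ) (g : Lp ℂ 2 μ) :
    inner ℂ g (mulOp μ f g) = ∫ x, f x * (‖g x‖ ^ 2 : ℝ) ∂μ := by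
  rw [L2.inner_def]
  refine integral_congr_ae ?_
  filter_upwards [coeFn_mulOp hf g] with x h1
  rw [h1]
  simp only [RCLike.inner_apply]
  rw [mul_assoc, Complex.mul_conj, Complex.normSq_eq_norm_sq]

theorem norm_mulOp_le {f : α → ℂ} (hf : MemLp f ∞ μ) {C : ℝ} (hC : 0 ≤ C)
    (h : ∀ᵐ x ∂μ, ‖f x‖ ≤ C) : ‖mulOp μ f‖ ≤ C := by
  refine ContinuousLinearMap.opNorm_le_bound _ hC fun g => ?_
  refine Lp.norm_le_mul_norm_of_ae_le_mul ?_
  filter_upwards [coeFn_mulOp hf g, h] with x h1 h2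
  rw [h1, norm_mul]
  gcongr

theorem mulOp_inj [IsFiniteMeasure μ] {f f' : α → ℂ} (hf : MemLp f ∞ μ) (hf' : MemLp f' ∞ μ)
    (h : mulOp μ f = mulOp μ f') : f =ᵐ[μ] f' := by
  have h1 := coeFn_mulOp hf ((memLp_const (1 : ℂ)).toLp _)
  have h2 := coeFn_mulOp hf' ((memLp_const (1 : ℂ)).toLp _)
  rw [h] at h1
  filter_upwards [h1, h2, (memLp_const (μ := μ) (p := 2) (1 : ℂ)).coeFn_toLp] with x e1 e2 e3
  rw [e2, e3] at e1
  simpa using e1.symm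

/-- A continuous function of a bounded measurable function is essentially bounded. -/
theorem memLp_top_comp {g : α → ℝ} (hg : Measurable g) {R : ℝ} (hR : ∀ x, |g x| ≤ R)
    {h : ℝ → ℝ} (hh : Continuous h) : MemLp (fun x => ((h (g x) : ℝ) : ℂ)) ∞ μ := by
  obtain ⟨C, hC⟩ := (isCompact_Icc (a := -R) (b := R)).exists_bound_of_continuousOn hh.continuousOn
  refine memLp_top_of_bound (C := C) ?_ (ae_of_all _ fun x => ?_)
  · exact (Complex.measurable_ofReal.comp (hh.measurable.comp hg)).aestronglyMeasurable
  · simpa using hC (g x) (abs_le.1 (hR x))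

variable {K : Type*} [NormedAddCommGroup K] [InnerProductSpace ℂ K] [CompleteSpace K]

/-- Multiplication by `f`, transported to a Hilbert space `K` along a unitary `e : L²(μ) ≃ K`. -/
def mulOn (e : Lp ℂ 2 μ ≃ₗᵢ[ℂ] K) (f : α → ℂ) : K →L[ℂ] K := e.conjStarAlgEquiv (mulOp μ f)

variable (e : Lp ℂ 2 μ ≃ₗᵢ[ℂ] K)

theorem mulOn_apply (f : α → ℂ) (y : K) : mulOn e f y = e (mulOp μ f (e.symm y)) := rfl

theorem mulOn_congr {f f' : α → ℂ} (hf : MemLp f ∞ μ) (h : f =ᵐ[μ] f') :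
    mulOn e f = mulOn e f' := by
  rw [mulOn, mulOp_congr hf h, mulOn]

theorem mulOn_add {f f' : α → ℂ} (hf : MemLp f ∞ μ) (hf' : MemLp f' ∞ μ) :
    mulOn e (fun x => f x + f' x) = mulOn e f + mulOn e f' := by
  rw [mulOn, mulOp_add hf hf', map_add, mulOn, mulOn]

theorem mulOn_sub {f f' : α → ℂ} (hf : MemLp f ∞ μ) (hf' : MemLp f' ∞ μ) :
    mulOn e (fun x => f x - f' x) = mulOn e f - mulOn e f' := by
  rw [mulOn, mulOp_sub hf hf', map_sub, mulOn, mulOn]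

theorem mulOn_mul {f f' : α → ℂ} (hf : MemLp f ∞ μ) (hf' : MemLp f' ∞ μ) :
    mulOn e (fun x => f x * f' x) = mulOn e f * mulOn e f' := by
  rw [mulOn, mulOp_mul hf hf', map_mul, mulOn, mulOn]

theorem commute_mulOn {f f' : α → ℂ} (hf : MemLp f ∞ μ) (hf' : MemLp f' ∞ μ) :
    Commute (mulOn e f) (mulOn e f') := by
  rw [Commute, SemiconjBy, ← mulOn_mul e hf hf', ← mulOn_mul e hf' hf]
  simp only [mul_comm]

theorem mulOn_const (c : ℂ) : mulOn e (fun _ => c) = c • 1 := by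
  rw [mulOn, mulOp_const, map_smul, map_one]

theorem mulOn_smul (c : ℂ) {f : α → ℂ} (hf : MemLp f ∞ μ) :
    mulOn e (fun x => c * f x) = c • mulOn e f := by
  rw [mulOn, mulOp_smul c hf, map_smul, mulOn]

theorem star_mulOn {f : α → ℂ} (hf : MemLp f ∞ μ) :
    star (mulOn e f) = mulOn e (fun x => starRingEnd ℂ (f x)) := by
  rw [mulOn, ← map_star, star_mulOp hf, mulOn]

theorem norm_mulOn_le {f : α → ℂ} (hf : MemLp f ∞ μ) {C : ℝ} (hC : 0 ≤ C)
    (h : ∀ᵐ x ∂μ, ‖f x‖ ≤ C) : ‖mulOn e f‖ ≤ C := by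
  refine ContinuousLinearMap.opNorm_le_bound _ hC fun y => ?_
  rw [mulOn_apply, e.norm_map]
  refine ((mulOp μ f).le_of_opNorm_le (norm_mulOp_le hf hC h) _).trans ?_
  rw [e.symm.norm_map]

theorem mulOn_inj [IsFiniteMeasure μ] {f f' : α → ℂ} (hf : MemLp f ∞ μ) (hf' : MemLp f' ∞ μ)
    (h : mulOn e f = mulOn e f') : f =ᵐ[μ] f' :=
  mulOp_inj hf hf' (e.conjStarAlgEquiv.injective h)

theorem inner_mulOn {f : α → ℂ} (hf : MemLp f ∞ μ) (y : K) :
    inner ℂ y (mulOn e f y) = ∫ x, f x * (‖e.symm y x‖ ^ 2 : ℝ) ∂μ := by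
  rw [← inner_mulOp hf, mulOn_apply, ← e.symm.inner_map_map, e.symm_apply_apply]

theorem isSelfAdjoint_mulOn_ofReal {f : α → ℝ} (hf : MemLp (fun x => (f x : ℂ)) ∞ μ) :
    IsSelfAdjoint (mulOn e fun x => (f x : ℂ)) := by
  rw [isSelfAdjoint_iff, star_mulOn e hf]
  simp

theorem isPositive_mulOn {f : α → ℝ} (hf : MemLp (fun x => (f x : ℂ)) ∞ μ) (h : ∀ x, 0 ≤ f x) :
    (mulOn e fun x => (f x : ℂ)).IsPositive := by
  rw [ContinuousLinearMap.isPositive_iff_complex]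
  intro y
  have hsa := isSelfAdjoint_mulOn_ofReal e hf
  have : inner ℂ (mulOn e (fun x => (f x : ℂ)) y) y
      = ((∫ x, f x * ‖e.symm y x‖ ^ 2 ∂μ : ℝ) : ℂ) := by
    have e : inner ℂ (mulOn e (fun x => (f x : ℂ)) y) y
        = inner ℂ y (mulOn e (fun x => (f x : ℂ)) y) := by
      conv_rhs => rw [← hsa.star_eq, ContinuousLinearMap.star_eq_adjoint,
        ContinuousLinearMap.adjoint_inner_right]
    rw [e, inner_mulOn _ hf, ← integral_complex_ofReal]
    simp
  rw [this]
  refine ⟨by simp, ?_⟩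
  simp only [RCLike.re_to_complex, Complex.ofReal_re]
  exact integral_nonneg fun x => mul_nonneg (h x) (sq_nonneg _)

theorem aeval_mulOn {g : α → ℝ} (hg : Measurable g) {R : ℝ} (hR : ∀ x, |g x| ≤ R)
    (p : Polynomial ℝ) :
    Polynomial.aeval (mulOn e fun x => (g x : ℂ)) p = mulOn e fun x => ((p.eval (g x) : ℝ) : ℂ) := by
  have hg' : MemLp (fun x => (g x : ℂ)) ∞ μ := memLp_top_comp hg hR continuous_id
  have hp : ∀ q : Polynomial ℝ, MemLp (fun x => ((q.eval (g x) : ℝ) : ℂ)) ∞ μ :=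
    fun q => memLp_top_comp hg hR q.continuous
  induction p using Polynomial.induction_on with
  | C a =>
    simp only [Polynomial.aeval_C, Polynomial.eval_C]
    rw [mulOn_const, Algebra.algebraMap_eq_smul_one]
    exact (RCLike.real_smul_eq_coe_smul (K := ℂ) a (1 : K →L[ℂ] K))
  | add p q h1 h2 =>
    rw [map_add, h1, h2, ← mulOn_add e (hp p) (hp q)]
    simp
  | monomial n a ih =>
    rw [pow_succ, ← mul_assoc, map_mul, ih, Polynomial.aeval_X, ← mulOn_mul e (hp _) hg']
    simp

/-- The continuous functional calculus of a multiplication operator is composition of functions: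
both sides agree for polynomials, and polynomials are uniformly dense. -/
theorem cfc_mulOn {g : α → ℝ} (hg : Measurable g) {R : ℝ} (hR : ∀ x, |g x| ≤ R)
    {h : ℝ → ℝ} (hh : Continuous h) :
    cfc h (mulOn e fun x => (g x : ℂ)) = mulOn e fun x => ((h (g x) : ℝ) : ℂ) := by
  have hg' : MemLp (fun x => (g x : ℂ)) ∞ μ := memLp_top_comp hg hR continuous_id
  have hsa : IsSelfAdjoint (mulOn e fun x => (g x : ℂ)) := isSelfAdjoint_mulOn_ofReal e hg'
  rcases isEmpty_or_nonempty α with hα | ⟨⟨x₀⟩⟩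
  · have : ∀ S T : K →L[ℂ] K, S = T := fun S T => by
      ext1 y
      apply e.symm.injective
      apply Lp.ext
      have : μ = 0 := Measure.eq_zero_of_isEmpty μ
      subst this
      exact Filter.Eventually.of_forall fun x => (hα.false x).elim
    exact this _ _
  have hR0 : 0 ≤ R := (abs_nonneg _).trans (hR x₀)
  have hspec : spectrum ℝ (mulOn e fun x => (g x : ℂ)) ⊆ Set.Icc (-R) R := by
    intro y hy
    have := spectrum.norm_le_norm_mul_of_mem hy
    have h2 : ‖mulOn e fun x => (g x : ℂ)‖ ≤ R :=
      norm_mulOn_le e hg' hR0 (ae_of_all _ fun x => by simpa using hR x)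
    have h3 : ‖(1 : K →L[ℂ] K)‖ ≤ 1 := ContinuousLinearMap.norm_id_le
    have h4 : ‖y‖ ≤ R := by
      refine this.trans ?_
      calc _ ≤ R * 1 := by gcongr
        _ = R := mul_one R
    exact abs_le.1 h4
  refine eq_of_forall_dist_le fun ε hε => ?_
  obtain ⟨p, hp⟩ := exists_polynomial_near_of_continuousOn (-R) R h hh.continuousOn (ε / 2)
    (half_pos hε)
  have e1 : ‖cfc h (mulOn e fun x => (g x : ℂ)) - cfc p.eval (mulOn e fun x => (g x : ℂ))‖
      ≤ ε / 2 := by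
    rw [← cfc_sub h p.eval _ hh.continuousOn p.continuous.continuousOn]
    refine norm_cfc_le (half_pos hε).le fun y hy => ?_
    rw [norm_sub_rev]
    exact (hp y (hspec hy)).le
  have e2 : ‖(mulOn e fun x => ((p.eval (g x) : ℝ) : ℂ)) - mulOn e fun x => ((h (g x) : ℝ) : ℂ)‖
      ≤ ε / 2 := by
    have m1 := memLp_top_comp (μ := μ) hg hR p.continuous
    have m2 := memLp_top_comp (μ := μ) hg hR hh
    rw [← mulOn_sub e m1 m2]
    refine norm_mulOn_le e (m1.sub m2) (half_pos hε).le (ae_of_all _ fun x => ?_)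
    change ‖((p.eval (g x) : ℝ) : ℂ) - ((h (g x) : ℝ) : ℂ)‖ ≤ ε / 2
    rw [← Complex.ofReal_sub, Complex.norm_real]
    exact (hp (g x) (abs_le.1 (hR x))).le
  rw [cfc_polynomial p _ hsa, aeval_mulOn e hg hR] at e1
  rw [dist_eq_norm]
  calc _ = ‖(cfc h (mulOn e fun x => (g x : ℂ)) - mulOn e fun x => ((p.eval (g x) : ℝ) : ℂ)) +
        ((mulOn e fun x => ((p.eval (g x) : ℝ) : ℂ)) -
          mulOn e fun x => ((h (g x) : ℝ) : ℂ))‖ := by congr 1; abel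
    _ ≤ _ := (norm_add_le _ _).trans (by linarith)

/-- A finite measure which integrates continuous functions to the matrix coefficients of the
functional calculus is automatically carried by the spectrum: test it against the distance to the
spectrum. -/
theorem isScalarSpectralMeasure_of_integral {a : K →L[ℂ] K} (y : K) {ν : Measure ℝ}
    [IsFiniteMeasure ν]
    (h : ∀ f : ℝ → ℝ, Continuous f → ((∫ x, f x ∂ν : ℝ) : ℂ) = inner ℂ y (cfc f a y)) :
    IsScalarSpectralMeasure a y ν := by
  refine ⟨inferInstance, ?_, h⟩
  have key : ∀ f : ℝ → ℝ, Continuous f → (∀ x, 0 ≤ f x) → (∀ x, f x ≤ 1) →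
      (∀ x ∈ spectrum ℝ a, f x = 0) → f =ᵐ[ν] 0 := by
    intro f hf h0 h1 hs
    have e1 := h f hf
    rw [cfc_congr (g := fun _ => (0 : ℝ)) (fun x hx => hs x hx)] at e1
    have e2 : ∫ x, f x ∂ν = 0 := by
      have : cfc (fun _ : ℝ => (0 : ℝ)) a = 0 := cfc_zero ℝ a
      rw [this] at e1
      simpa using e1
    have hint : Integrable f ν := Integrable.of_bound hf.aestronglyMeasurable 1
      (ae_of_all _ fun x => by rw [Real.norm_eq_abs, abs_of_nonneg (h0 x)]; exact h1 x)
    exact (integral_eq_zero_iff_of_nonneg (fun x => h0 x) hint).1 e2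
  rcases (spectrum ℝ a).eq_empty_or_nonempty with he | hne
  · have := key (fun _ => 1) continuous_const (by simp) (by simp) (by simp [he])
    rw [he, Set.compl_empty]
    rw [Filter.EventuallyEq, ae_iff] at this
    simpa using this
  · have := key (fun x => min 1 (Metric.infDist x (spectrum ℝ a)))
      (continuous_const.min (Metric.continuous_infDist_pt _))
      (fun x => le_min zero_le_one Metric.infDist_nonneg) (fun x => min_le_left _ _)
      (fun x hx => by simp [Metric.infDist_zero_of_mem hx])
    rw [Filter.EventuallyEq, ae_iff] at this
    refine measure_mono_null (fun x hx => ?_) this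
    have := ((spectrum.isClosed (𝕜 := ℝ) a).notMem_iff_infDist_pos hne).1 hx
    simp only [Set.mem_ofPred_eq, Pi.zero_apply]
    exact (lt_min zero_lt_one this).ne'

theorem hasAbsContSpectrum_mulOn {g : α → ℝ} (hg : Measurable g) {R : ℝ} (hR : ∀ x, |g x| ≤ R)
    (hac : (μ.map g).AbsolutelyContinuous volume) :
    HasAbsContSpectrum (mulOn e fun x => (g x : ℂ)) := by
  refine ⟨isSelfAdjoint_mulOn_ofReal e (memLp_top_comp hg hR continuous_id), fun y => ?_⟩
  have hm : Measurable fun x => ‖e.symm y x‖ ^ 2 :=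
    ((Lp.stronglyMeasurable (e.symm y)).norm.measurable).pow_const 2
  have hint : Integrable (fun x => ‖e.symm y x‖ ^ 2) μ :=
    (Lp.memLp (e.symm y)).integrable_norm_pow (by norm_num)
  set ρ : Measure α := μ.withDensity fun x => ENNReal.ofReal (‖e.symm y x‖ ^ 2) with hρ
  have : IsFiniteMeasure ρ := by
    refine isFiniteMeasure_withDensity ?_
    exact (hasFiniteIntegral_iff_ofReal (ae_of_all _ fun x => sq_nonneg _)).1 hint.2 |>.ne
  refine ⟨ρ.map g, isScalarSpectralMeasure_of_integral y fun f hf => ?_, ?_⟩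
  · rw [cfc_mulOn e hg hR hf, inner_mulOn e (memLp_top_comp hg hR hf),
      integral_map hg.aemeasurable hf.aestronglyMeasurable, hρ,
      integral_withDensity_eq_integral_toReal_smul₀ hm.ennreal_ofReal.aemeasurable
        (ae_of_all _ fun x => ENNReal.ofReal_lt_top), ← integral_complex_ofReal]
    refine integral_congr_ae (ae_of_all _ fun x => ?_)
    simp only [ENNReal.toReal_ofReal (sq_nonneg ‖e.symm y x‖), smul_eq_mul]
    push_cast
    ring
  · exact ((withDensity_absolutelyContinuous _ _).map hg).trans hac

end MulOp

/-! ### The commutant of multiplication by the coordinate on the circle -/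

section Circle

open MeasureTheory AddCircle
open scoped ENNReal

theorem memLp_fourier (n : ℤ) : MemLp (fourier n : UnitAddCircle → ℂ) ∞ haarAddCircle :=
  memLp_top_of_bound (C := 1) (fourier n).continuous.aestronglyMeasurable
    (ae_of_all _ fun x => (((fourier n).norm_coe_le_norm x).trans (fourier_norm n).le))

theorem mulOp_fourier_apply (m n : ℤ) :
    mulOp haarAddCircle (fourier m : UnitAddCircle → ℂ) (fourierLp 2 n) = fourierLp 2 (m + n) := by
  apply Lp.ext
  filter_upwards [coeFn_mulOp (memLp_fourier m) (fourierLp 2 n),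
    coeFn_fourierLp (T := 1) 2 n, coeFn_fourierLp (T := 1) 2 (m + n)] with x h1 h2 h3
  rw [h1, h2, h3, fourier_add]

theorem mulOp_apply_fourierLp_zero_ae {f : UnitAddCircle → ℂ} (hf : MemLp f ∞ haarAddCircle) :
    mulOp haarAddCircle f (fourierLp 2 0) =ᵐ[haarAddCircle] f := by
  filter_upwards [coeFn_mulOp hf (fourierLp 2 0), coeFn_fourierLp (T := 1) 2 0] with x h1 h2
  rw [h1, h2, fourier_zero, mul_one]

theorem eq_of_inner_fourierLp {x y : Lp ℂ 2 (haarAddCircle (T := 1))}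
    (h : ∀ n, inner ℂ (fourierLp 2 n) x = inner ℂ (fourierLp 2 n) y) : x = y := by
  apply (fourierBasis (T := 1)).repr.injective
  ext n
  rw [HilbertBasis.repr_apply_apply, HilbertBasis.repr_apply_apply, coe_fourierBasis, h n]

/-- An operator which commutes with multiplication by `e^{2πix}` commutes with multiplication by
all trigonometric monomials. -/
theorem commute_mulOp_fourier {T : Lp ℂ 2 (haarAddCircle (T := 1)) →L[ℂ] Lp ℂ 2 haarAddCircle}
    (hT : Commute T (mulOp haarAddCircle (fourier 1 : UnitAddCircle → ℂ))) (n : ℤ) :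
    Commute T (mulOp haarAddCircle (fourier n : UnitAddCircle → ℂ)) := by
  have hmul : ∀ m n : ℤ, mulOp haarAddCircle (fourier (m + n) : UnitAddCircle → ℂ) =
      mulOp haarAddCircle (fourier m : UnitAddCircle → ℂ) *
        mulOp haarAddCircle (fourier n : UnitAddCircle → ℂ) := fun m n => by
    rw [← mulOp_mul (memLp_fourier m) (memLp_fourier n)]
    congr 1
    ext x
    exact fourier_add
  have hone : mulOp haarAddCircle (fourier 0 : UnitAddCircle → ℂ) = 1 := by
    rw [← one_smul ℂ (1 : Lp ℂ 2 (haarAddCircle (T := 1)) →L[ℂ] Lp ℂ 2 haarAddCircle),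
      ← mulOp_const]
    congr 1
    ext x
    exact fourier_zero
  have hinv : Commute T (mulOp haarAddCircle (fourier (-1) : UnitAddCircle → ℂ)) := by
    have e1 := hmul 1 (-1)
    have e2 := hmul (-1) 1
    rw [show (1 : ℤ) + -1 = 0 by norm_num, hone] at e1
    rw [show (-1 : ℤ) + 1 = 0 by norm_num, hone] at e2
    set V := mulOp haarAddCircle (fourier 1 : UnitAddCircle → ℂ)
    set V' := mulOp haarAddCircle (fourier (-1) : UnitAddCircle → ℂ)
    change T * V' = V' * T
    calc T * V' = V' * V * (T * V') := by rw [← e2, one_mul]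
      _ = V' * (V * T) * V' := by noncomm_ring
      _ = V' * (T * V) * V' := by rw [hT.eq]
      _ = V' * T * (V * V') := by noncomm_ring
      _ = V' * T := by rw [← e1, mul_one]
  induction n with
  | zero => rw [hone]; exact Commute.one_right T
  | succ n ih => rw [hmul]; exact ih.mul_right hT
  | pred n ih => rw [sub_eq_add_neg, hmul]; exact ih.mul_right hinv

/-- A square-integrable function `f` is bounded by `C` if multiplication by `χ` maps it to a vector
of norm at most `C ‖χ‖`, for all bounded `χ`: take for `χ` the indicator function of the set where
the bound fails. -/
theorem ae_norm_le_of_norm_mulOp_le {f : Lp ℂ 2 (haarAddCircle (T := 1))} {C : ℝ} (hC : 0 ≤ C)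
    (h : ∀ χ : UnitAddCircle → ℂ, MemLp χ ∞ haarAddCircle →
      ‖mulOp haarAddCircle χ f‖ ≤ C * ‖mulOp haarAddCircle χ (fourierLp 2 0)‖) :
    ∀ᵐ x ∂haarAddCircle, ‖f x‖ ≤ C := by
  set B : Set UnitAddCircle := {x | C < ‖f x‖} with hB
  have hBm : MeasurableSet B :=
    measurableSet_lt measurable_const (Lp.stronglyMeasurable f).norm.measurable
  set χ : UnitAddCircle → ℂ := B.indicator fun _ => 1 with hχ
  have hχm : MemLp χ ∞ haarAddCircle := (memLp_top_const 1).indicator hBm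
  have hnorm : ∀ y : Lp ℂ 2 (haarAddCircle (T := 1)), ‖mulOp haarAddCircle χ y‖ ^ 2 =
      ∫ x, B.indicator (fun x => ‖y x‖ ^ 2) x ∂haarAddCircle := by
    intro y
    have e1 : (inner ℂ (mulOp haarAddCircle χ y) (mulOp haarAddCircle χ y) : ℂ) =
        inner ℂ y (mulOp haarAddCircle χ y) := by
      rw [← ContinuousLinearMap.adjoint_inner_right, ← ContinuousLinearMap.star_eq_adjoint,
        star_mulOp hχm, ← mul_apply_eq_comp, ← mulOp_mul (memLp_conj hχm) hχm]
      congr 3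
      ext x
      by_cases hx : x ∈ B <;> simp [hχ, hx]
    rw [inner_mulOp hχm, inner_self_eq_norm_sq_to_K] at e1
    apply Complex.ofReal_injective
    rw [← integral_complex_ofReal]
    push_cast
    refine e1.trans (integral_congr_ae (ae_of_all _ fun x => ?_))
    by_cases hx : x ∈ B <;> simp [hχ, hx]
  have hle : ∀ᵐ x ∂haarAddCircle, ‖f x‖ ≤ C := by
    have e1 : ‖mulOp haarAddCircle χ f‖ ^ 2 ≤
        C ^ 2 * ‖mulOp haarAddCircle χ (fourierLp 2 0)‖ ^ 2 := by
      rw [← mul_pow]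
      have := h χ hχm
      gcongr
    rw [hnorm, hnorm, ← integral_const_mul] at e1
    have i1 : ∀ y : Lp ℂ 2 (haarAddCircle (T := 1)),
        Integrable (B.indicator fun x => ‖y x‖ ^ 2) haarAddCircle := fun y =>
      ((Lp.memLp y).integrable_norm_pow (by norm_num)).indicator hBm
    set d : UnitAddCircle → ℝ := B.indicator fun x => ‖f x‖ ^ 2 - C ^ 2 with hd
    have hd0 : ∀ x, 0 ≤ d x := by
      intro x
      refine Set.indicator_nonneg (fun x hx => ?_) x
      have : C < ‖f x‖ := hx
      have := hC
      nlinarith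
    have hd1 : d =ᵐ[haarAddCircle] fun x => B.indicator (fun x => ‖f x‖ ^ 2) x -
        C ^ 2 * B.indicator (fun x => ‖(fourierLp 2 0 : Lp ℂ 2 (haarAddCircle (T := 1))) x‖ ^ 2) x := by
      filter_upwards [coeFn_fourierLp (T := 1) 2 0] with x hx
      by_cases hxB : x ∈ B
      · simp only [hd, Set.indicator_of_mem hxB]
        rw [hx, fourier_zero, norm_one, one_pow, mul_one]
      · simp [hd, hxB]
    have hd2 : Integrable d haarAddCircle :=
      (integrable_congr hd1).2 ((i1 f).sub ((i1 _).const_mul _))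
    have hd3 : ∫ x, d x ∂haarAddCircle = 0 := by
      refine le_antisymm ?_ (integral_nonneg hd0)
      rw [integral_congr_ae hd1, integral_sub (i1 f) ((i1 _).const_mul _)]
      linarith
    filter_upwards [(integral_eq_zero_iff_of_nonneg hd0 hd2).1 hd3] with x hx
    by_contra hlt
    push Not at hlt
    have hxB : x ∈ B := hlt
    rw [hd, Set.indicator_of_mem hxB] at hx
    have := hC
    simp only [Pi.zero_apply] at hx
    nlinarith
  exact hle

theorem ae_norm_le_norm_mulOp {f : UnitAddCircle → ℂ} (hf : MemLp f ∞ haarAddCircle) :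
    ∀ᵐ x ∂haarAddCircle, ‖f x‖ ≤ ‖mulOp haarAddCircle f‖ := by
  have := ae_norm_le_of_norm_mulOp_le (f := mulOp haarAddCircle f (fourierLp 2 0))
    (norm_nonneg (mulOp haarAddCircle f)) fun χ hχ => by
      rw [← mul_apply_eq_comp, ← mulOp_mul hχ hf, show (fun x => χ x * f x) = fun x => f x * χ x
        from funext fun x => mul_comm _ _, mulOp_mul hf hχ, mul_apply_eq_comp]
      exact (mulOp haarAddCircle f).le_opNorm _
  filter_upwards [this, mulOp_apply_fourierLp_zero_ae hf] with x h1 h2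
  rwa [h2] at h1

/-- An operator on `L²` of the circle which commutes with multiplication by `e^{2πix}` is itself
the multiplication by a bounded function, namely its value at the constant function `1`. -/
theorem exists_eq_mulOp {T : Lp ℂ 2 (haarAddCircle (T := 1)) →L[ℂ] Lp ℂ 2 haarAddCircle}
    (hT : Commute T (mulOp haarAddCircle (fourier 1 : UnitAddCircle → ℂ))) :
    ∃ f : UnitAddCircle → ℂ, MemLp f ∞ haarAddCircle ∧ T = mulOp haarAddCircle f := by
  have hc := commute_mulOp_fourier hT
  have hap : ∀ n, mulOp haarAddCircle (fourier n : UnitAddCircle → ℂ) (fourierLp 2 0) =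
      fourierLp 2 n := fun n => by rw [mulOp_fourier_apply, add_zero]
  have hstar : ∀ n, star (mulOp haarAddCircle (fourier n : UnitAddCircle → ℂ)) =
      mulOp haarAddCircle (fourier (-n) : UnitAddCircle → ℂ) := fun n => by
    rw [star_mulOp (memLp_fourier n)]
    congr 1
    ext x
    exact fourier_neg.symm
  have hc' : ∀ n, Commute (star T) (mulOp haarAddCircle (fourier n : UnitAddCircle → ℂ)) := by
    intro n
    have := (hc (-n)).star_star
    rwa [hstar, neg_neg] at this
  set f : Lp ℂ 2 (haarAddCircle (T := 1)) := T (fourierLp 2 0) with hf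
  -- the adjoint of `T` maps `1` to the conjugate of `f`
  have hadj : star T (fourierLp 2 0) = (memLp_conj (Lp.memLp f)).toLp _ := by
    refine eq_of_inner_fourierLp fun n => ?_
    have e1 : inner ℂ (fourierLp 2 n) (star T (fourierLp 2 0)) = inner ℂ
        (mulOp haarAddCircle (fourier n : UnitAddCircle → ℂ) f) (fourierLp 2 0) := by
      rw [ContinuousLinearMap.star_eq_adjoint, ContinuousLinearMap.adjoint_inner_right, hf,
        ← hap n]
      congr 1
      exact congrArg (fun S => S (fourierLp 2 0)) (hc n).eq
    rw [e1, L2.inner_def, L2.inner_def]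
    refine integral_congr_ae ?_
    filter_upwards [coeFn_mulOp (memLp_fourier n) f, coeFn_fourierLp (T := 1) 2 n,
      coeFn_fourierLp (T := 1) 2 0, (memLp_conj (Lp.memLp f)).coeFn_toLp] with x h1 h2 h3 h4
    rw [h1, h2, h3, h4, fourier_zero]
    simp only [RCLike.inner_apply, map_mul]
    ring
  -- hence `T h = f h` for bounded `h`
  have hmul : ∀ h : UnitAddCircle → ℂ, MemLp h ∞ haarAddCircle →
      T (mulOp haarAddCircle h (fourierLp 2 0)) = mulOp haarAddCircle h f := by
    intro h hh
    refine eq_of_inner_fourierLp fun n => ?_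
    have e1 : inner ℂ (fourierLp 2 n) (T (mulOp haarAddCircle h (fourierLp 2 0))) = inner ℂ
        (mulOp haarAddCircle (fourier n : UnitAddCircle → ℂ) (star T (fourierLp 2 0)))
        (mulOp haarAddCircle h (fourierLp 2 0)) := by
      rw [← ContinuousLinearMap.adjoint_inner_left, ← ContinuousLinearMap.star_eq_adjoint]
      congr 1
      rw [← hap n]
      exact congrArg (fun S => S (fourierLp 2 0)) (hc' n).eq
    rw [e1, hadj, L2.inner_def, L2.inner_def]
    refine integral_congr_ae ?_
    filter_upwards [coeFn_mulOp (memLp_fourier n) ((memLp_conj (Lp.memLp f)).toLp _),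
      mulOp_apply_fourierLp_zero_ae hh, coeFn_mulOp hh f,
      coeFn_fourierLp (T := 1) 2 n, (memLp_conj (Lp.memLp f)).coeFn_toLp] with x h1 h2 h3 h4 h5
    rw [h1, h2, h3, h4, h5]
    simp only [RCLike.inner_apply, map_mul, Complex.conj_conj]
    ring
  have hfm : MemLp f ∞ haarAddCircle := memLp_top_of_bound (Lp.aestronglyMeasurable f) _
    (ae_norm_le_of_norm_mulOp_le (norm_nonneg T) fun χ hχ => by
      rw [← hmul χ hχ]
      exact T.le_opNorm _)
  refine ⟨f, hfm, ?_⟩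
  refine ContinuousLinearMap.ext_on (s := Set.range (fourierBasis (T := 1))) ?_ ?_
  · rw [dense_iff_closure_eq, ← Submodule.topologicalClosure_coe,
      (fourierBasis (T := 1)).dense_span]
    rfl
  · rintro _ ⟨n, rfl⟩
    rw [coe_fourierBasis, ← hap n, hmul _ (memLp_fourier n)]
    apply Lp.ext
    filter_upwards [coeFn_mulOp (memLp_fourier n) f,
      coeFn_mulOp hfm (mulOp haarAddCircle (fourier n : UnitAddCircle → ℂ) (fourierLp 2 0)),
      mulOp_apply_fourierLp_zero_ae (memLp_fourier n)] with x h1 h2 h3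
    rw [h1, h2, h3, mul_comm]

end Circle

/-! ### The coordinate on the circle and sine functions -/

section Circle

open MeasureTheory AddCircle
open scoped ENNReal

/-- The representative in `(0, 1]` of a point of `ℝ/ℤ`. -/
def circleRep (x : UnitAddCircle) : ℝ := equivIoc 1 0 x

theorem circleRep_mem (x : UnitAddCircle) : 0 < circleRep x ∧ circleRep x ≤ 1 := by
  have := (equivIoc (1 : ℝ) 0 x).2
  simpa [circleRep] using this

theorem coe_circleRep (x : UnitAddCircle) : (circleRep x : UnitAddCircle) = x :=
  coe_equivIoc

theorem measurePreserving_circleRep :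
    MeasurePreserving circleRep haarAddCircle (volume.restrict (Set.Ioc 0 1)) := by
  have h := (measurePreserving_subtype_coe (μa := (volume : Measure ℝ))
    (measurableSet_Ioc (a := (0 : ℝ)) (b := 0 + 1))).comp
    (measurePreserving_equivIoc (T := 1) (a := 0))
  have hv : (volume : Measure UnitAddCircle) = haarAddCircle := by
    rw [volume_eq_smul_haarAddCircle]
    simp
  rw [hv] at h
  rw [show Set.Ioc (0 : ℝ) 1 = Set.Ioc 0 (0 + 1) by rw [zero_add]]
  exact h

theorem measurable_circleRep : Measurable circleRep := measurePreserving_circleRep.measurable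

theorem abs_circleRep_le (x : UnitAddCircle) : |circleRep x| ≤ 1 := by
  have := circleRep_mem x
  rw [abs_le]
  constructor <;> linarith

theorem integral_circleRep (f : ℝ → ℝ) (hf : Continuous f) :
    ∫ x, f (circleRep x) ∂haarAddCircle = ∫ y in (0 : ℝ)..1, f y := by
  rw [intervalIntegral.integral_of_le zero_le_one, ← measurePreserving_circleRep.map_eq,
    integral_map measurable_circleRep.aemeasurable hf.aestronglyMeasurable]

theorem ae_circleRep_lt_one : ∀ᵐ x ∂(haarAddCircle (T := 1)), circleRep x < 1 := by
  have h : ∀ᵐ y ∂(volume.restrict (Set.Ioc (0 : ℝ) 1)), y ≠ 1 := by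
    refine ae_restrict_of_ae ?_
    rw [ae_iff]
    simp
  rw [← measurePreserving_circleRep.map_eq] at h
  filter_upwards [ae_of_ae_map measurable_circleRep.aemeasurable h] with x hx
  exact lt_of_le_of_ne (circleRep_mem x).2 hx

/-- The image of Lebesgue measure on `(0, 1)` under a function with a differentiable left inverse
is absolutely continuous. -/
theorem absolutelyContinuous_map_circleRep {φ ψ : ℝ → ℝ} (hφ : Measurable φ)
    (h : ∀ x ∈ Set.Ioo (0 : ℝ) 1, ψ (φ x) = x ∧ DifferentiableAt ℝ ψ (φ x)) :
    ((haarAddCircle (T := 1)).map fun x => φ (circleRep x)).AbsolutelyContinuous volume := by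
  have e : (fun x => φ (circleRep x)) = φ ∘ circleRep := rfl
  rw [e, ← Measure.map_map hφ measurable_circleRep, measurePreserving_circleRep.map_eq]
  refine Measure.AbsolutelyContinuous.mk fun N hN h0 => ?_
  rw [Measure.map_apply hφ hN, ← Measure.restrict_congr_set Ioo_ae_eq_Ioc,
    Measure.restrict_apply (hφ hN)]
  have him : volume (ψ '' (N ∩ φ '' Set.Ioo 0 1)) = 0 := by
    refine addHaar_image_eq_zero_of_differentiableOn_of_addHaar_eq_zero volume ?_
      (measure_mono_null Set.inter_subset_left h0)
    rintro _ ⟨-, x, hx, rfl⟩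
    exact (h x hx).2.differentiableWithinAt
  refine measure_mono_null ?_ him
  rintro x ⟨hx, hx'⟩
  exact ⟨φ x, ⟨hx, x, hx', rfl⟩, (h x hx').1⟩

theorem fourier_one_eq (x : UnitAddCircle) : fourier 1 x =
    ((Real.cos (Real.pi * circleRep x) : ℂ) + Complex.I * Real.sin (Real.pi * circleRep x)) ^ 2 := by
  conv_lhs => rw [← coe_circleRep x]
  rw [fourier_coe_apply, Complex.ofReal_cos, Complex.ofReal_sin, mul_comm Complex.I,
    ← Complex.exp_mul_I, ← Complex.exp_nat_mul]
  congr 1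
  push_cast
  ring

/-- The function `√2 sin((k+1)πx)` on the circle, viewed as `(0, 1]`. -/
def sineFun (k : ℕ) (x : UnitAddCircle) : ℂ :=
  ((√2 * Real.sin ((k + 1) * (Real.pi * circleRep x)) : ℝ) : ℂ)

theorem memLp_sineFun (k : ℕ) : MemLp (sineFun k) ∞ haarAddCircle :=
  memLp_top_comp (h := fun y => √2 * Real.sin ((k + 1) * (Real.pi * y)))
    measurable_circleRep abs_circleRep_le (by fun_prop)

theorem integral_cos_int_mul_pi (n : ℤ) :
    ∫ y in (0 : ℝ)..1, Real.cos (n * (Real.pi * y)) = if n = 0 then 1 else 0 := by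
  split_ifs with h
  · simp [h]
  · have hne : (n : ℝ) * Real.pi ≠ 0 := mul_ne_zero (by exact_mod_cast h) Real.pi_ne_zero
    simp_rw [← mul_assoc]
    rw [intervalIntegral.integral_comp_mul_left (fun y => Real.cos y) hne, integral_cos]
    simp

theorem integral_sineFun_mul (j k : ℕ) :
    ∫ x, (starRingEnd ℂ (sineFun j x)) * sineFun k x ∂haarAddCircle = if j = k then 1 else 0 := by
  have e : ∀ x, (starRingEnd ℂ (sineFun j x)) * sineFun k x = ((
      (fun y => Real.cos ((j - k : ℤ) * (Real.pi * y)) -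
        Real.cos ((j + k + 2 : ℤ) * (Real.pi * y))) (circleRep x) : ℝ) : ℂ) := by
    intro x
    simp only [sineFun, Complex.conj_ofReal]
    rw [← Complex.ofReal_mul]
    congr 1
    set θ := Real.pi * circleRep x
    have h1 : ((j - k : ℤ) : ℝ) * θ = (j + 1) * θ - (k + 1) * θ := by push_cast; ring
    have h2 : ((j + k + 2 : ℤ) : ℝ) * θ = (j + 1) * θ + (k + 1) * θ := by push_cast; ring
    have h3 : √2 * √2 = (2 : ℝ) := Real.mul_self_sqrt (by norm_num)
    rw [h1, h2, Real.cos_sub, Real.cos_add]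
    linear_combination (Real.sin ((j + 1) * θ) * Real.sin ((k + 1) * θ)) * h3
  simp_rw [e]
  rw [integral_complex_ofReal, integral_circleRep (fun y => Real.cos ((j - k : ℤ) * (Real.pi * y)) -
        Real.cos ((j + k + 2 : ℤ) * (Real.pi * y))) (by fun_prop), intervalIntegral.integral_sub
    (Continuous.intervalIntegrable (by fun_prop) _ _)
    (Continuous.intervalIntegrable (by fun_prop) _ _),
    integral_cos_int_mul_pi, integral_cos_int_mul_pi, if_neg (by omega : ¬ (j + k + 2 : ℤ) = 0)]
  by_cases h : j = k
  · simp [h]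
  · rw [if_neg (by omega), if_neg h]
    simp

theorem sineFun_zero_ne_zero : ∀ᵐ x ∂(haarAddCircle (T := 1)), sineFun 0 x ≠ 0 := by
  filter_upwards [ae_circleRep_lt_one] with x hx
  have h0 := (circleRep_mem x).1
  have : 0 < Real.sin (Real.pi * circleRep x) := by
    apply Real.sin_pos_of_pos_of_lt_pi
    · positivity
    · nlinarith [Real.pi_pos]
  simp [sineFun, -Complex.ofReal_sin, this.ne']

/-- The function `√(c + 2 cos(πx))` on the circle, viewed as `(0, 1]`. -/
def symbolFun (c : ℝ) (x : UnitAddCircle) : ℝ := √(c + 2 * Real.cos (Real.pi * circleRep x))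

theorem symbolFun_nonneg (c : ℝ) (x : UnitAddCircle) : 0 ≤ symbolFun c x := Real.sqrt_nonneg _

theorem measurable_symbolFun (c : ℝ) : Measurable (symbolFun c) := by
  unfold symbolFun
  exact (Continuous.measurable (f := fun y => √(c + 2 * Real.cos (Real.pi * y)))
    (by fun_prop)).comp measurable_circleRep

theorem symbolFun_sq {c : ℝ} (hc : 2 ≤ c) (x : UnitAddCircle) :
    symbolFun c x ^ 2 = c + 2 * Real.cos (Real.pi * circleRep x) := by
  have := Real.neg_one_le_cos (Real.pi * circleRep x)
  exact Real.sq_sqrt (by linarith)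

theorem abs_symbolFun_le {c : ℝ} (hc : 2 ≤ c) (x : UnitAddCircle) : |symbolFun c x| ≤ c + 2 := by
  rw [abs_of_nonneg (symbolFun_nonneg c x)]
  have h1 := symbolFun_sq hc x
  have h2 := Real.cos_le_one (Real.pi * circleRep x)
  nlinarith [symbolFun_nonneg c x]

theorem symbolFun_ne_zero {c : ℝ} (hc : 2 ≤ c) :
    ∀ᵐ x ∂(haarAddCircle (T := 1)), symbolFun c x ≠ 0 := by
  filter_upwards [ae_circleRep_lt_one] with x hx h
  have h1 := symbolFun_sq hc x
  rw [h] at h1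
  have h0 := (circleRep_mem x).1
  have : Real.cos Real.pi < Real.cos (Real.pi * circleRep x) := by
    apply Real.cos_lt_cos_of_nonneg_of_le_pi
    · positivity
    · exact le_rfl
    · nlinarith [Real.pi_pos]
  rw [Real.cos_pi] at this
  linarith

theorem cos_mem_Ioo {x : ℝ} (hx : x ∈ Set.Ioo (0 : ℝ) 1) :
    -1 < Real.cos (Real.pi * x) ∧ Real.cos (Real.pi * x) < 1 := by
  have hp := Real.pi_pos
  constructor
  · rw [← Real.cos_pi]
    exact Real.cos_lt_cos_of_nonneg_of_le_pi (by nlinarith [hx.1]) le_rfl (by nlinarith [hx.2])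
  · rw [← Real.cos_zero]
    exact Real.cos_lt_cos_of_nonneg_of_le_pi le_rfl (by nlinarith [hx.2]) (by nlinarith [hx.1])

theorem differentiableAt_arccos_comp {f : ℝ → ℝ} {x y : ℝ} (hx : x ∈ Set.Ioo (0 : ℝ) 1)
    (hf : DifferentiableAt ℝ f y) (h : f y = Real.cos (Real.pi * x)) :
    DifferentiableAt ℝ (fun y => Real.arccos (f y) / Real.pi) y ∧
      Real.arccos (f y) / Real.pi = x := by
  have hp := Real.pi_pos
  refine ⟨DifferentiableAt.div_const (DifferentiableAt.comp (g := Real.arccos) y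
    (Real.differentiableAt_arccos.2 ?_) hf) _, ?_⟩
  · rw [h]
    exact ⟨(cos_mem_Ioo hx).1.ne', (cos_mem_Ioo hx).2.ne⟩
  · rw [h, Real.arccos_cos (by nlinarith [hx.1]) (by nlinarith [hx.2])]
    field_simp

theorem absolutelyContinuous_symbolFun {c : ℝ} (hc : 2 ≤ c) :
    ((haarAddCircle (T := 1)).map (symbolFun c)).AbsolutelyContinuous volume := by
  refine absolutelyContinuous_map_circleRep (φ := fun y => √(c + 2 * Real.cos (Real.pi * y)))
    (ψ := fun y => Real.arccos ((y ^ 2 - c) / 2) / Real.pi) (by fun_prop) fun x hx => ?_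
  have := differentiableAt_arccos_comp (f := fun y => (y ^ 2 - c) / 2)
    (y := √(c + 2 * Real.cos (Real.pi * x))) hx (by fun_prop) (by
      rw [Real.sq_sqrt (by linarith [(cos_mem_Ioo hx).1])]; ring)
  exact ⟨this.2, this.1⟩

theorem absolutelyContinuous_symbolFun_sq {c : ℝ} (hc : 2 ≤ c) :
    ((haarAddCircle (T := 1)).map fun x => symbolFun c x ^ 2).AbsolutelyContinuous volume := by
  simp_rw [symbolFun_sq hc]
  refine absolutelyContinuous_map_circleRep (φ := fun y => c + 2 * Real.cos (Real.pi * y))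
    (ψ := fun y => Real.arccos ((y - c) / 2) / Real.pi) (by fun_prop) fun x hx => ?_
  have := differentiableAt_arccos_comp (f := fun y => (y - c) / 2)
    (y := c + 2 * Real.cos (Real.pi * x)) hx (by fun_prop) (by ring)
  exact ⟨this.2, this.1⟩

end Circle

/-! ### The model operator -/

section Model

open MeasureTheory AddCircle
open scoped ENNReal

variable {K : Type*} [NormedAddCommGroup K] [InnerProductSpace ℂ K] [CompleteSpace K]

/-- An operator commuting with the square of a positive operator commutes with that operator. -/
theorem commute_of_commute_mul_self {a X : K →L[ℂ] K} (ha : 0 ≤ a) (h : Commute (a * a) X) :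
    Commute a X := by
  have := h.cfcₙ_nnreal NNReal.sqrt
  rwa [← CFC.sqrt, CFC.sqrt_mul_self a ha] at this

/-- A selfadjoint operator which maps a subspace into itself commutes with the projection onto its
orthogonal complement. -/
theorem commute_starProjection_orthogonal {a : K →L[ℂ] K} (ha : IsSelfAdjoint a)
    (E : Submodule ℂ K) (h : ∀ x ∈ E, a x ∈ E) : Commute a Eᗮ.starProjection := by
  have hsym : ∀ x y, inner ℂ (a x) y = inner ℂ x (a y) := fun x y => by
    conv_rhs => rw [← ha.star_eq, ContinuousLinearMap.star_eq_adjoint,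
      ContinuousLinearMap.adjoint_inner_right]
  have h1 : ∀ x ∈ Eᗮ, a x ∈ Eᗮ := by
    intro x hx
    rw [Submodule.mem_orthogonal] at hx ⊢
    intro y hy
    rw [← hsym]
    exact hx _ (h y hy)
  have h2 : ∀ x ∈ Eᗮᗮ, a x ∈ Eᗮᗮ := by
    intro x hx
    rw [Submodule.mem_orthogonal] at hx ⊢
    intro y hy
    rw [← hsym]
    exact hx _ (h1 y hy)
  ext x
  change a (Eᗮ.starProjection x) = Eᗮ.starProjection (a x)
  have hx : a x = a (Eᗮ.starProjection x) + a (x - Eᗮ.starProjection x) := by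
    rw [← map_add, add_sub_cancel]
  rw [hx, map_add, Submodule.starProjection_eq_self_iff.2
    (h1 _ (Submodule.starProjection_apply_mem _ x)),
    (Submodule.starProjection_apply_eq_zero_iff _).2
      (h2 _ (Submodule.sub_starProjection_mem_orthogonal x)), add_zero]

variable (e : Lp ℂ 2 (haarAddCircle (T := 1)) ≃ₗᵢ[ℂ] K)

/-- The unitary of multiplication by `e^{2πix}`, transported to `K`. -/
def coordOp : K →L[ℂ] K := mulOn e (fourier 1 : UnitAddCircle → ℂ)

/-- The operator of multiplication by `√(c + 2 cos(πx))`, transported to `K`. -/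
def modelOp (c : ℝ) : K →L[ℂ] K := mulOn e fun x => (symbolFun c x : ℂ)

theorem memLp_symbolFun {c : ℝ} (hc : 2 ≤ c) :
    MemLp (fun x => (symbolFun c x : ℂ)) ∞ (haarAddCircle (T := 1)) :=
  memLp_top_comp (measurable_symbolFun c) (abs_symbolFun_le hc) continuous_id

theorem modelOp_nonneg {c : ℝ} (hc : 2 ≤ c) : 0 ≤ modelOp e c :=
  (ContinuousLinearMap.nonneg_iff_isPositive _).2
    (isPositive_mulOn e (memLp_symbolFun hc) (symbolFun_nonneg c))

theorem modelOp_mul_self {c : ℝ} (hc : 2 ≤ c) :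
    modelOp e c * modelOp e c = mulOn e fun x => ((symbolFun c x ^ 2 : ℝ) : ℂ) := by
  rw [modelOp, ← mulOn_mul e (memLp_symbolFun hc) (memLp_symbolFun hc)]
  congr 1
  ext x
  push_cast
  ring

theorem hasAbsContSpectrum_modelOp {c : ℝ} (hc : 2 ≤ c) : HasAbsContSpectrum (modelOp e c) :=
  hasAbsContSpectrum_mulOn e (measurable_symbolFun c) (abs_symbolFun_le hc)
    (absolutelyContinuous_symbolFun hc)

theorem hasAbsContSpectrum_modelOp_mul_self {c : ℝ} (hc : 2 ≤ c) :
    HasAbsContSpectrum (modelOp e c * modelOp e c) := by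
  rw [modelOp_mul_self e hc]
  refine hasAbsContSpectrum_mulOn e ((measurable_symbolFun c).pow_const 2) (R := c + 2)
    (fun x => ?_) (absolutelyContinuous_symbolFun_sq hc)
  rw [abs_of_nonneg (sq_nonneg _), symbolFun_sq hc]
  linarith [Real.cos_le_one (Real.pi * circleRep x)]

theorem modelOp_injective {c : ℝ} (hc : 2 ≤ c) {y : K} (h : modelOp e c y = 0) : y = 0 := by
  rw [modelOp, mulOn_apply, e.map_eq_zero_iff] at h
  have h1 := coeFn_mulOp (memLp_symbolFun hc) (e.symm y)
  rw [h] at h1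
  have : e.symm y = 0 := by
    apply Lp.ext
    filter_upwards [h1, Lp.coeFn_zero ℂ 2 (haarAddCircle (T := 1)), symbolFun_ne_zero hc]
      with x h1 h2 h3
    rw [h2, Pi.zero_apply] at h1 ⊢
    have h3' : (symbolFun c x : ℂ) ≠ 0 := by exact_mod_cast h3
    simpa [h3'] using h1.symm
  simpa using this

/-- The continuous function giving `cos(πx)` in terms of `√(c + 2 cos(πx))`. -/
def cosOfSymbol (c y : ℝ) : ℝ := (y ^ 2 - c) / 2

/-- The continuous function giving `sin(πx)` in terms of `√(c + 2 cos(πx))`, for `0 < x ≤ 1`. -/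
def sinOfSymbol (c y : ℝ) : ℝ := √(1 - cosOfSymbol c y ^ 2)

theorem continuous_cosOfSymbol (c : ℝ) : Continuous (cosOfSymbol c) := by
  unfold cosOfSymbol
  fun_prop

theorem continuous_sinOfSymbol (c : ℝ) : Continuous (sinOfSymbol c) := by
  unfold sinOfSymbol cosOfSymbol
  fun_prop

/-- The coordinate unitary is a continuous function of the model operator, because `x ↦ cos(πx)`
is injective on `(0, 1]`. -/
theorem coordOp_eq_cfc {c : ℝ} (hc : 2 ≤ c) :
    coordOp e = (cfc (cosOfSymbol c) (modelOp e c) +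
      Complex.I • cfc (sinOfSymbol c) (modelOp e c)) ^ 2 := by
  have m1 := memLp_top_comp (μ := haarAddCircle (T := 1)) (measurable_symbolFun c)
    (abs_symbolFun_le hc) (continuous_cosOfSymbol c)
  have m2 := memLp_top_comp (μ := haarAddCircle (T := 1)) (measurable_symbolFun c)
    (abs_symbolFun_le hc) (continuous_sinOfSymbol c)
  have m3 := m2.const_mul Complex.I
  have m4 : MemLp (fun x => ((cosOfSymbol c (symbolFun c x) : ℝ) : ℂ) +
    Complex.I * ((sinOfSymbol c (symbolFun c x) : ℝ) : ℂ)) ∞ (haarAddCircle (T := 1)) := m1.add m3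
  rw [modelOp, cfc_mulOn e (measurable_symbolFun c) (abs_symbolFun_le hc)
    (continuous_cosOfSymbol c), cfc_mulOn e (measurable_symbolFun c) (abs_symbolFun_le hc)
    (continuous_sinOfSymbol c), ← mulOn_smul e _ m2, ← mulOn_add e m1 m3, pow_two,
    ← mulOn_mul e m4 m4, coordOp]
  congr 1
  ext x
  have h1 : cosOfSymbol c (symbolFun c x) = Real.cos (Real.pi * circleRep x) := by
    rw [cosOfSymbol, symbolFun_sq hc]
    ring
  have h2 : sinOfSymbol c (symbolFun c x) = Real.sin (Real.pi * circleRep x) := by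
    have hp := Real.pi_pos
    have hx := circleRep_mem x
    rw [sinOfSymbol, h1, ← Real.abs_sin_eq_sqrt_one_sub_cos_sq, abs_of_nonneg]
    exact Real.sin_nonneg_of_nonneg_of_le_pi (by nlinarith) (by nlinarith)
  rw [h1, h2, fourier_one_eq, pow_two]

theorem commute_coordOp_of_commute_modelOp {c : ℝ} (hc : 2 ≤ c) {X : K →L[ℂ] K}
    (h : Commute (modelOp e c) X) : Commute (coordOp e) X := by
  rw [coordOp_eq_cfc e hc]
  exact ((h.cfc_real _).add_left ((h.cfc_real _).smul_left _)).pow_left 2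

/-- The operators commuting with the coordinate unitary are the multiplication operators. -/
theorem commute_coordOp_iff {X : K →L[ℂ] K} :
    Commute (coordOp e) X ↔ ∃ f, MemLp f ∞ haarAddCircle ∧ X = mulOn e f := by
  constructor
  · intro h
    have h' : Commute (e.conjStarAlgEquiv.symm X)
        (mulOp haarAddCircle (fourier 1 : UnitAddCircle → ℂ)) := by
      have := h.symm.map e.conjStarAlgEquiv.symm
      rwa [coordOp, mulOn, StarAlgEquiv.symm_apply_apply] at this
    obtain ⟨f, hf, hX⟩ := exists_eq_mulOp h'
    exact ⟨f, hf, by rw [mulOn, ← hX, StarAlgEquiv.apply_symm_apply]⟩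
  · rintro ⟨f, hf, rfl⟩
    exact commute_mulOn e (memLp_fourier 1) hf

/-- The vectors `√2 sin((k+1)πx)`, transported to `K`. -/
def sineVec (k : ℕ) : K := mulOn e (sineFun k) (e (fourierLp 2 0))

theorem orthonormal_sineVec : Orthonormal ℂ (sineVec e) := by
  rw [orthonormal_iff_ite]
  intro j k
  rw [sineVec, sineVec, mulOn_apply, mulOn_apply, e.inner_map_map, e.symm_apply_apply,
    L2.inner_def, ← integral_sineFun_mul]
  refine integral_congr_ae ?_
  filter_upwards [mulOp_apply_fourierLp_zero_ae (memLp_sineFun j),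
    mulOp_apply_fourierLp_zero_ae (memLp_sineFun k)] with x h1 h2
  rw [h1, h2]
  simp [mul_comm]

/-- The square of the model operator is a Jacobi matrix in the basis of the sine functions. -/
theorem modelOp_sq_sineVec {c : ℝ} (hc : 2 ≤ c) (k : ℕ) :
    modelOp e c (modelOp e c (sineVec e k)) = (c : ℂ) • sineVec e k + sineVec e (k + 1) +
      if k = 0 then 0 else sineVec e (k - 1) := by
  have m := memLp_symbolFun hc
  have m2 : MemLp (fun x => ((symbolFun c x ^ 2 : ℝ) : ℂ)) ∞ (haarAddCircle (T := 1)) :=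
    memLp_top_comp (h := fun y => y ^ 2) (measurable_symbolFun c) (abs_symbolFun_le hc)
      (by fun_prop)
  have hk : (if k = 0 then 0 else sineVec e (k - 1) : K) =
      mulOn e (fun x => if k = 0 then 0 else sineFun (k - 1) x) (e (fourierLp 2 0)) := by
    split_ifs
    · rw [mulOn_const]
      simp
    · rfl
  have m3 : MemLp (fun x => if k = 0 then 0 else sineFun (k - 1) x) ∞
      (haarAddCircle (T := 1)) := by
    split_ifs
    · exact MemLp.zero
    · exact memLp_sineFun _
  have m4 : MemLp (fun x => (c : ℂ) * sineFun k x + sineFun (k + 1) x) ∞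
      (haarAddCircle (T := 1)) := ((memLp_sineFun k).const_mul _).add (memLp_sineFun _)
  rw [hk, ← mul_apply_eq_comp, modelOp_mul_self e hc]
  simp only [sineVec]
  rw [← mul_apply_eq_comp, ← mulOn_mul e m2 (memLp_sineFun k), ← _root_.smul_apply,
    ← mulOn_smul e _ (memLp_sineFun k), ← _root_.add_apply, ← _root_.add_apply,
    ← mulOn_add e ((memLp_sineFun k).const_mul _) (memLp_sineFun _), ← mulOn_add e m4 m3]
  congr 2
  ext x
  rw [symbolFun_sq hc]
  have e2 : (if k = 0 then 0 else sineFun (k - 1) x : ℂ) =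
      ((√2 * Real.sin (k * (Real.pi * circleRep x)) : ℝ) : ℂ) := by
    split_ifs with h
    · simp [h]
    · rw [sineFun, Nat.cast_sub (Nat.one_le_iff_ne_zero.2 h)]
      simp
  rw [e2]
  simp only [sineFun]
  rw [← Complex.ofReal_mul, ← Complex.ofReal_mul, ← Complex.ofReal_add, ← Complex.ofReal_add]
  congr 1
  set θ := Real.pi * circleRep x
  rw [show (((k + 1 : ℕ) : ℝ) + 1) * θ = (k + 1) * θ + θ by push_cast; ring,
    show (k : ℝ) * θ = (k + 1) * θ - θ by ring, Real.sin_add, Real.sin_sub]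
  ring

theorem span_sineVec_orthogonal : (Submodule.span ℂ (Set.range (sineVec e)))ᗮ = ⊥ := by
  rw [Submodule.eq_bot_iff]
  intro x hx
  set E := Submodule.span ℂ (Set.range (sineVec e)) with hE
  have h2 : (2 : ℝ) ≤ 2 := le_rfl
  have hsa : IsSelfAdjoint (modelOp e 2) := IsSelfAdjoint.of_nonneg (modelOp_nonneg e h2)
  have hsa2 : IsSelfAdjoint (modelOp e 2 * modelOp e 2) := by
    rw [IsSelfAdjoint, star_mul, hsa.star_eq]
  have hs : ∀ k, sineVec e k ∈ E := fun k => Submodule.subset_span ⟨k, rfl⟩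
  -- the projection onto the orthogonal complement of all sines commutes with the coordinate
  have hinv : ∀ y ∈ E, (modelOp e 2 * modelOp e 2) y ∈ E := by
    intro y hy
    induction hy using Submodule.span_induction with
    | mem y hy =>
      obtain ⟨k, rfl⟩ := hy
      rw [mul_apply_eq_comp, modelOp_sq_sineVec e h2]
      refine E.add_mem (E.add_mem (E.smul_mem _ (hs _)) (hs _)) ?_
      split_ifs
      · exact E.zero_mem
      · exact hs _
    | zero => rw [map_zero]; exact E.zero_mem
    | add y z _ _ hy hz => rw [map_add]; exact E.add_mem hy hz
    | smul c y _ hy => rw [map_smul]; exact E.smul_mem c hy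
  have hcomm := commute_coordOp_of_commute_modelOp e h2 (commute_of_commute_mul_self
    (modelOp_nonneg e h2) (commute_starProjection_orthogonal hsa2 E hinv))
  obtain ⟨f, hf, hP⟩ := (commute_coordOp_iff e).1 hcomm
  -- hence it is a multiplication operator, which annihilates the nowhere vanishing `sin(πx)`
  have h0 : mulOn e f (sineVec e 0) = 0 := by
    rw [← hP]
    exact (Submodule.starProjection_apply_eq_zero_iff _).2
      (Submodule.le_orthogonal_orthogonal _ (hs 0))
  have hf0 : f =ᵐ[haarAddCircle] fun _ => 0 := by
    rw [sineVec, ← mul_apply_eq_comp, ← mulOn_mul e hf (memLp_sineFun 0), mulOn_apply,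
      e.map_eq_zero_iff, e.symm_apply_apply] at h0
    have := mulOp_apply_fourierLp_zero_ae ((memLp_sineFun 0).mul (r := ∞) hf)
    have h0' : mulOp haarAddCircle (f * sineFun 0) (fourierLp 2 0) = 0 := h0
    rw [h0'] at this
    filter_upwards [this, Lp.coeFn_zero ℂ 2 (haarAddCircle (T := 1)), sineFun_zero_ne_zero]
      with x h1 h2 h3
    rw [h2] at h1
    simpa [h3] using h1.symm
  have hx' : Eᗮ.starProjection x = x := Submodule.starProjection_eq_self_iff.2 hx
  rw [← hx', hP, mulOn_congr e hf hf0, mulOn_const]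
  simp

/-- The sine functions form an orthonormal basis. -/
def sineBasis : HilbertBasis ℕ ℂ K :=
  HilbertBasis.mkOfOrthogonalEqBot (orthonormal_sineVec e) (span_sineVec_orthogonal e)

theorem sineBasis_apply (k : ℕ) : sineBasis e k = sineVec e k := by
  rw [sineBasis, HilbertBasis.coe_mkOfOrthogonalEqBot]

end Model

/-! ### Rigidity of the von Neumann algebra generated by the coordinate -/

section Rigidity

open MeasureTheory AddCircle
open scoped ENNReal

/-- A star homomorphism fixing `a` fixes every continuous function of `a`, even if the function is
evaluated in a larger algebra. -/
theorem map_eq_self_of_eq_cfc {A B : Type*} [CStarAlgebra A] [CStarAlgebra B] (ι : A →⋆ₐ[ℂ] B)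
    (hι : Function.Injective ι) (θ : A →⋆ₐ[ℂ] A) {a x : A} (ha : IsSelfAdjoint a) (hθ : θ a = a)
    {f g : ℝ → ℝ} (hf : Continuous f) (hg : Continuous g)
    (hx : ι x = (cfc f (ι a) + Complex.I • cfc g (ι a)) ^ 2) : θ x = x := by
  have hιc : Continuous ι :=
    AddMonoidHomClass.continuous_of_bound ι 1 fun y => by
      simpa using NonUnitalStarAlgHom.norm_apply_le ι y
  have hθc : Continuous θ :=
    AddMonoidHomClass.continuous_of_bound θ 1 fun y => by
      simpa using NonUnitalStarAlgHom.norm_apply_le θ y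
  have hιa : IsSelfAdjoint (ι a) := ha.map ι
  have hθa : IsSelfAdjoint (θ a) := ha.map θ
  have e : x = (cfc f a + Complex.I • cfc g a) ^ 2 := by
    apply hι
    rw [hx, map_pow, map_add, map_smul,
      StarAlgHom.map_cfc (R := ℝ) (S := ℂ) ι f a hf.continuousOn hιc ha hιa,
      StarAlgHom.map_cfc (R := ℝ) (S := ℂ) ι g a hg.continuousOn hιc ha hιa]
  rw [e, map_pow, map_add, map_smul,
    StarAlgHom.map_cfc (R := ℝ) (S := ℂ) θ f a hf.continuousOn hθc ha hθa,
    StarAlgHom.map_cfc (R := ℝ) (S := ℂ) θ g a hg.continuousOn hθc ha hθa, hθ]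

variable {K : Type*} [NormedAddCommGroup K] [InnerProductSpace ℂ K] [CompleteSpace K]

theorem isClosed_vonNeumannAlgebra (N : VonNeumannAlgebra K) :
    IsClosed (N.toStarSubalgebra : Set (K →L[ℂ] K)) := by
  rw [VonNeumannAlgebra.coe_toStarSubalgebra, ← N.centralizer_centralizer]
  exact Set.isClosed_centralizer _

variable (e : Lp ℂ 2 (haarAddCircle (T := 1)) ≃ₗᵢ[ℂ] K)

theorem ae_norm_le_norm_mulOn {f : UnitAddCircle → ℂ} (hf : MemLp f ∞ haarAddCircle) :
    ∀ᵐ x ∂haarAddCircle, ‖f x‖ ≤ ‖mulOn e f‖ := by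
  have : ‖mulOp haarAddCircle f‖ ≤ ‖mulOn e f‖ := by
    refine ContinuousLinearMap.opNorm_le_bound _ (norm_nonneg _) fun y => ?_
    have := (mulOn e f).le_opNorm (e y)
    rwa [mulOn_apply, e.norm_map, e.norm_map, e.symm_apply_apply] at this
  filter_upwards [ae_norm_le_norm_mulOp hf] with x hx
  exact hx.trans this

theorem memLp_continuousMap (f : C(UnitAddCircle, ℂ)) : MemLp f ∞ (haarAddCircle (T := 1)) :=
  memLp_top_of_bound (C := ‖f‖) f.continuous.aestronglyMeasurable
    (ae_of_all _ fun x => f.norm_coe_le_norm x)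

theorem exists_measurable_of_commute {X : K →L[ℂ] K} (h : Commute (coordOp e) X) :
    ∃ f, Measurable f ∧ MemLp f ∞ haarAddCircle ∧ X = mulOn e f := by
  obtain ⟨f, hf, rfl⟩ := (commute_coordOp_iff e).1 h
  have hm := hf.1.ae_eq_mk
  exact ⟨hf.1.mk f, hf.1.stronglyMeasurable_mk.measurable, (memLp_congr_ae hm).1 hf,
    mulOn_congr e hf hm⟩

variable {N : VonNeumannAlgebra K}

/-- Multiplication by an essentially bounded function, as an element of the commutant `N` of the
coordinate unitary. -/
def mulElem (hN : ∀ X, X ∈ N ↔ Commute (coordOp e) X) (f : UnitAddCircle → ℂ)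
    (hf : MemLp f ∞ haarAddCircle) : N.toStarSubalgebra :=
  ⟨mulOn e f, (hN _).2 (commute_mulOn e (memLp_fourier 1) hf)⟩

theorem norm_starAlgEquiv_le (θ : N.toStarSubalgebra ≃⋆ₐ[ℂ] N.toStarSubalgebra)
    (y : N.toStarSubalgebra) : ‖θ y‖ ≤ ‖y‖ := by
  have := isClosed_vonNeumannAlgebra N
  exact NonUnitalStarAlgHom.norm_apply_le θ y

/-- An automorphism which fixes the coordinate fixes all continuous functions. -/
theorem map_mulElem_continuousMap (hN : ∀ X, X ∈ N ↔ Commute (coordOp e) X)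
    (θ : N.toStarSubalgebra ≃⋆ₐ[ℂ] N.toStarSubalgebra)
    (hθ : θ (mulElem e hN _ (memLp_fourier 1)) = mulElem e hN _ (memLp_fourier 1))
    (f : C(UnitAddCircle, ℂ)) :
    θ (mulElem e hN f (memLp_continuousMap f)) = mulElem e hN f (memLp_continuousMap f) := by
  let M : C(UnitAddCircle, ℂ) →⋆ₐ[ℂ] N.toStarSubalgebra :=
    { toFun := fun f => mulElem e hN f (memLp_continuousMap f)
      map_one' := Subtype.ext ((mulOn_const e 1).trans (one_smul _ _))
      map_mul' := fun f g => Subtype.ext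
        (mulOn_mul e (memLp_continuousMap f) (memLp_continuousMap g))
      map_zero' := Subtype.ext ((mulOn_const e 0).trans (zero_smul _ _))
      map_add' := fun f g => Subtype.ext
        (mulOn_add e (memLp_continuousMap f) (memLp_continuousMap g))
      commutes' := fun c => Subtype.ext ((mulOn_const e c).trans
        (Algebra.algebraMap_eq_smul_one c).symm)
      map_star' := fun f => Subtype.ext (star_mulOn e (memLp_continuousMap f)).symm }
  have hMc : Continuous M := AddMonoidHomClass.continuous_of_bound M 1 fun f => by
    rw [one_mul]
    exact norm_mulOn_le e (memLp_continuousMap f) (norm_nonneg f)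
      (ae_of_all _ fun x => f.norm_coe_le_norm x)
  have hθc : Continuous θ := AddMonoidHomClass.continuous_of_bound θ 1 fun y => by
    rw [one_mul]
    exact norm_starAlgEquiv_le θ y
  have hclosed : IsClosed {f | θ (M f) = M f} := isClosed_eq (hθc.comp hMc) hMc
  have hpos : ∀ n : ℕ, θ (M (fourier n)) = M (fourier n) := by
    intro n
    have hpow : (fourier n : C(UnitAddCircle, ℂ)) = fourier 1 ^ n := by
      ext x
      simp [fourier_apply, toCircle_nsmul]
    rw [hpow, map_pow, map_pow]
    congr 1
  have hfour : ∀ n : ℤ, θ (M (fourier n)) = M (fourier n) := by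
    intro n
    obtain ⟨m, rfl | rfl⟩ := n.eq_nat_or_neg
    · exact hpos m
    · have : (fourier (-(m : ℤ)) : C(UnitAddCircle, ℂ)) = star (fourier m) := by
        ext x
        exact fourier_neg
      rw [this, map_star, map_star, hpos]
  have hspan : (Submodule.span ℂ (Set.range (fourier (T := 1))) : Set C(UnitAddCircle, ℂ)) ⊆
      {f | θ (M f) = M f} := by
    intro f hf
    induction hf using Submodule.span_induction with
    | mem f hf => obtain ⟨n, rfl⟩ := hf; exact hfour n
    | zero => simp
    | add f g _ _ hf hg =>
      rw [Set.mem_ofPred_eq] at hf hg ⊢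
      rw [map_add, map_add, hf, hg]
    | smul c f _ hf =>
      rw [Set.mem_ofPred_eq] at hf ⊢
      rw [map_smul, map_smul, hf]
  have := closure_minimal hspan hclosed
  rw [← Submodule.topologicalClosure_coe, span_fourier_closure_eq_top] at this
  exact this trivial

theorem memLp_indicator {B : Set UnitAddCircle} (hB : MeasurableSet B) :
    MemLp (B.indicator fun _ => (1 : ℂ)) ∞ haarAddCircle := (memLp_top_const 1).indicator hB

/-- An automorphism which fixes the coordinate fixes the indicator functions of closed sets: a
closed set is the zero set of a continuous function, so its indicator function generates the
annihilator of that function. -/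
theorem map_mulElem_indicator (hN : ∀ X, X ∈ N ↔ Commute (coordOp e) X)
    (θ : N.toStarSubalgebra ≃⋆ₐ[ℂ] N.toStarSubalgebra)
    (hθ : θ (mulElem e hN _ (memLp_fourier 1)) = mulElem e hN _ (memLp_fourier 1))
    {B : Set UnitAddCircle} (hB : IsClosed B) (hne : B.Nonempty) :
    θ (mulElem e hN _ (memLp_indicator hB.measurableSet)) =
      mulElem e hN _ (memLp_indicator hB.measurableSet) := by
  let d : C(UnitAddCircle, ℂ) :=
    ⟨fun x => ((Metric.infDist x B : ℝ) : ℂ),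
      Complex.continuous_ofReal.comp (Metric.continuous_infDist_pt B)⟩
  set p := mulElem e hN _ (memLp_indicator hB.measurableSet) with hp
  set D := mulElem e hN d (memLp_continuousMap d) with hD
  have hDp : D * p = 0 := by
    apply Subtype.ext
    refine (mulOn_mul e (memLp_continuousMap d) (memLp_indicator hB.measurableSet)).symm.trans ?_
    refine Eq.trans ?_ ((mulOn_const e 0).trans (zero_smul _ _))
    congr 1
    ext x
    by_cases hx : x ∈ B
    · simp [d, Metric.infDist_zero_of_mem hx]
    · simp [hx]
  have key : ∀ θ' : N.toStarSubalgebra ≃⋆ₐ[ℂ] N.toStarSubalgebra, θ' D = D →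
      p * θ' p = θ' p := by
    intro θ' h
    have h0 : D * θ' p = 0 := by rw [← h, ← map_mul, hDp, map_zero]
    obtain ⟨f, hfm, hf, hX⟩ := exists_measurable_of_commute e ((hN _).1 (θ' p).2)
    have hX' : θ' p = mulElem e hN f hf := Subtype.ext hX
    rw [hX'] at h0 ⊢
    have h1 : mulOn e (fun x => d x * f x) = mulOn e fun _ => 0 := by
      rw [mulOn_mul e (memLp_continuousMap d) hf, mulOn_const, zero_smul]
      exact congrArg Subtype.val h0
    have h2 := mulOn_inj e (hf.mul (r := ∞) (memLp_continuousMap d)) MemLp.zero h1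
    apply Subtype.ext
    refine (mulOn_mul e (memLp_indicator hB.measurableSet) hf).symm.trans ?_
    refine (mulOn_congr e hf ?_).symm
    filter_upwards [h2] with x hx
    by_cases hxB : x ∈ B
    · simp [hxB]
    · have h3 := (hB.notMem_iff_infDist_pos hne).1 hxB
      have h4 : (d x) ≠ 0 := by
        simp only [d, ContinuousMap.coe_mk]
        exact_mod_cast h3.ne'
      have h5 : d x * f x = 0 := hx
      simp [hxB, (mul_eq_zero.1 h5).resolve_left h4]
  have hDθ : θ D = D := map_mulElem_continuousMap e hN θ hθ d
  have h1 := key θ hDθ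
  have h2 := key θ.symm (by rw [StarAlgEquiv.symm_apply_eq, hDθ])
  have h3 := congrArg θ h2
  rw [map_mul, StarAlgEquiv.apply_symm_apply] at h3
  have hcomm : ∀ y : N.toStarSubalgebra, p * y = y * p := by
    intro y
    obtain ⟨f, hfm, hf, hX⟩ := exists_measurable_of_commute e ((hN _).1 y.2)
    apply Subtype.ext
    change mulOn e _ * (y : K →L[ℂ] K) = (y : K →L[ℂ] K) * mulOn e _
    rw [hX]
    exact commute_mulOn e (memLp_indicator hB.measurableSet) hf
  rw [← h1, hcomm, h3]

/-- An automorphism which fixes the coordinate is the identity. If multiplication by `f` were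
mapped to multiplication by `g ≠ f`, there would be a disc containing the values of `f`, but not
those of `g`, on a compact set `B` of positive measure; since multiplication by the indicator
function of `B` is fixed, this contradicts contractivity. -/
theorem starAlgEquiv_apply_eq_of_coord (hN : ∀ X, X ∈ N ↔ Commute (coordOp e) X)
    (θ : N.toStarSubalgebra ≃⋆ₐ[ℂ] N.toStarSubalgebra)
    (hθ : θ (mulElem e hN _ (memLp_fourier 1)) = mulElem e hN _ (memLp_fourier 1))
    (y : N.toStarSubalgebra) : θ y = y := by
  obtain ⟨f, hfm, hf, hy⟩ := exists_measurable_of_commute e ((hN _).1 y.2)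
  obtain ⟨g, hgm, hg, hθy⟩ := exists_measurable_of_commute e ((hN _).1 (θ y).2)
  have hy' : y = mulElem e hN f hf := Subtype.ext hy
  have hθy' : θ y = mulElem e hN g hg := Subtype.ext hθy
  have hnull : ∀ (n : ℕ) (r : ℚ), haarAddCircle {x | ‖f x - TopologicalSpace.denseSeq ℂ n‖ ≤ r ∧
      (r : ℝ) < ‖g x - TopologicalSpace.denseSeq ℂ n‖} = 0 := by
    intro n r
    set q := TopologicalSpace.denseSeq ℂ n
    set B : Set UnitAddCircle := {x | ‖f x - q‖ ≤ r ∧ (r : ℝ) < ‖g x - q‖} with hB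
    by_contra hpos
    have hBm : MeasurableSet B :=
      (measurableSet_le (hfm.sub_const q).norm measurable_const).inter
        (measurableSet_lt measurable_const (hgm.sub_const q).norm)
    obtain ⟨C, hCB, hC, hCpos⟩ := hBm.exists_lt_isCompact_of_ne_top
      (measure_ne_top haarAddCircle B) (pos_iff_ne_zero.2 hpos)
    have hCne : C.Nonempty := by
      rw [Set.nonempty_iff_ne_empty]
      rintro rfl
      simp at hCpos
    have hr : (0 : ℝ) ≤ r := by
      obtain ⟨x, hx⟩ := hCne
      exact (norm_nonneg _).trans (hCB hx).1
    have hCm := hC.isClosed.measurableSet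
    set p := mulElem e hN _ (memLp_indicator hCm) with hp
    have hθp : θ p = p := map_mulElem_indicator e hN θ hθ hC.isClosed hCne
    have hval : ∀ (k : UnitAddCircle → ℂ) (hk : MemLp k ∞ haarAddCircle),
        (((mulElem e hN k hk - q • 1) * p : N.toStarSubalgebra) : K →L[ℂ] K) =
          mulOn e fun x => (k x - q) * C.indicator (fun _ => 1) x := by
      intro k hk
      have hkq : MemLp (fun x => k x - q) ∞ haarAddCircle := hk.sub (memLp_top_const q)
      rw [mulOn_mul e hkq (memLp_indicator hCm), mulOn_sub e hk (memLp_top_const q), mulOn_const]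
      rfl
    have h1 : ‖(y - q • 1) * p‖ ≤ r := by
      change ‖(((y - q • 1) * p : N.toStarSubalgebra) : K →L[ℂ] K)‖ ≤ r
      rw [hy', hval]
      refine norm_mulOn_le e ((memLp_indicator hCm).mul (hf.sub (memLp_top_const q))) hr
        (ae_of_all _ fun x => ?_)
      by_cases hx : x ∈ C
      · simpa [hx] using (hCB hx).1
      · simpa [hx] using hr
    have h2 : ‖(θ y - q • 1) * p‖ ≤ r := by
      refine le_trans (le_of_eq_of_le ?_ (norm_starAlgEquiv_le θ ((y - q • 1) * p))) h1
      rw [map_mul, map_sub, map_smul, map_one, hθp]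
    change ‖(((θ y - q • 1) * p : N.toStarSubalgebra) : K →L[ℂ] K)‖ ≤ r at h2
    rw [hθy', hval] at h2
    have hgq : MemLp (fun x => (g x - q) * C.indicator (fun _ => 1) x) ∞ haarAddCircle :=
      (memLp_indicator hCm).mul (hg.sub (memLp_top_const q))
    have h3 := ae_norm_le_norm_mulOn e hgq
    have h4 : haarAddCircle C = 0 := by
      refine measure_mono_null (fun x hx => ?_) h3
      simp only [Set.mem_compl_iff, Set.mem_ofPred_eq, not_le, Set.indicator_of_mem hx, mul_one]
      exact lt_of_le_of_lt h2 (hCB hx).2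
    exact hCpos.ne' h4
  have hae : f =ᵐ[haarAddCircle] g := by
    rw [Filter.EventuallyEq, ae_iff]
    refine measure_mono_null (fun x hx => ?_)
      (measure_iUnion_null fun n => measure_iUnion_null fun r => hnull n r)
    have hfg : 0 < ‖g x - f x‖ := norm_pos_iff.2 (sub_ne_zero.2 (Ne.symm hx))
    obtain ⟨n, hn⟩ := (TopologicalSpace.denseRange_denseSeq ℂ).exists_dist_lt (f x)
      (half_pos hfg)
    rw [dist_eq_norm] at hn
    have h2 : ‖f x - TopologicalSpace.denseSeq ℂ n‖ < ‖g x - TopologicalSpace.denseSeq ℂ n‖ := by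
      have := norm_sub_le_norm_sub_add_norm_sub (g x) (TopologicalSpace.denseSeq ℂ n) (f x)
      rw [norm_sub_rev (TopologicalSpace.denseSeq ℂ n)] at this
      linarith
    obtain ⟨r, hr1, hr2⟩ := exists_rat_btwn h2
    exact Set.mem_iUnion.2 ⟨n, Set.mem_iUnion.2 ⟨r, hr1.le, hr2⟩⟩
  rw [hθy', hy']
  exact Subtype.ext (mulOn_congr e hg hae.symm)

/-- An automorphism which fixes the model operator is the identity. -/
theorem starAlgEquiv_apply_eq_of_modelOp (hN : ∀ X, X ∈ N ↔ Commute (coordOp e) X) {c : ℝ}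
    (hc : 2 ≤ c) (θ : N.toStarSubalgebra ≃⋆ₐ[ℂ] N.toStarSubalgebra)
    (hθ : θ (mulElem e hN _ (memLp_symbolFun hc)) = mulElem e hN _ (memLp_symbolFun hc))
    (y : N.toStarSubalgebra) : θ y = y := by
  refine starAlgEquiv_apply_eq_of_coord e hN θ ?_ y
  have := isClosed_vonNeumannAlgebra N
  refine map_eq_self_of_eq_cfc N.toStarSubalgebra.subtype Subtype.val_injective
    (θ : N.toStarSubalgebra →⋆ₐ[ℂ] N.toStarSubalgebra) ?_ hθ (continuous_cosOfSymbol c)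
    (continuous_sinOfSymbol c) (coordOp_eq_cfc e hc)
  exact Subtype.ext (isSelfAdjoint_mulOn_ofReal e (memLp_symbolFun hc))

end Rigidity

/-! ### The group von Neumann algebra of the integers -/

section GroupVN

open MeasureTheory AddCircle
open scoped ENNReal

theorem mem_generatedVN_iff {H : Type*} [NormedAddCommGroup H] [InnerProductSpace ℂ H]
    [CompleteSpace H] {S : Set (H →L[ℂ] H)} {X : H →L[ℂ] H} :
    X ∈ generatedVN S ↔
      ∀ Y, (∀ s ∈ S, Commute s Y ∧ Commute (star s) Y) → Commute Y X := by
  rw [← SetLike.mem_coe, coe_generatedVN, Set.mem_centralizer_iff]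
  refine forall_congr' fun Y => imp_congr_left ?_
  rw [Set.mem_centralizer_iff]
  constructor
  · intro h s hs
    exact ⟨h s (Or.inl hs), h (star s) (Or.inr (by simpa using hs))⟩
  · rintro h s (hs | hs)
    · exact (h s hs).1
    · have := (h (star s) hs).2
      rw [star_star] at this
      exact this

theorem dense_span_fourier_multiplicative : ⊤ ≤ (Submodule.span ℂ (Set.range
    (fun g : Multiplicative ℤ => (fourierLp 2 g.toAdd :
      Lp ℂ 2 (haarAddCircle (T := 1)))))).topologicalClosure := by
  have h := (fourierBasis (T := 1)).dense_span
  rw [coe_fourierBasis] at h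
  have hr : Set.range (fun g : Multiplicative ℤ => (fourierLp 2 g.toAdd :
      Lp ℂ 2 (haarAddCircle (T := 1)))) = Set.range (fourierLp 2) :=
    (Multiplicative.toAdd (α := ℤ)).surjective.range_comp
      (fourierLp 2 : ℤ → Lp ℂ 2 (haarAddCircle (T := 1)))
  rw [hr, h]

/-- The Fourier transform `L²(ℝ/ℤ) ≃ ℓ²(ℤ)`. -/
def fourierEquiv : Lp ℂ 2 (haarAddCircle (T := 1)) ≃ₗᵢ[ℂ] EllTwo (Multiplicative ℤ) :=
  (HilbertBasis.mk (orthonormal_fourier.comp _ Multiplicative.toAdd.injective)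
    dense_span_fourier_multiplicative).repr

theorem fourierEquiv_fourierLp (g : Multiplicative ℤ) :
    fourierEquiv (fourierLp 2 g.toAdd) = EllTwo.delta g := by
  have h := HilbertBasis.repr_self (HilbertBasis.mk
    (orthonormal_fourier.comp _ Multiplicative.toAdd.injective)
    dense_span_fourier_multiplicative) g
  rw [HilbertBasis.coe_mk] at h
  refine h.trans ?_
  unfold EllTwo.delta
  congr!

theorem eq_of_forall_delta {ι : Type*} {F : Type*} [NormedAddCommGroup F] [NormedSpace ℂ F]
    {S T : EllTwo ι →L[ℂ] F} (h : ∀ i, S (EllTwo.delta i) = T (EllTwo.delta i)) : S = T := by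
  have hb : (Submodule.span ℂ (Set.range (EllTwo.delta (ι := ι))))ᗮ = ⊥ := by
    rw [Submodule.eq_bot_iff]
    intro x hx
    refine EllTwo.eq_zero_of_inner_delta x fun i => ?_
    exact (Submodule.mem_orthogonal _ _).1 hx _ (Submodule.subset_span ⟨i, rfl⟩)
  refine ContinuousLinearMap.ext_on (s := Set.range (EllTwo.delta (ι := ι))) ?_ ?_
  · rwa [Submodule.dense_iff_topologicalClosure_eq_top,
      Submodule.topologicalClosure_eq_top_iff]
  · rintro _ ⟨i, rfl⟩
    exact h i

/-- Under the Fourier transform, translations become multiplications by trigonometric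
monomials. -/
theorem leftRegular_eq_mulOn (g : Multiplicative ℤ) :
    leftRegular g = mulOn fourierEquiv (fourier g.toAdd : UnitAddCircle → ℂ) := by
  refine eq_of_forall_delta fun h => ?_
  rw [mulOn_apply, ← fourierEquiv_fourierLp h, LinearIsometryEquiv.symm_apply_apply,
    mulOp_fourier_apply, fourierEquiv_fourierLp]
  exact (EllTwo.mapInj_delta _ (mul_right_injective g) _).trans (fourierEquiv_fourierLp (g * h)).symm

/-- `Lℤ` is maximal abelian: it is the commutant of the generating translation. -/
theorem mem_LZ_iff (X : EllTwo (Multiplicative ℤ) →L[ℂ] EllTwo (Multiplicative ℤ)) :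
    X ∈ LZ ↔ Commute (coordOp fourierEquiv) X := by
  have hgen : coordOp fourierEquiv = leftRegular (Multiplicative.ofAdd (1 : ℤ)) :=
    (leftRegular_eq_mulOn _).symm
  rw [LZ, groupVN, mem_generatedVN_iff]
  constructor
  · intro h
    refine h _ ?_
    rintro _ ⟨g, rfl⟩
    rw [leftRegular_eq_mulOn, star_mulOn _ (memLp_fourier _)]
    exact ⟨commute_mulOn _ (memLp_fourier _) (memLp_fourier _),
      commute_mulOn _ (memLp_conj (memLp_fourier _)) (memLp_fourier _)⟩
  · intro h Y hY
    obtain ⟨f, hf, rfl⟩ := (commute_coordOp_iff _).1 h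
    have hY' := (hY (leftRegular (Multiplicative.ofAdd (1 : ℤ))) ⟨_, rfl⟩).1
    rw [← hgen] at hY'
    obtain ⟨g, hg, rfl⟩ := (commute_coordOp_iff _).1 hY'
    exact commute_mulOn _ hg hf

theorem commute_of_mem_LZ {X Y : EllTwo (Multiplicative ℤ) →L[ℂ] EllTwo (Multiplicative ℤ)}
    (hX : X ∈ LZ) (hY : Y ∈ LZ) : Commute X Y := by
  obtain ⟨f, hf, rfl⟩ := (commute_coordOp_iff _).1 ((mem_LZ_iff X).1 hX)
  obtain ⟨g, hg, rfl⟩ := (commute_coordOp_iff _).1 ((mem_LZ_iff Y).1 hY)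
  exact commute_mulOn _ hf hg

/-- The generator of `Lℤ`: a positive operator with absolutely continuous spectrum whose square is
`c` plus the Jacobi matrix of the Chebyshev polynomials. -/
def modelLZ (c : ℝ) : EllTwo (Multiplicative ℤ) →L[ℂ] EllTwo (Multiplicative ℤ) :=
  modelOp fourierEquiv c

theorem modelLZ_mem {c : ℝ} (hc : 2 ≤ c) : modelLZ c ∈ LZ :=
  (mem_LZ_iff _).2 (commute_mulOn _ (memLp_fourier 1) (memLp_symbolFun hc))

theorem mem_LZ_iff_commute_modelLZ {c : ℝ} (hc : 2 ≤ c)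
    (X : EllTwo (Multiplicative ℤ) →L[ℂ] EllTwo (Multiplicative ℤ)) :
    X ∈ LZ ↔ Commute (modelLZ c) X :=
  ⟨fun h => commute_of_mem_LZ (modelLZ_mem hc) h,
    fun h => (mem_LZ_iff X).2 (commute_coordOp_of_commute_modelOp _ hc h)⟩

theorem modelLZ_nonneg {c : ℝ} (hc : 2 ≤ c) : 0 ≤ modelLZ c := modelOp_nonneg _ hc

theorem generatedVN_modelLZ {c : ℝ} (hc : 2 ≤ c) : generatedVN {modelLZ c} = LZ := by
  ext X
  rw [mem_generatedVN_iff]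
  have hsa : star (modelLZ c) = modelLZ c := (IsSelfAdjoint.of_nonneg (modelLZ_nonneg hc)).star_eq
  constructor
  · intro h
    rw [mem_LZ_iff_commute_modelLZ hc]
    refine h _ ?_
    rintro _ rfl
    rw [hsa]
    exact ⟨Commute.refl _, Commute.refl _⟩
  · intro h Y hY
    exact commute_of_mem_LZ ((mem_LZ_iff_commute_modelLZ hc Y).2 (hY _ rfl).1) h

theorem starAlgEquiv_LZ_apply_eq {c : ℝ} (hc : 2 ≤ c)
    (θ : LZ.toStarSubalgebra ≃⋆ₐ[ℂ] LZ.toStarSubalgebra)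
    (hθ : θ ⟨modelLZ c, modelLZ_mem hc⟩ = ⟨modelLZ c, modelLZ_mem hc⟩)
    (y : LZ.toStarSubalgebra) : θ y = y :=
  starAlgEquiv_apply_eq_of_modelOp fourierEquiv mem_LZ_iff hc θ hθ y

end GroupVN

/-! ### Amplifications along families of isometries -/

section Amplification

variable {L H : Type*} [NormedAddCommGroup L] [InnerProductSpace ℂ L] [CompleteSpace L]
  [NormedAddCommGroup H] [InnerProductSpace ℂ H] [CompleteSpace H]

/-- The operator `∑ W_{ij} y_{ik} W_{kj}^*` on `H`, for a matrix `y` of operators on `L` and a family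
of operators `W_{ij} : L → H`. For isometries with pairwise orthogonal ranges this is `y`, acting
with multiplicity. -/
def amp {ι κ : Type*} [Fintype ι] [Fintype κ] (W : ι → κ → L →L[ℂ] H)
    (y : Matrix ι ι (L →L[ℂ] L)) : H →L[ℂ] H :=
  ∑ i, ∑ k, ∑ j, W i j ∘L y i k ∘L ContinuousLinearMap.adjoint (W k j)

variable {ι κ : Type*} [Fintype ι] [Fintype κ]

theorem amp_apply (W : ι → κ → L →L[ℂ] H) (y : Matrix ι ι (L →L[ℂ] L)) (v : H) :
    amp W y v = ∑ i, ∑ k, ∑ j, W i j (y i k (ContinuousLinearMap.adjoint (W k j) v)) := by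
  simp [amp]

/-- The operators `W_{ij}` are isometries with pairwise orthogonal ranges. -/
def IsOrthoFamily [DecidableEq ι] [DecidableEq κ] (W : ι → κ → L →L[ℂ] H) : Prop :=
  ∀ i j k l x, ContinuousLinearMap.adjoint (W i j) (W k l x) =
    if i = k then if j = l then x else 0 else 0

theorem amp_add (W : ι → κ → L →L[ℂ] H) (x y : Matrix ι ι (L →L[ℂ] L)) :
    amp W (x + y) = amp W x + amp W y := by
  ext v
  simp [amp_apply, Finset.sum_add_distrib]

theorem amp_zero (W : ι → κ → L →L[ℂ] H) : amp W (0 : Matrix ι ι (L →L[ℂ] L)) = 0 := by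
  ext v
  simp [amp_apply]

theorem amp_smul (W : ι → κ → L →L[ℂ] H) (c : ℂ) (y : Matrix ι ι (L →L[ℂ] L)) :
    amp W (c • y) = c • amp W y := by
  ext v
  simp [amp_apply, Finset.smul_sum]

theorem star_amp (W : ι → κ → L →L[ℂ] H) (y : Matrix ι ι (L →L[ℂ] L)) :
    star (amp W y) = amp W (star y) := by
  rw [ContinuousLinearMap.star_eq_adjoint, eq_comm, ContinuousLinearMap.eq_adjoint_iff]
  intro v v'
  rw [amp_apply, amp_apply, sum_inner, inner_sum]
  simp_rw [sum_inner, inner_sum]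
  rw [Finset.sum_comm]
  refine Finset.sum_congr rfl fun k _ => Finset.sum_congr rfl fun i _ =>
    Finset.sum_congr rfl fun j _ => ?_
  rw [Matrix.star_apply, ContinuousLinearMap.star_eq_adjoint,
    ← ContinuousLinearMap.adjoint_inner_right, ContinuousLinearMap.adjoint_inner_left,
    ContinuousLinearMap.adjoint_inner_left]

section

variable [DecidableEq ι] [DecidableEq κ] {W : ι → κ → L →L[ℂ] H}

theorem IsOrthoFamily.adjoint_amp (hW : IsOrthoFamily W) (y : Matrix ι ι (L →L[ℂ] L)) (i : ι)
    (j : κ) (v : H) : ContinuousLinearMap.adjoint (W i j) (amp W y v) =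
      ∑ k, y i k (ContinuousLinearMap.adjoint (W k j) v) := by
  rw [amp_apply]
  simp only [map_sum, hW i j]
  rw [Finset.sum_eq_single i]
  · simp
  · intro i' _ h
    simp [Ne.symm h]
  · simp

theorem IsOrthoFamily.amp_mul (hW : IsOrthoFamily W) (x y : Matrix ι ι (L →L[ℂ] L)) :
    amp W (x * y) = amp W x * amp W y := by
  ext v
  rw [mul_apply_eq_comp, amp_apply, amp_apply]
  refine Finset.sum_congr rfl fun i _ => ?_
  simp only [hW.adjoint_amp, Matrix.mul_apply, _root_.sum_apply, map_sum, mul_apply_eq_comp]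
  rw [Finset.sum_comm]
  conv_rhs => rw [Finset.sum_comm]
  refine Finset.sum_congr rfl fun j _ => ?_
  rw [Finset.sum_comm]

theorem IsOrthoFamily.amp_apply_apply (hW : IsOrthoFamily W) (y : Matrix ι ι (L →L[ℂ] L)) (k : ι)
    (j : κ) (x : L) : amp W y (W k j x) = ∑ i, W i j (y i k x) := by
  rw [amp_apply]
  refine Finset.sum_congr rfl fun i _ => ?_
  rw [Finset.sum_eq_single k]
  · rw [Finset.sum_eq_single j]
    · simp [hW k j k j]
    · intro l _ h
      simp [hW k l k j, h]
    · simp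
  · intro k' _ h
    refine Finset.sum_eq_zero fun l _ => ?_
    simp [hW k' l k j, h]
  · simp

theorem IsOrthoFamily.adjoint_amp_apply (hW : IsOrthoFamily W) (y : Matrix ι ι (L →L[ℂ] L))
    (i k : ι) (j l : κ) (x : L) : ContinuousLinearMap.adjoint (W i j) (amp W y (W k l x)) =
      if j = l then y i k x else 0 := by
  rw [hW.amp_apply_apply, map_sum, Finset.sum_eq_single i]
  · simp [hW i j i l]
  · intro i' _ h
    simp [hW i j i' l, Ne.symm h]
  · simp

theorem IsOrthoFamily.amp_injective [Nonempty κ] (hW : IsOrthoFamily W)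
    {x y : Matrix ι ι (L →L[ℂ] L)} (h : amp W x = amp W y) : x = y := by
  ext i k v
  obtain ⟨j⟩ := ‹Nonempty κ›
  have h1 := hW.adjoint_amp_apply x i k j j v
  rw [h, hW.adjoint_amp_apply] at h1
  simpa using h1.symm

end

end Amplification

/-! ### Polar decompositions and dense ranges -/

section Polar

variable {K H : Type*} [NormedAddCommGroup K] [InnerProductSpace ℂ K] [CompleteSpace K]
  [NormedAddCommGroup H] [InnerProductSpace ℂ H] [CompleteSpace H]

theorem denseRange_of_nonneg_of_injective {a : K →L[ℂ] K} (ha : 0 ≤ a)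
    (hinj : ∀ y, a y = 0 → y = 0) : DenseRange a := by
  have hsa : IsSelfAdjoint a := IsSelfAdjoint.of_nonneg ha
  change Dense (LinearMap.range (a : K →ₗ[ℂ] K) : Set K)
  rw [Submodule.dense_iff_topologicalClosure_eq_top, Submodule.topologicalClosure_eq_top_iff,
    Submodule.eq_bot_iff]
  intro x hx
  refine hinj x (ext_inner_left ℂ fun y => ?_)
  rw [inner_zero_right, ← ContinuousLinearMap.adjoint_inner_left,
    ← ContinuousLinearMap.star_eq_adjoint, hsa.star_eq]
  exact (Submodule.mem_orthogonal _ _).1 hx _ ⟨y, rfl⟩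

/-- If `‖s x‖ = ‖a x‖` for all `x` and `a` has dense range, then `s = u a` for an isometry `u`. -/
theorem exists_isometry_comp {a : K →L[ℂ] K} (ha : DenseRange a) {s : K →L[ℂ] H}
    (h : ∀ x, ‖s x‖ = ‖a x‖) : ∃ u : K →ₗᵢ[ℂ] H, ∀ x, s x = u (a x) := by
  have hn : ∃ C : ℝ, ∀ x, ‖(s : K →ₗ[ℂ] H) x‖ ≤ C * ‖(a : K →ₗ[ℂ] K) x‖ :=
    ⟨1, fun x => by rw [one_mul]; exact (h x).le⟩
  let u := (s : K →ₗ[ℂ] H).extendOfNorm (a : K →ₗ[ℂ] K)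
  have hu : ∀ x, u (a x) = s x := fun x => LinearMap.extendOfNorm_eq ha hn x
  refine ⟨⟨u, fun y => ?_⟩, fun x => (hu x).symm⟩
  refine congrFun (ha.equalizer (g := fun y => ‖u y‖) (h := fun y => ‖y‖)
    u.continuous.norm continuous_norm ?_) y
  ext x
  simp only [Function.comp_apply]
  rw [hu, h]

end Polar

/-! ### The von Neumann algebra of a matrix frame -/

section Frame

open ContinuousLinearMap (adjoint)

variable {L H : Type*} [NormedAddCommGroup L] [InnerProductSpace ℂ L] [CompleteSpace L]
  [NormedAddCommGroup H] [InnerProductSpace ℂ H] [CompleteSpace H]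

/-- A decomposition of `H` into the range of `z` and the (pairwise orthogonal) ranges of the
isometries `W_{ij} : L → H`, where the projection `z` has rank at most one. The index `i` is the
matrix index, `j` counts multiplicities. -/
structure IsMatrixFrame (z : H →L[ℂ] H) (W : Fin 2 → Fin 2 → L →L[ℂ] H) : Prop where
  ortho : IsOrthoFamily W
  map_eq_zero : ∀ i j x, z (W i j x) = 0
  isSelfAdjoint : IsSelfAdjoint z
  total : ∀ v, v = z v + ∑ i, ∑ j, W i j (adjoint (W i j) v)
  compress : ∀ T : H →L[ℂ] H, ∃ c : ℂ, ∀ v, z (T (z v)) = c • z v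

variable {z : H →L[ℂ] H} {W : Fin 2 → Fin 2 → L →L[ℂ] H}

theorem IsMatrixFrame.map_map (hW : IsMatrixFrame z W) (v : H) : z (z v) = z v := by
  conv_rhs => rw [hW.total v]
  simp [hW.map_eq_zero]

theorem IsMatrixFrame.adjoint_map (hW : IsMatrixFrame z W) (i j : Fin 2) (v : H) :
    adjoint (W i j) (z v) = 0 := by
  refine ext_inner_left ℂ fun x => ?_
  rw [inner_zero_right, ContinuousLinearMap.adjoint_inner_right, ← hW.isSelfAdjoint.star_eq,
    ContinuousLinearMap.star_eq_adjoint, ContinuousLinearMap.adjoint_inner_right,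
    hW.map_eq_zero, inner_zero_left]

theorem IsMatrixFrame.mul_amp (hW : IsMatrixFrame z W) (y : Matrix (Fin 2) (Fin 2) (L →L[ℂ] L)) :
    z * amp W y = 0 := by
  ext v
  simp [amp_apply, hW.map_eq_zero]

theorem IsMatrixFrame.amp_mul (hW : IsMatrixFrame z W) (y : Matrix (Fin 2) (Fin 2) (L →L[ℂ] L)) :
    amp W y * z = 0 := by
  ext v
  simp [amp_apply, hW.adjoint_map]

/-- The operators commuting with the four operators of a frame that generate its von Neumann
algebra: the two vertex projections, an edge whose only non-zero matrix entry is `a`, and the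
adjoint of that edge. -/
def FrameCommutes (z : H →L[ℂ] H) (W : Fin 2 → Fin 2 → L →L[ℂ] H) (a : L →L[ℂ] L)
    (X : H →L[ℂ] H) : Prop :=
  Commute X (z + amp W !![1, 0; 0, 0]) ∧ Commute X (amp W !![0, 0; 0, 1]) ∧
    Commute X (amp W !![0, a; 0, 0]) ∧ Commute X (amp W !![0, 0; a, 0])

theorem frameCommutes_star {a : L →L[ℂ] L} (hW : IsMatrixFrame z W) (ha : IsSelfAdjoint a)
    {X : H →L[ℂ] H} (h : FrameCommutes z W a X) : FrameCommutes z W a (star X) := by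
  obtain ⟨h1, h2, h3, h4⟩ := h
  have e : ∀ p q r s : L →L[ℂ] L, star (amp W !![p, q; r, s]) =
      amp W !![star p, star r; star q, star s] := by
    intro p q r s
    rw [star_amp]
    congr 1
    ext i j : 2
    fin_cases i <;> fin_cases j <;> rfl
  refine ⟨?_, ?_, ?_, ?_⟩
  · have := h1.star_star
    rwa [star_add, hW.isSelfAdjoint.star_eq, e, star_one, star_zero] at this
  · have := h2.star_star
    rwa [e, star_one, star_zero] at this
  · have := h4.star_star
    rwa [e, star_zero, ha.star_eq] at this
  · have := h3.star_star
    rwa [e, star_zero, ha.star_eq] at this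

/-- An operator commuting with the operators of a frame is diagonal with respect to the matrix index
and constant along it, with entries commuting with `a`. -/
theorem FrameCommutes.exists_entries {a : L →L[ℂ] L} (hW : IsMatrixFrame z W) (ha : 0 ≤ a)
    (hinj : ∀ y, a y = 0 → y = 0) {X : H →L[ℂ] H} (h : FrameCommutes z W a X) :
    (∀ i j x, z (X (W i j x)) = 0) ∧ ∃ x : Fin 2 → Fin 2 → L →L[ℂ] L,
      (∀ j l, Commute a (x j l)) ∧ ∀ i l y, X (W i l y) = ∑ j, W i j (x j l y) := by
  obtain ⟨h1, h2, h3, h4⟩ := h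
  have hO := hW.ortho
  -- the values of the generators on the ranges of the frame
  have c1 : ∀ v, X (z v + amp W !![1, 0; 0, 0] v) = z (X v) + amp W !![1, 0; 0, 0] (X v) :=
    fun v => congrArg (fun T => T v) h1.eq
  have c2 : ∀ v, X (amp W !![0, 0; 0, 1] v) = amp W !![0, 0; 0, 1] (X v) :=
    fun v => congrArg (fun T => T v) h2.eq
  have c3 : ∀ v, X (amp W !![0, a; 0, 0] v) = amp W !![0, a; 0, 0] (X v) :=
    fun v => congrArg (fun T => T v) h3.eq
  have c4 : ∀ v, X (amp W !![0, 0; a, 0] v) = amp W !![0, 0; a, 0] (X v) :=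
    fun v => congrArg (fun T => T v) h4.eq
  have d1 : ∀ l x, X (W 0 l x) = z (X (W 0 l x)) + amp W !![1, 0; 0, 0] (X (W 0 l x)) := by
    intro l x
    rw [← c1, hW.map_eq_zero, hO.amp_apply_apply]
    simp
  have d2 : ∀ l x, X (W 1 l x) = amp W !![0, 0; 0, 1] (X (W 1 l x)) := by
    intro l x
    rw [← c2, hO.amp_apply_apply]
    simp
  have d3 : ∀ l x, X (W 0 l (a x)) = amp W !![0, a; 0, 0] (X (W 1 l x)) := by
    intro l x
    rw [← c3, hO.amp_apply_apply]
    simp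
  have d4 : ∀ l x, X (W 1 l (a x)) = amp W !![0, 0; a, 0] (X (W 0 l x)) := by
    intro l x
    rw [← c4, hO.amp_apply_apply]
    simp
  have z1 : ∀ l x, z (X (W 1 l x)) = 0 := by
    intro l x
    rw [d2]
    exact congrArg (fun T : H →L[ℂ] H => T _) (hW.mul_amp _)
  have hd := denseRange_of_nonneg_of_injective ha hinj
  have z0 : ∀ l x, z (X (W 0 l x)) = 0 := by
    intro l x
    refine congrFun (hd.equalizer (g := fun y => z (X (W 0 l y))) (h := fun _ => 0)
      (by fun_prop) continuous_const ?_) x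
    ext y
    simp only [Function.comp_apply]
    rw [d3]
    exact congrArg (fun T : H →L[ℂ] H => T _) (hW.mul_amp _)
  have hz : ∀ i l x, z (X (W i l x)) = 0 := by
    intro i l x
    fin_cases i
    · exact z0 l x
    · exact z1 l x
  have o1 : ∀ j l x, adjoint (W 1 j) (X (W 0 l x)) = 0 := by
    intro j l x
    rw [d1, map_add, hO.adjoint_amp, hW.adjoint_map]
    simp
  have o2 : ∀ j l x, adjoint (W 0 j) (X (W 1 l x)) = 0 := by
    intro j l x
    rw [d2, hO.adjoint_amp]
    simp
  let P : Fin 2 → Fin 2 → L →L[ℂ] L := fun j l => adjoint (W 0 j) ∘L X ∘L W 0 l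
  let Q : Fin 2 → Fin 2 → L →L[ℂ] L := fun j l => adjoint (W 1 j) ∘L X ∘L W 1 l
  have e1 : ∀ j l, P j l * a = a * Q j l := by
    intro j l
    ext x
    change adjoint (W 0 j) (X (W 0 l (a x))) = a (adjoint (W 1 j) (X (W 1 l x)))
    rw [d3, hO.adjoint_amp]
    simp
  have e2 : ∀ j l, Q j l * a = a * P j l := by
    intro j l
    ext x
    change adjoint (W 1 j) (X (W 1 l (a x))) = a (adjoint (W 0 j) (X (W 0 l x)))
    rw [d4, hO.adjoint_amp]
    simp
  have e3 : ∀ j l, Commute a (P j l) := by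
    intro j l
    refine commute_of_commute_mul_self ha ?_
    change a * a * P j l = P j l * (a * a)
    rw [mul_assoc, ← e2, ← mul_assoc, ← e1, mul_assoc]
  have e4 : ∀ j l, P j l = Q j l := by
    intro j l
    have : a * P j l = a * Q j l := by rw [(e3 j l).eq, e1]
    ext x
    rw [← sub_eq_zero]
    apply hinj
    rw [map_sub, sub_eq_zero]
    exact congrArg (fun T => T x) this
  refine ⟨hz, P, e3, fun i l y => ?_⟩
  rw [hW.total (X (W i l y)), hz, zero_add]
  fin_cases i
  · simp [Fin.sum_univ_two, o1, P]
  · simp only [e4]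
    simp [Fin.sum_univ_two, o2, Q]

theorem FrameCommutes.commute_proj {a : L →L[ℂ] L} (hW : IsMatrixFrame z W) (ha : 0 ≤ a)
    (hinj : ∀ y, a y = 0 → y = 0) {X : H →L[ℂ] H} (h : FrameCommutes z W a X) : Commute X z := by
  have key : ∀ Y, FrameCommutes z W a Y → z * Y = z * Y * z := by
    intro Y hY
    have hz := (hY.exists_entries hW ha hinj).1
    ext v
    change z (Y v) = z (Y (z v))
    conv_lhs => rw [hW.total v]
    simp [hz]
  have h1 := key X h
  have h2 := key _ (frameCommutes_star hW (IsSelfAdjoint.of_nonneg ha) h)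
  have h3 := congrArg star h2
  rw [star_mul, star_mul, star_mul, star_star, hW.isSelfAdjoint.star_eq] at h3
  change X * z = z * X
  rw [h1, h3, mul_assoc]

/-- An operator commuting with the operators of a frame commutes with all amplified matrices whose
entries commute with everything that commutes with `a`. -/
theorem FrameCommutes.commute_amp {a : L →L[ℂ] L} (hW : IsMatrixFrame z W) (ha : 0 ≤ a)
    (hinj : ∀ y, a y = 0 → y = 0) {X : H →L[ℂ] H} (h : FrameCommutes z W a X)
    {y : Matrix (Fin 2) (Fin 2) (L →L[ℂ] L)} (hy : ∀ i k x, Commute a x → Commute (y i k) x) :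
    Commute X (amp W y) := by
  obtain ⟨hz, x, hx, hX⟩ := h.exists_entries hW ha hinj
  have hXz := h.commute_proj hW ha hinj
  ext v
  change X (amp W y v) = amp W y (X v)
  -- both sides vanish on the range of `z`
  have e1 : ∀ v, amp W y (z v) = 0 := fun v => congrArg (fun T => T v) (hW.amp_mul y)
  have e2 : amp W y (X (z v)) = 0 := by
    have : X (z v) = z (X v) := congrArg (fun T => T v) hXz.eq
    rw [this, e1]
  have key : ∀ k l u, X (amp W y (W k l u)) = amp W y (X (W k l u)) := by
    intro k l u
    rw [hW.ortho.amp_apply_apply, hX, map_sum, map_sum]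
    simp_rw [hW.ortho.amp_apply_apply, hX]
    rw [Finset.sum_comm]
    refine Finset.sum_congr rfl fun j _ => Finset.sum_congr rfl fun i _ => ?_
    congr 1
    exact (congrArg (fun T => T u) (hy i k _ (hx j l)).eq).symm
  rw [hW.total v]
  simp only [map_add, map_sum, e1, e2, key, map_zero]

theorem amp_eq_of_cons (W : Fin 2 → Fin 2 → L →L[ℂ] H) (p q r s : L →L[ℂ] L) (v : H) :
    amp W !![p, q; r, s] v = ∑ j, (W 0 j (p (adjoint (W 0 j) v)) + W 0 j (q (adjoint (W 1 j) v)) +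
      W 1 j (r (adjoint (W 0 j) v)) + W 1 j (s (adjoint (W 1 j) v))) := by
  simp [amp_apply, Fin.sum_univ_two]
  abel

/-- The multiplicity operators `∑ᵢ W_{ij} c W_{il}^*` commute with the operators of a frame. -/
theorem frameCommutes_multiplicity {a c : L →L[ℂ] L} (hW : IsMatrixFrame z W) (hc : Commute a c)
    (j l : Fin 2) : FrameCommutes z W a (∑ i, W i j ∘L c ∘L adjoint (W i l)) := by
  have hca : ∀ x, c (a x) = a (c x) := fun x => congrArg (fun T => T x) hc.eq.symm
  have hO := hW.ortho
  have key : ∀ y : Matrix (Fin 2) (Fin 2) (L →L[ℂ] L), (∀ i k x, c (y i k x) = y i k (c x)) →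
      Commute (∑ i, W i j ∘L c ∘L adjoint (W i l)) (amp W y) := by
    intro y hy
    ext v
    simp only [mul_apply_eq_comp, _root_.sum_apply, ContinuousLinearMap.comp_apply,
      hO.adjoint_amp, map_sum, hO.amp_apply_apply, hy]
    rw [Finset.sum_comm]
  refine ⟨Commute.add_right ?_ (key _ ?_), key _ ?_, key _ ?_, key _ ?_⟩
  · ext v
    simp [hW.map_eq_zero, hW.adjoint_map]
  all_goals
    intro i k x
    fin_cases i <;> fin_cases k <;> simp [hca]

/-- The von Neumann algebra generated by the operators of a frame consists of the operators
`λ z + ∑ W_{ij} y_{ik} W_{kj}^*` with entries in the maximal abelian algebra `N = {a}'`. -/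
theorem IsMatrixFrame.mem_iff {a : L →L[ℂ] L} (hW : IsMatrixFrame z W) (ha : 0 ≤ a)
    (hinj : ∀ y, a y = 0 → y = 0) {N : VonNeumannAlgebra L} (hN : ∀ X, X ∈ N ↔ Commute a X)
    (hcomm : ∀ X ∈ N, ∀ Y ∈ N, Commute X Y) {M : VonNeumannAlgebra H}
    (hM : ∀ T, T ∈ M ↔ ∀ X, FrameCommutes z W a X → Commute X T) (T : H →L[ℂ] H) :
    T ∈ M ↔ ∃ (c : ℂ) (y : Matrix (Fin 2) (Fin 2) (L →L[ℂ] L)),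
      (∀ i k, y i k ∈ N) ∧ T = c • z + amp W y := by
  rw [hM]
  constructor
  · intro h
    have hO := hW.ortho
    have hz : Commute z T := by
      refine h z ⟨?_, ?_, ?_, ?_⟩
      · refine (Commute.refl z).add_right ?_
        rw [Commute, SemiconjBy, hW.mul_amp, hW.amp_mul]
      all_goals rw [Commute, SemiconjBy, hW.mul_amp, hW.amp_mul]
    obtain ⟨c, hc⟩ := hW.compress T
    let y : Matrix (Fin 2) (Fin 2) (L →L[ℂ] L) := fun i k => adjoint (W i 0) ∘L T ∘L W k 0
    have hmult : ∀ (b : L →L[ℂ] L), Commute a b → ∀ j l v,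
        ∑ i, W i j (b (adjoint (W i l) (T v))) = T (∑ i, W i j (b (adjoint (W i l) v))) := by
      intro b hb j l v
      have := congrArg (fun S => S v) (h _ (frameCommutes_multiplicity hW hb j l)).eq
      simpa using this
    -- the entries of `T` do not depend on the multiplicity index
    have hent : ∀ i j k l x, adjoint (W i j) (T (W k l x)) = if j = l then y i k x else 0 := by
      intro i j k l x
      have h1 := hmult 1 (Commute.one_right a) 0 j (W k l x)
      have h2 := congrArg (adjoint (W i 0)) h1
      simp only [map_sum, one_apply_eq_self, hO i 0, hO _ j] at h2
      rw [Finset.sum_eq_single i (by intro i' _ h; simp [Ne.symm h]) (by simp)] at h2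
      simp only [if_true] at h2
      rw [h2, Finset.sum_eq_single k (by intro i' _ h; simp [h]) (by simp), if_pos rfl]
      by_cases hjl : j = l
      · rw [if_pos hjl, if_pos hjl]
        rfl
      · rw [if_neg hjl, if_neg hjl, map_zero, map_zero, map_zero]
    refine ⟨c, y, fun i k => ?_, ?_⟩
    · rw [hN]
      ext x
      have h1 := hmult a (Commute.refl a) 0 0 (W k 0 x)
      have h2 := congrArg (adjoint (W i 0)) h1
      simp only [map_sum, hO _ 0 _ 0] at h2
      rw [Finset.sum_eq_single i (by intro i' _ h; simp [Ne.symm h]) (by simp),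
        Finset.sum_eq_single k (by intro i' _ h; simp [h]) (by simp)] at h2
      simpa [y] using h2
    · have hTz : ∀ v, T (z v) = c • z v := by
        intro v
        rw [← hc, ← hW.map_map v]
        have := congrArg (fun S => S (z v)) hz.eq
        simp only [mul_apply_eq_comp] at this
        rw [hW.map_map, this, hW.map_map]
      have hTW : ∀ k l x, T (W k l x) = amp W y (W k l x) := by
        intro k l x
        rw [hO.amp_apply_apply, hW.total (T (W k l x))]
        have hz0 : z (T (W k l x)) = 0 := by
          have := congrArg (fun S => S (W k l x)) hz.eq
          simp only [mul_apply_eq_comp] at this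
          rw [this, hW.map_eq_zero, map_zero]
        rw [hz0, zero_add]
        simp only [hent]
        refine Finset.sum_congr rfl fun i _ => ?_
        rw [Finset.sum_eq_single l (by intro j _ h; simp [h]) (by simp), if_pos rfl]
      ext v
      have e1 : amp W y (z v) = 0 := congrArg (fun S => S v) (hW.amp_mul y)
      rw [_root_.add_apply, _root_.smul_apply]
      conv_lhs => rw [hW.total v]
      conv_rhs => rw [hW.total v]
      simp only [map_add, map_sum, hTz, hTW, hW.map_map, hW.map_eq_zero, e1]
      simp
  · rintro ⟨c, y, hy, rfl⟩ X hX
    refine ((hX.commute_proj hW ha hinj).smul_right c).add_right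
      (hX.commute_amp hW ha hinj fun i k x hx => hcomm _ (hy i k) _ ((hN x).2 hx))

end Frame

/-! ### Isomorphisms with matrix algebras -/

section MatrixIso

variable {L H : Type*} [NormedAddCommGroup L] [InnerProductSpace ℂ L] [CompleteSpace L]
  [NormedAddCommGroup H] [InnerProductSpace ℂ H] [CompleteSpace H]
  {N : VonNeumannAlgebra L} {M : VonNeumannAlgebra H}

/-- The matrix of operators underlying a matrix with entries in a von Neumann algebra. -/
def matVal {ι : Type*} (y : Matrix ι ι N.toStarSubalgebra) : Matrix ι ι (L →L[ℂ] L) :=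
  fun i k => (y i k : L →L[ℂ] L)

theorem matVal_mul {ι : Type*} [Fintype ι] (x y : Matrix ι ι N.toStarSubalgebra) :
    matVal (x * y) = matVal x * matVal y := by
  ext i k : 2
  simp [matVal, Matrix.mul_apply]

theorem matVal_add {ι : Type*} (x y : Matrix ι ι N.toStarSubalgebra) :
    matVal (x + y) = matVal x + matVal y := rfl

theorem matVal_smul {ι : Type*} (c : ℂ) (y : Matrix ι ι N.toStarSubalgebra) :
    matVal (c • y) = c • matVal y := rfl

theorem matVal_star {ι : Type*} (y : Matrix ι ι N.toStarSubalgebra) :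
    matVal (star y) = star (matVal y) := rfl

theorem matVal_cons (p q r s : N.toStarSubalgebra) :
    matVal !![p, q; r, s] = !![(p : L →L[ℂ] L), q; r, s] := by
  ext i k : 2
  fin_cases i <;> fin_cases k <;> rfl

theorem matVal_injective {ι : Type*} :
    Function.Injective (matVal : Matrix ι ι N.toStarSubalgebra → _) := by
  intro x y h
  ext i k : 2
  exact congrFun (congrFun h i) k

/-- The algebra of the operators `c z + amp W y` is `ℂ ⊕ M₂(N)`, since `y ↦ amp W y` is a faithful
representation and `z` is orthogonal to its range. -/
theorem exists_starAlgEquiv_prod {z : H →L[ℂ] H} {W : Fin 2 → Fin 2 → L →L[ℂ] H}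
    (hW : IsMatrixFrame z W) (hz : z ≠ 0)
    (hM : ∀ T, T ∈ M ↔ ∃ (c : ℂ) (y : Matrix (Fin 2) (Fin 2) (L →L[ℂ] L)),
      (∀ i k, y i k ∈ N) ∧ T = c • z + amp W y) :
    ∃ Ψ : (ℂ × Matrix (Fin 2) (Fin 2) N.toStarSubalgebra) ≃⋆ₐ[ℂ] M.toStarSubalgebra,
      ∀ p, (Ψ p : H →L[ℂ] H) = p.1 • z + amp W (matVal p.2) := by
  have hzz : z * z = z := by
    ext v
    exact hW.map_map v
  let f : (ℂ × Matrix (Fin 2) (Fin 2) N.toStarSubalgebra) →⋆ₙₐ[ℂ] M.toStarSubalgebra :=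
    { toFun := fun p => ⟨p.1 • z + amp W (matVal p.2),
        (hM _).2 ⟨p.1, matVal p.2, fun i k => (p.2 i k).2, rfl⟩⟩
      map_smul' := fun c p => Subtype.ext <| by
        simp only [Prod.smul_fst, Prod.smul_snd, matVal_smul, amp_smul, smul_eq_mul, mul_smul,
          MonoidHom.id_apply]
        exact (smul_add c _ _).symm
      map_zero' := Subtype.ext <| by
        change (0 : ℂ) • z + amp W 0 = 0
        rw [zero_smul, amp_zero, add_zero]
      map_add' := fun p q => Subtype.ext <| by
        simp only [Prod.fst_add, Prod.snd_add, matVal_add, amp_add, add_smul]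
        exact add_add_add_comm _ _ _ _
      map_mul' := fun p q => Subtype.ext <| by
        change (p.1 * q.1) • z + amp W (matVal (p.2 * q.2)) =
          (p.1 • z + amp W (matVal p.2)) * (q.1 • z + amp W (matVal q.2))
        rw [matVal_mul, hW.ortho.amp_mul, add_mul, mul_add, mul_add, smul_mul_smul_comm, hzz,
          smul_mul_assoc, hW.mul_amp, mul_smul_comm, hW.amp_mul]
        simp
      map_star' := fun p => Subtype.ext <| by
        change star p.1 • z + amp W (matVal (star p.2)) = star (p.1 • z + amp W (matVal p.2))
        rw [matVal_star, ← star_amp, star_add, star_smul, hW.isSelfAdjoint.star_eq] }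
  refine ⟨StarAlgEquiv.ofBijective f ⟨fun p q h => ?_, fun T => ?_⟩, fun p => rfl⟩
  · have h1 : p.1 • z + amp W (matVal p.2) = q.1 • z + amp W (matVal q.2) :=
      congrArg Subtype.val h
    have h2 := congrArg (fun T => z * T) h1
    simp only [mul_add, mul_smul_comm, hzz, hW.mul_amp, add_zero] at h2
    have h3 : p.1 = q.1 := smul_left_injective ℂ hz h2
    rw [h3] at h1
    exact Prod.ext h3 (matVal_injective (hW.ortho.amp_injective (add_left_cancel h1)))
  · obtain ⟨c, y, hy, hT⟩ := (hM T).1 T.2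
    exact ⟨(c, fun i k => ⟨y i k, hy i k⟩), Subtype.ext hT.symm⟩

theorem exists_starAlgEquiv_matrix {W : Fin 2 → Fin 2 → L →L[ℂ] H}
    (hW : IsMatrixFrame 0 W)
    (hM : ∀ T, T ∈ M ↔ ∃ (c : ℂ) (y : Matrix (Fin 2) (Fin 2) (L →L[ℂ] L)),
      (∀ i k, y i k ∈ N) ∧ T = c • (0 : H →L[ℂ] H) + amp W y) :
    ∃ Ψ : Matrix (Fin 2) (Fin 2) N.toStarSubalgebra ≃⋆ₐ[ℂ] M.toStarSubalgebra,
      ∀ p, (Ψ p : H →L[ℂ] H) = amp W (matVal p) := by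
  let f : Matrix (Fin 2) (Fin 2) N.toStarSubalgebra →⋆ₙₐ[ℂ] M.toStarSubalgebra :=
    { toFun := fun p => ⟨amp W (matVal p),
        (hM _).2 ⟨0, matVal p, fun i k => (p i k).2, by simp⟩⟩
      map_smul' := fun c p => Subtype.ext <| by
        simp only [matVal_smul, amp_smul, MonoidHom.id_apply]
        rfl
      map_zero' := Subtype.ext (amp_zero W)
      map_add' := fun p q => Subtype.ext <| by
        simp only [matVal_add, amp_add]
        rfl
      map_mul' := fun p q => Subtype.ext <| by
        change amp W (matVal (p * q)) = amp W (matVal p) * amp W (matVal q)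
        rw [matVal_mul, hW.ortho.amp_mul]
      map_star' := fun p => Subtype.ext <| by
        change amp W (matVal (star p)) = star (amp W (matVal p))
        rw [matVal_star, ← star_amp] }
  refine ⟨StarAlgEquiv.ofBijective f ⟨fun p q h => ?_, fun T => ?_⟩, fun p => rfl⟩
  · exact matVal_injective (hW.ortho.amp_injective (congrArg Subtype.val h))
  · obtain ⟨c, y, hy, hT⟩ := (hM T).1 T.2
    rw [smul_zero, zero_add] at hT
    exact ⟨fun i k => ⟨y i k, hy i k⟩, Subtype.ext hT.symm⟩

/-- The matrix with the single entry `b` in the lower right corner. -/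
def lowerCorner {A : Type*} [Zero A] (b : A) : Matrix (Fin 2) (Fin 2) A := !![0, 0; 0, b]

theorem lowerCorner_mul {A : Type*} [Ring A] (b c : A) :
    lowerCorner b * lowerCorner c = lowerCorner (b * c) := by
  ext i k
  fin_cases i <;> fin_cases k <;> simp [lowerCorner, Matrix.mul_apply, Fin.sum_univ_two]

theorem lowerCorner_one_mul_mul {A : Type*} [Ring A] (r : Matrix (Fin 2) (Fin 2) A) :
    lowerCorner 1 * r * lowerCorner 1 = lowerCorner (r 1 1) := by
  ext i k
  simp only [Matrix.mul_apply, Fin.sum_univ_two]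
  fin_cases i <;> fin_cases k <;> simp [lowerCorner]

/-- An automorphism of an algebra `R` containing `M₂(A)` as an ideal which fixes the matrix unit
`e₁₂` and an element of the lower right corner fixes `M₂(A)`, provided that automorphisms of `A`
fixing that element are trivial. -/
theorem starAlgEquiv_eq_of_matrix {A R : Type*} [Ring A] [StarRing A] [Algebra ℂ A]
    [StarModule ℂ A] [Ring R] [StarRing R] [Algebra ℂ R] [StarModule ℂ R]
    (j : Matrix (Fin 2) (Fin 2) A →⋆ₙₐ[ℂ] R) (hj : Function.Injective j)
    (hcorner : ∀ r, ∃ b, j (lowerCorner 1) * r * j (lowerCorner 1) = j (lowerCorner b))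
    {a : A} (hA : ∀ θ : A ≃⋆ₐ[ℂ] A, θ a = a → ∀ b, θ b = b) (Θ : R ≃⋆ₐ[ℂ] R)
    (h1 : Θ (j !![0, 1; 0, 0]) = j !![0, 1; 0, 0])
    (h2 : Θ (j (lowerCorner a)) = j (lowerCorner a)) (y : Matrix (Fin 2) (Fin 2) A) :
    Θ (j y) = j y := by
  have hstar : star (!![0, 1; 0, 0] : Matrix (Fin 2) (Fin 2) A) = !![0, 0; 1, 0] := by
    ext i k
    fin_cases i <;> fin_cases k <;> simp [Matrix.star_apply]
  have h3 : Θ (j !![0, 0; 1, 0]) = j !![0, 0; 1, 0] := by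
    rw [← hstar, map_star, map_star, h1]
  have hunit : (!![0, 0; 1, 0] * !![0, 1; 0, 0] : Matrix (Fin 2) (Fin 2) A) = lowerCorner 1 := by
    ext i k
    fin_cases i <;> fin_cases k <;> simp [lowerCorner, Matrix.mul_apply, Fin.sum_univ_two]
  have h4 : Θ (j (lowerCorner 1)) = j (lowerCorner 1) := by
    rw [← hunit, map_mul, map_mul, h1, h3]
  have hinj : ∀ b c : A, j (lowerCorner b) = j (lowerCorner c) → b = c := by
    intro b c h
    simpa [lowerCorner] using congrFun (congrFun (hj h) 1) 1
  -- the restriction of an automorphism to the lower right corner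
  have hex : ∀ Θ' : R ≃⋆ₐ[ℂ] R, Θ' (j (lowerCorner 1)) = j (lowerCorner 1) → ∀ b, ∃ c,
      Θ' (j (lowerCorner b)) = j (lowerCorner c) := by
    intro Θ' h b
    obtain ⟨c, hc⟩ := hcorner (Θ' (j (lowerCorner b)))
    refine ⟨c, hc ▸ ?_⟩
    rw [← h, ← map_mul, ← map_mul, ← map_mul, ← map_mul, lowerCorner_mul, lowerCorner_mul, one_mul,
      mul_one]
  choose f hf using hex Θ h4
  choose g hg using hex Θ.symm (by rw [StarAlgEquiv.symm_apply_eq, h4])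
  have hadd : ∀ b c : A, lowerCorner (b + c) = lowerCorner b + lowerCorner c := by
    intro b c
    ext i k
    fin_cases i <;> fin_cases k <;> simp [lowerCorner]
  have hsmul : ∀ (t : ℂ) (b : A), lowerCorner (t • b) = t • lowerCorner b := by
    intro t b
    ext i k
    fin_cases i <;> fin_cases k <;> simp [lowerCorner]
  have hst : ∀ b : A, lowerCorner (star b) = star (lowerCorner b) := by
    intro b
    ext i k
    fin_cases i <;> fin_cases k <;> simp [lowerCorner, Matrix.star_apply]
  let θ : A ≃⋆ₐ[ℂ] A :=
    { toFun := f
      invFun := g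
      left_inv := fun b => hinj _ _ <| by rw [← hg, ← hf, StarAlgEquiv.symm_apply_apply]
      right_inv := fun b => hinj _ _ <| by rw [← hf, ← hg, StarAlgEquiv.apply_symm_apply]
      map_mul' := fun b c => hinj _ _ <| by
        rw [← hf, ← lowerCorner_mul, ← lowerCorner_mul, map_mul, map_mul, map_mul, hf, hf]
      map_add' := fun b c => hinj _ _ <| by rw [← hf, hadd, hadd, map_add, map_add, map_add, hf, hf]
      map_star' := fun b => hinj _ _ <| by rw [← hf, hst, hst, map_star, map_star, map_star, hf]
      map_smul' := fun t b => hinj _ _ <| by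
        rw [← hf, hsmul, hsmul, map_smul, map_smul, map_smul, hf] }
  have hθ : ∀ b, f b = b := hA θ (hinj _ _ ((hf a).symm.trans h2))
  have hlc : ∀ b, Θ (j (lowerCorner b)) = j (lowerCorner b) := fun b => by rw [hf, hθ]
  have hy : y = !![0, 1; 0, 0] * lowerCorner (y 0 0) * !![0, 0; 1, 0] +
      !![0, 1; 0, 0] * lowerCorner (y 0 1) + lowerCorner (y 1 0) * !![0, 0; 1, 0] +
      lowerCorner (y 1 1) := by
    ext i k
    fin_cases i <;> fin_cases k <;>
      simp [lowerCorner]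
  rw [hy]
  simp only [map_add, map_mul, h1, h3, hlc]

/-- Uniqueness of an isomorphism with `ℂ ⊕ M₂(A)`. -/
theorem starAlgEquiv_prod_unique {A R : Type*} [Ring A] [StarRing A] [Algebra ℂ A]
    [StarModule ℂ A] [Ring R] [StarRing R] [Algebra ℂ R] [StarModule ℂ R]
    {a : A} (hA : ∀ θ : A ≃⋆ₐ[ℂ] A, θ a = a → ∀ b, θ b = b) {z u t : R}
    {Φ Φ' : R ≃⋆ₐ[ℂ] ℂ × Matrix (Fin 2) (Fin 2) A}
    (hz : Φ z = (1, 0)) (hu : Φ u = (0, !![0, 1; 0, 0])) (ht : Φ t = (0, !![0, 0; 0, a]))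
    (hz' : Φ' z = (1, 0)) (hu' : Φ' u = (0, !![0, 1; 0, 0]))
    (ht' : Φ' t = (0, !![0, 0; 0, a])) : Φ' = Φ := by
  let j : Matrix (Fin 2) (Fin 2) A →⋆ₙₐ[ℂ] ℂ × Matrix (Fin 2) (Fin 2) A :=
    NonUnitalStarAlgHom.inr ℂ ℂ (Matrix (Fin 2) (Fin 2) A)
  have hj : ∀ y, j y = (0, y) := fun y => rfl
  have hcorner : ∀ r, ∃ b, j (lowerCorner 1) * r * j (lowerCorner 1) = j (lowerCorner b) := by
    intro r
    refine ⟨r.2 1 1, ?_⟩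
    rw [hj, hj]
    refine Prod.ext (by simp) ?_
    exact lowerCorner_one_mul_mul r.2
  have key := starAlgEquiv_eq_of_matrix j (fun x y h => congrArg Prod.snd h) hcorner hA
    (Φ.symm.trans Φ')
    (by
      rw [hj, ← hu, StarAlgEquiv.trans_apply, StarAlgEquiv.symm_apply_apply, hu, hu'])
    (by
      have : j (lowerCorner a) = Φ t := ht.symm
      rw [this, StarAlgEquiv.trans_apply, StarAlgEquiv.symm_apply_apply, ht, ht'])
  ext r : 1
  have h1 : Φ r = (Φ r).1 • Φ z + j (Φ r).2 := by
    rw [hz, hj]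
    ext <;> simp
  have h2 : r = (Φ r).1 • z + Φ.symm (j (Φ r).2) := by
    apply EquivLike.injective Φ
    rw [map_add, map_smul, StarAlgEquiv.apply_symm_apply, ← h1]
  have h3 : Φ' (Φ.symm (j (Φ r).2)) = j (Φ r).2 := key _
  conv_lhs => rw [h2]
  rw [map_add, map_smul, h3, hz', ← hz, ← h1]

/-- Uniqueness of an isomorphism with `M₂(A)`. -/
theorem starAlgEquiv_matrix_unique {A R : Type*} [Ring A] [StarRing A] [Algebra ℂ A]
    [StarModule ℂ A] [Ring R] [StarRing R] [Algebra ℂ R] [StarModule ℂ R]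
    {a : A} (hA : ∀ θ : A ≃⋆ₐ[ℂ] A, θ a = a → ∀ b, θ b = b) {u t : R}
    {Φ Φ' : R ≃⋆ₐ[ℂ] Matrix (Fin 2) (Fin 2) A}
    (hu : Φ u = !![0, 1; 0, 0]) (ht : Φ t = !![0, 0; 0, a])
    (hu' : Φ' u = !![0, 1; 0, 0]) (ht' : Φ' t = !![0, 0; 0, a]) : Φ' = Φ := by
  let j : Matrix (Fin 2) (Fin 2) A →⋆ₙₐ[ℂ] Matrix (Fin 2) (Fin 2) A :=
    NonUnitalStarAlgHom.id ℂ _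
  have hcorner : ∀ r, ∃ b, j (lowerCorner 1) * r * j (lowerCorner 1) = j (lowerCorner b) := by
    intro r
    refine ⟨r 1 1, ?_⟩
    exact lowerCorner_one_mul_mul r
  have key := starAlgEquiv_eq_of_matrix j (fun x y h => h) hcorner hA
    (Φ.symm.trans Φ')
    (by
      change (Φ.symm.trans Φ') !![0, 1; 0, 0] = !![0, 1; 0, 0]
      rw [← hu, StarAlgEquiv.trans_apply, StarAlgEquiv.symm_apply_apply, hu, hu'])
    (by
      change (Φ.symm.trans Φ') !![0, 0; 0, a] = !![0, 0; 0, a]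
      rw [← ht, StarAlgEquiv.trans_apply, StarAlgEquiv.symm_apply_apply, ht, ht'])
  ext r : 1
  have := key (Φ r)
  change Φ' (Φ.symm (Φ r)) = Φ r at this
  rwa [StarAlgEquiv.symm_apply_apply] at this

end MatrixIso

/-! ### Inflations of operators -/

section Inflation

open ContinuousLinearMap (adjoint)
open MeasureTheory

variable {L K : Type*} [NormedAddCommGroup L] [InnerProductSpace ℂ L] [CompleteSpace L]
  [NormedAddCommGroup K] [InnerProductSpace ℂ K] [CompleteSpace K]
  {κ : Type*} [Fintype κ] [DecidableEq κ]

/-- The `I_j : L → K` are isometries whose ranges decompose `K` orthogonally. -/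
structure IsDecomposition (I : κ → L →L[ℂ] K) : Prop where
  ortho : ∀ j l x, adjoint (I j) (I l x) = if j = l then x else 0
  total : ∀ v, ∑ j, I j (adjoint (I j) v) = v

variable {I : κ → L →L[ℂ] K}

/-- The representation of the operators on `L` on an orthogonal sum `K` of copies of `L`. -/
def IsDecomposition.inflate (hI : IsDecomposition I) : (L →L[ℂ] L) →⋆ₐ[ℂ] (K →L[ℂ] K) where
  toFun y := ∑ j, I j ∘L y ∘L adjoint (I j)
  map_one' := by
    ext v
    simp [hI.total]
  map_mul' x y := by
    ext v
    simp only [_root_.sum_apply, ContinuousLinearMap.comp_apply, mul_apply_eq_comp, map_sum,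
      hI.ortho]
    rw [Finset.sum_comm]
    refine Finset.sum_congr rfl fun j _ => ?_
    rw [Finset.sum_eq_single j (fun i _ h => by simp [Ne.symm h]) (by simp), if_pos rfl]
  map_zero' := by simp
  map_add' x y := by
    ext v
    simp [Finset.sum_add_distrib]
  commutes' c := by
    ext v
    conv_rhs => rw [← hI.total v]
    simp [Algebra.algebraMap_eq_smul_one]
  map_star' y := by
    simp only [ContinuousLinearMap.star_eq_adjoint, map_sum, ContinuousLinearMap.adjoint_comp,
      ContinuousLinearMap.adjoint_adjoint, ContinuousLinearMap.comp_assoc]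

theorem IsDecomposition.inflate_apply (hI : IsDecomposition I) (y : L →L[ℂ] L) (v : K) :
    hI.inflate y v = ∑ j, I j (y (adjoint (I j) v)) := by
  change (∑ j, I j ∘L y ∘L adjoint (I j)) v = _
  simp

theorem IsDecomposition.inflate_apply_apply (hI : IsDecomposition I) (y : L →L[ℂ] L) (j : κ)
    (x : L) : hI.inflate y (I j x) = I j (y x) := by
  rw [hI.inflate_apply, Finset.sum_eq_single j]
  · simp [hI.ortho]
  · intro l _ h
    simp [hI.ortho, h]
  · simp

theorem IsDecomposition.adjoint_inflate (hI : IsDecomposition I) (y : L →L[ℂ] L) (j : κ)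
    (v : K) : adjoint (I j) (hI.inflate y v) = y (adjoint (I j) v) := by
  simp [hI.inflate_apply, hI.ortho]

theorem IsDecomposition.ext (hI : IsDecomposition I) {F : Type*} [NormedAddCommGroup F]
    [NormedSpace ℂ F] {S T : K →L[ℂ] F} (h : ∀ j x, S (I j x) = T (I j x)) : S = T := by
  ext v
  rw [← hI.total v]
  simp [h]

theorem IsDecomposition.inflate_injective [Nonempty κ] (hI : IsDecomposition I) :
    Function.Injective hI.inflate := by
  intro x y h
  obtain ⟨j⟩ := ‹Nonempty κ›
  ext v
  have := congrArg (fun T => adjoint (I j) (T (I j v))) h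
  simpa [hI.inflate_apply_apply, hI.ortho] using this

theorem IsDecomposition.inflate_nonneg (hI : IsDecomposition I) {a : L →L[ℂ] L} (ha : 0 ≤ a) :
    0 ≤ hI.inflate a := map_nonneg hI.inflate ha

theorem IsDecomposition.cfc_inflate (hI : IsDecomposition I) {b : L →L[ℂ] L}
    (hb : IsSelfAdjoint b) {f : ℝ → ℝ} (hf : Continuous f) :
    cfc f (hI.inflate b) = hI.inflate (cfc f b) := by
  have hc : Continuous hI.inflate :=
    AddMonoidHomClass.continuous_of_bound hI.inflate 1 fun y => by
      simpa using NonUnitalStarAlgHom.norm_apply_le hI.inflate y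
  exact (StarAlgHom.map_cfc (R := ℝ) (S := ℂ) hI.inflate f b hf.continuousOn hc hb
    (hb.map hI.inflate)).symm

theorem IsScalarSpectralMeasure.integrable {b : L →L[ℂ] L} {h : L} {ν : Measure ℝ}
    (hν : IsScalarSpectralMeasure b h ν) {f : ℝ → ℝ} (hf : Continuous f) : Integrable f ν := by
  obtain ⟨h1, h2, -⟩ := hν
  have h3 : ν.restrict (spectrum ℝ b) = ν := Measure.restrict_eq_self_of_ae_mem h2
  rw [← h3]
  exact hf.continuousOn.integrableOn_compact (spectrum.isCompact b)

theorem IsDecomposition.hasAbsContSpectrum (hI : IsDecomposition I) {b : L →L[ℂ] L}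
    (hb : HasAbsContSpectrum b) : HasAbsContSpectrum (hI.inflate b) := by
  refine ⟨hb.1.map hI.inflate, fun h => ?_⟩
  choose ν hν hac using fun j => hb.2 (adjoint (I j) h)
  have : ∀ j, IsFiniteMeasure (ν j) := fun j => (hν j).1
  refine ⟨∑ j, ν j, isScalarSpectralMeasure_of_integral h fun f hf => ?_, ?_⟩
  · rw [integral_finsetSum_measure fun j _ => (hν j).integrable hf, hI.cfc_inflate hb.1 hf,
      hI.inflate_apply, inner_sum, Complex.ofReal_sum]
    refine Finset.sum_congr rfl fun j _ => ?_
    rw [(hν j).2.2 f hf, ContinuousLinearMap.adjoint_inner_left]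
  · intro s hs
    simp [hac _ hs]

/-- The von Neumann algebra generated by the inflation of a generator of a maximal abelian algebra
`N` is the inflation of `N`. -/
theorem IsDecomposition.mem_generatedVN_iff [Nonempty κ] (hI : IsDecomposition I)
    {a : L →L[ℂ] L} (ha : IsSelfAdjoint a) {N : VonNeumannAlgebra L}
    (hN : ∀ X, X ∈ N ↔ Commute a X) (hcomm : ∀ X ∈ N, ∀ Y ∈ N, Commute X Y) (T : K →L[ℂ] K) :
    T ∈ generatedVN {hI.inflate a} ↔ ∃ y ∈ N, hI.inflate y = T := by
  have hsa : star (hI.inflate a) = hI.inflate a := (ha.map hI.inflate).star_eq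
  rw [_root_.mem_generatedVN_iff]
  simp only [Set.mem_singleton_iff, forall_eq, hsa, and_self]
  constructor
  · intro h
    obtain ⟨o⟩ := ‹Nonempty κ›
    let y : L →L[ℂ] L := adjoint (I o) ∘L T ∘L I o
    have hT : ∀ l x, T (I l x) = I l (y x) := by
      intro l x
      -- the partial isometries between the copies of `L` commute with the inflation
      have h1 : Commute (hI.inflate a) (I l ∘L adjoint (I o)) := by
        ext v
        simp [hI.inflate_apply_apply, hI.adjoint_inflate]
      have h2 := congrArg (fun S => S (I o x)) (h _ h1).eq
      simpa [hI.ortho, y] using h2.symm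
    have hTy : hI.inflate y = T := hI.ext fun j x => by rw [hT, hI.inflate_apply_apply]
    refine ⟨y, (hN y).2 (hI.inflate_injective ?_), hTy⟩
    rw [map_mul, map_mul, hTy]
    exact (h _ (Commute.refl _)).eq
  · rintro ⟨y, hy, rfl⟩ X hX
    refine hI.ext fun l x => ?_
    have hx : ∀ j, Commute y (adjoint (I j) ∘L X ∘L I l) := by
      intro j
      refine hcomm _ hy _ ((hN _).2 ?_)
      ext v
      have := congrArg (fun S => adjoint (I j) (S (I l v))) hX.eq
      simpa [hI.inflate_apply_apply, hI.adjoint_inflate] using this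
    change X (hI.inflate y (I l x)) = hI.inflate y (X (I l x))
    rw [hI.inflate_apply_apply, hI.inflate_apply]
    conv_lhs => rw [← hI.total (X (I l (y x)))]
    refine Finset.sum_congr rfl fun j _ => congrArg (I j) ?_
    exact (congrArg (fun S => S x) (hx j).eq).symm

/-- An operator and its inflations generate isomorphic von Neumann algebras, if the algebra
generated by the operator is maximal abelian. -/
theorem IsDecomposition.nonempty_starAlgEquiv [Nonempty κ] (hI : IsDecomposition I)
    {a : L →L[ℂ] L} (ha : IsSelfAdjoint a) {N : VonNeumannAlgebra L}
    (hN : ∀ X, X ∈ N ↔ Commute a X) (hcomm : ∀ X ∈ N, ∀ Y ∈ N, Commute X Y) :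
    Nonempty ((generatedVN {hI.inflate a}).toStarSubalgebra ≃⋆ₐ[ℂ] N.toStarSubalgebra) := by
  have hmem := hI.mem_generatedVN_iff ha hN hcomm
  let f : N.toStarSubalgebra →⋆ₐ[ℂ] (generatedVN {hI.inflate a}).toStarSubalgebra :=
    (hI.inflate.comp N.toStarSubalgebra.subtype).codRestrict _
      fun y => (hmem _).2 ⟨y, y.2, rfl⟩
  refine ⟨(StarAlgEquiv.ofBijective f ⟨fun x y h => ?_, fun T => ?_⟩).symm⟩
  · exact Subtype.ext (hI.inflate_injective (congrArg Subtype.val h))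
  · obtain ⟨y, hy, hT⟩ := (hmem T).1 T.2
    exact ⟨⟨y, hy⟩, Subtype.ext hT⟩

end Inflation

/-! ### Alternating paths and their products -/

namespace WeightedGraph

variable {V E : Type*} [Fintype V] (Γ : WeightedGraph V E)

/-- The list `f, f̃, f, f̃, …` of length `n`. -/
def altList : E → ℕ → List E
  | _, 0 => []
  | f, n + 1 => f :: altList (Γ.rev f) n

theorem length_altList (f : E) (n : ℕ) : (Γ.altList f n).length = n := by
  induction n generalizing f with
  | zero => rfl
  | succ n ih => simp [altList, ih]

theorem isWalk_altList (f : E) (n : ℕ) : Γ.IsWalk (Γ.s f) (Γ.altList f n) := by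
  induction n generalizing f with
  | zero => trivial
  | succ n ih => exact ⟨rfl, Γ.s_rev f ▸ ih _⟩

theorem endpoint_altList (f : E) (n : ℕ) :
    Γ.endpoint (Γ.s f) (Γ.altList f n) = Γ.s (Γ.rev^[n] f) := by
  induction n generalizing f with
  | zero => rfl
  | succ n ih =>
    change Γ.endpoint (Γ.r f) (Γ.altList (Γ.rev f) n) = _
    rw [← Γ.s_rev, ih, Function.iterate_succ_apply]

theorem take_altList (f : E) (n k : ℕ) (h : k ≤ n) :
    (Γ.altList f n).take k = Γ.altList f k := by
  induction n generalizing f k with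
  | zero => simp [Nat.le_zero.1 h, altList]
  | succ n ih =>
    cases k with
    | zero => simp [altList]
    | succ k => simp [altList, ih _ _ (Nat.le_of_succ_le_succ h)]

theorem drop_altList (f : E) (n k : ℕ) :
    (Γ.altList f n).drop k = Γ.altList (Γ.rev^[k] f) (n - k) := by
  induction k generalizing f n with
  | zero => simp
  | succ k ih =>
    cases n with
    | zero => simp [altList]
    | succ n => simp [altList, ih]

theorem altList_append (f : E) (m n : ℕ) :
    Γ.altList f m ++ Γ.altList (Γ.rev^[m] f) n = Γ.altList f (m + n) := by
  induction m generalizing f with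
  | zero => simp [altList]
  | succ m ih => simp [altList, ih, Nat.succ_add]

theorem rev_iterate_iterate (f : E) (n : ℕ) : Γ.rev^[n] (Γ.rev^[n] f) = f := by
  induction n with
  | zero => rfl
  | succ n ih => rw [Function.iterate_succ_apply, Function.iterate_succ_apply', Γ.rev_rev, ih]

theorem rev_iterate_sub (f : E) {m k : ℕ} (h : k ≤ m) :
    Γ.rev^[k] (Γ.rev^[m] f) = Γ.rev^[m - k] f := by
  conv_lhs => rw [← Nat.add_sub_cancel' h, Function.iterate_add_apply, rev_iterate_iterate]

theorem revList_altList (f : E) (n : ℕ) :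
    Γ.revList (Γ.altList f n) = Γ.altList (Γ.rev^[n] f) n := by
  induction n generalizing f with
  | zero => rfl
  | succ n ih =>
    have h1 : Γ.revList (Γ.altList f (n + 1)) = Γ.revList (Γ.altList (Γ.rev f) n) ++ [Γ.rev f] := by
      simp [revList, altList]
    have h2 : Γ.altList (Γ.rev^[n] (Γ.rev^[n + 1] f)) 1 = [Γ.rev f] := by
      rw [Function.iterate_succ_apply, rev_iterate_iterate]
      rfl
    rw [h1, ih, ← altList_append, h2, Function.iterate_succ_apply]

/-- The path `f f̃ f f̃ ⋯` of length `n`. -/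
def altPath (f : E) (n : ℕ) : Γ.Path := ⟨Γ.s f, Γ.altList f n, Γ.isWalk_altList f n⟩

theorem altPath_rng (f : E) (n : ℕ) : (Γ.altPath f n).rng = Γ.s (Γ.rev^[n] f) :=
  Γ.endpoint_altList f n

theorem altPath_length (f : E) (n : ℕ) : (Γ.altPath f n).length = n := Γ.length_altList f n

theorem altPath_one (f : E) : Γ.altPath f 1 = Γ.edgePath f := rfl

theorem altPath_injective (f : E) : Function.Injective (Γ.altPath f) := fun m n h => by
  rw [← Γ.altPath_length f m, h, altPath_length]

theorem mulTerm_altPath (f : E) {m n k : ℕ} (hm : k ≤ m) (hn : k ≤ n) :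
    mulTerm (Γ.altPath f m) (Γ.altPath (Γ.rev^[m] f) n) k =
      ((Γ.μ (Γ.s (Γ.rev^[m] f)) / Γ.μ (Γ.s (Γ.rev^[m - k] f)) : ℝ) : ℂ) •
        basisElem (Γ.altPath f (m + n - 2 * k)) := by
  have hc : Cancels (Γ.altPath f m) (Γ.altPath (Γ.rev^[m] f) n) k := by
    refine ⟨Γ.altPath_rng f m, ?_⟩
    rw [altPath_length]
    change (Γ.altList f m).drop (m - k) = Γ.revList ((Γ.altList _ n).take k)
    rw [drop_altList, take_altList _ _ _ _ hn, revList_altList, rev_iterate_sub _ _ hm,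
      Nat.sub_sub_self hm]
  have hj : join _ _ k hc = Γ.altPath f (m + n - 2 * k) := by
    refine Path.ext rfl ?_
    change (Γ.altList f m).take ((Γ.altPath f m).length - k) ++ (Γ.altList _ n).drop k =
      Γ.altList f _
    rw [altPath_length, take_altList _ _ _ _ (Nat.sub_le m k), drop_altList,
      rev_iterate_sub _ _ hm, altList_append]
    congr 1
    omega
  rw [mulTerm, dif_pos hc, hj, altPath_rng, altPath_length]
  change ((_ / Γ.μ (Γ.endpoint (Γ.s f) ((Γ.altList f m).take (m - k))) : ℝ) : ℂ) • _ = _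
  rw [take_altList _ _ _ _ (Nat.sub_le m k), endpoint_altList]

theorem mulBasis_altPath (f : E) (m n : ℕ) :
    mulBasis (Γ.altPath f m) (Γ.altPath (Γ.rev^[m] f) n) =
      ∑ k ∈ Finset.range (min m n + 1),
        ((Γ.μ (Γ.s (Γ.rev^[m] f)) / Γ.μ (Γ.s (Γ.rev^[m - k] f)) : ℝ) : ℂ) •
          basisElem (Γ.altPath f (m + n - 2 * k)) := by
  rw [mulBasis, altPath_length, altPath_length]
  refine Finset.sum_congr rfl fun k hk => ?_
  rw [Finset.mem_range] at hk
  exact Γ.mulTerm_altPath f (by omega) (by omega)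

theorem mulBasis_eq_zero {ξ η : Γ.Path} (h : ξ.rng ≠ η.src) : mulBasis ξ η = 0 :=
  Finset.sum_eq_zero fun k _ => by rw [mulTerm, dif_neg fun hc => h hc.1]

theorem mulBasis_edgePath (f : E) (n : ℕ) :
    mulBasis (Γ.edgePath f) (Γ.altPath (Γ.rev f) n) = basisElem (Γ.altPath f (n + 1)) +
      if n = 0 then 0 else ((Γ.μ (Γ.r f) / Γ.μ (Γ.s f) : ℝ) : ℂ) •
        basisElem (Γ.altPath f (n - 1)) := by
  have h := Γ.mulBasis_altPath f 1 n
  have h0 : ((Γ.μ (Γ.r f) / Γ.μ (Γ.r f) : ℝ) : ℂ) = 1 := by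
    rw [div_self (Γ.μ_pos _).ne', Complex.ofReal_one]
  rw [altPath_one, Function.iterate_one] at h
  rw [h]
  rcases Nat.eq_zero_or_pos n with rfl | hn
  · simp [Γ.s_rev, (Γ.μ_pos (Γ.r f)).ne']
  · rw [Nat.min_eq_left hn, if_neg hn.ne', Finset.sum_range_succ, Finset.sum_range_one]
    simp only [Nat.sub_zero, Function.iterate_one, Nat.sub_self, Function.iterate_zero, id_eq,
      Γ.s_rev, h0, one_smul, mul_zero, mul_one]
    congr 3
    · omega
    · congr 1
      omega

/-- Left multiplication by an edge prolongs an alternating path or removes its first edge; this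
three-term relation expresses all alternating paths by edges. -/
theorem mul_edgePath_mul (f : E) (m n : ℕ) :
    Γ.mul (basisElem (Γ.edgePath f))
        (mulBasis (Γ.altPath (Γ.rev f) m) (Γ.altPath (Γ.rev^[m + 1] f) n)) =
      mulBasis (Γ.altPath f (m + 1)) (Γ.altPath (Γ.rev^[m + 1] f) n) +
        if m = 0 then 0 else ((Γ.μ (Γ.r f) / Γ.μ (Γ.s f) : ℝ) : ℂ) •
          mulBasis (Γ.altPath f (m - 1)) (Γ.altPath (Γ.rev^[m + 1] f) n) := by
  rw [mulBasis_altPath]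
  conv_lhs => rw [Function.iterate_succ_apply, mulBasis_altPath]
  simp only [map_sum, map_smul, mul_basisElem, mulBasis_edgePath, smul_add,
    Finset.sum_add_distrib, ← Function.iterate_succ_apply]
  set M := Γ.μ (Γ.s (Γ.rev^[m + 1] f))
  have hs : ∀ k ≤ m, Γ.rev^[m - k + 1] f = Γ.rev^[m + 1 - k] f := fun k hk => by
    rw [Nat.sub_add_comm hk]
  have hr : ∀ m : ℕ, Γ.rev^[m + 2] f = Γ.rev^[m] f := fun m => by
    rw [Function.iterate_add_apply]
    congr 1
    exact Γ.rev_rev f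
  rcases Nat.lt_or_ge n m with h | h
  · have hm : m ≠ 0 := by omega
    obtain ⟨p, rfl⟩ := Nat.exists_eq_succ_of_ne_zero hm
    rw [if_neg hm, Nat.min_eq_right h.le, Nat.min_eq_right (by omega)]
    have h2 := Γ.mulBasis_altPath f p n
    rw [← hr p, Nat.min_eq_right (by omega)] at h2
    change _ = _ + _ • mulBasis (Γ.altPath f p) (Γ.altPath (Γ.rev^[p + 2] f) n)
    rw [h2, Finset.smul_sum]
    congr 1
    · refine Finset.sum_congr rfl fun k hk => ?_
      rw [Finset.mem_range] at hk
      rw [hs k (by omega)]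
      congr 3
      omega
    · refine Finset.sum_congr rfl fun k hk => ?_
      rw [Finset.mem_range] at hk
      rw [if_neg (by omega), hs k (by omega), smul_comm]
      congr 2
      · rw [← hr (p - k)]
        congr 7
        omega
      · congr 2
        omega
  · rw [Nat.min_eq_left h]
    have hm : (M / Γ.μ (Γ.s (Γ.rev^[m - m + 1] f)) : ℝ) * (Γ.μ (Γ.r f) / Γ.μ (Γ.s f)) =
        M / Γ.μ (Γ.s f) := by
      rw [Nat.sub_self, zero_add, Function.iterate_one, Γ.s_rev]
      field_simp [(Γ.μ_pos (Γ.r f)).ne']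
    have hsum : ∑ k ∈ Finset.range (m + 1), ((M / Γ.μ (Γ.s (Γ.rev^[m - k + 1] f)) : ℝ) : ℂ) •
          basisElem (Γ.altPath f (m + n - 2 * k + 1)) =
        ∑ k ∈ Finset.range (m + 1), ((M / Γ.μ (Γ.s (Γ.rev^[m + 1 - k] f)) : ℝ) : ℂ) •
          basisElem (Γ.altPath f (m + 1 + n - 2 * k)) := by
      refine Finset.sum_congr rfl fun k hk => ?_
      rw [Finset.mem_range] at hk
      rw [hs k (by omega)]
      congr 3
      omega
    obtain ⟨A, hA⟩ : ∃ A, A = ∑ k ∈ Finset.range (m + 1),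
        ((M / Γ.μ (Γ.s (Γ.rev^[m + 1 - k] f)) : ℝ) : ℂ) •
          basisElem (Γ.altPath f (m + 1 + n - 2 * k)) := ⟨_, rfl⟩
    rw [hsum, ← hA, Finset.sum_range_succ _ m, ← add_assoc, add_right_comm]
    congr 1
    · -- the term in which `m + 1` edges cancel arises from removing an edge
      rcases h.eq_or_lt with rfl | h'
      · rw [if_pos (by omega), smul_zero, add_zero, Nat.min_eq_right (Nat.le_succ m), hA]
      · rw [if_neg (by omega), Nat.min_eq_left (Nat.succ_le_of_lt h'),
          Finset.sum_range_succ _ (m + 1), ← hA, smul_smul, ← Complex.ofReal_mul, hm, Nat.sub_self]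
        congr 4
        omega
    · rcases m with _ | p
      · simp
      · rw [if_neg (Nat.succ_ne_zero p)]
        have h2 := Γ.mulBasis_altPath f p n
        rw [← hr p, Nat.min_eq_left (by omega)] at h2
        change _ = _ • mulBasis (Γ.altPath f p) (Γ.altPath (Γ.rev^[p + 2] f) n)
        rw [h2, Finset.smul_sum]
        refine Finset.sum_congr rfl fun k hk => ?_
        rw [Finset.mem_range] at hk
        rw [if_neg (by omega), hs k (by omega), smul_comm]
        congr 2
        · rw [← hr (p - k)]
          congr 7
          omega
        · congr 2
          omega

end WeightedGraph

/-! ### The graph with two vertices and two edges -/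

namespace WeightedGraph

open EllTwo ContinuousLinearMap

variable {V E : Type*} [Fintype V] (Γ : WeightedGraph V E)

/-- The graph consists of the edge `f`, its reversal and the two distinct endpoints of `f`. -/
structure IsTwoCycle (f : E) : Prop where
  ne : Γ.s f ≠ Γ.r f
  vertex : ∀ x, x = Γ.s f ∨ x = Γ.r f
  edge : ∀ g, g = f ∨ g = Γ.rev f

variable {Γ}

theorem IsTwoCycle.symm {f : E} (h : Γ.IsTwoCycle f) : Γ.IsTwoCycle (Γ.rev f) where
  ne := by rw [Γ.s_rev, Γ.r_rev]; exact h.ne.symm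
  vertex x := by rw [Γ.s_rev, Γ.r_rev]; exact (h.vertex x).symm
  edge g := by rw [Γ.rev_rev]; exact (h.edge g).symm

theorem IsTwoCycle.eq_of_s_eq {f g g' : E} (h : Γ.IsTwoCycle f) (hg : Γ.s g = Γ.s g') :
    g = g' := by
  have hne := h.ne
  rw [← Γ.s_rev] at hne
  rcases h.edge g with rfl | rfl <;> rcases h.edge g' with rfl | rfl
  · rfl
  · exact absurd hg hne
  · exact absurd hg.symm hne
  · rfl

theorem IsTwoCycle.eq_altList {f : E} (h : Γ.IsTwoCycle f) (g : E) (l : List E)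
    (hl : Γ.IsWalk (Γ.s g) l) : l = Γ.altList g l.length := by
  induction l generalizing g with
  | nil => rfl
  | cons g' l ih =>
    obtain ⟨h1, h2⟩ := hl
    obtain rfl := h.eq_of_s_eq h1
    rw [← Γ.s_rev] at h2
    simp only [List.length_cons, altList]
    rw [← ih _ h2]

theorem IsTwoCycle.exists_altPath {f : E} (h : Γ.IsTwoCycle f) (ξ : Γ.Path) :
    ∃ g n, ξ = Γ.altPath g n := by
  have : ∃ g, Γ.s g = ξ.start := by
    rcases h.vertex ξ.start with h1 | h1
    · exact ⟨f, h1.symm⟩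
    · exact ⟨Γ.rev f, by rw [Γ.s_rev, h1]⟩
  obtain ⟨g, hg⟩ := this
  refine ⟨g, ξ.edges.length, Path.ext hg.symm (h.eq_altList g _ ?_)⟩
  rw [hg]
  exact ξ.isWalk

variable (Γ) in
/-- The orthonormal basis vector of `L²(F(Γ), τ)` given by the alternating path of length `n` which
begins with `f`. -/
def pathVec (f : E) (n : ℕ) : Γ.L2 := delta (Γ.altPath f n)

theorem inner_pathVec_self (f : E) (m n : ℕ) :
    (inner ℂ (Γ.pathVec f m) (Γ.pathVec f n) : ℂ) = if m = n then 1 else 0 := by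
  rw [pathVec, pathVec, inner_delta]
  simp [(Γ.altPath_injective f).eq_iff]

theorem IsTwoCycle.inner_pathVec_rev {f : E} (h : Γ.IsTwoCycle f) (m n : ℕ) :
    (inner ℂ (Γ.pathVec f m) (Γ.pathVec (Γ.rev f) n) : ℂ) = 0 := by
  rw [pathVec, pathVec, inner_delta, if_neg]
  intro h1
  have : Γ.s f = Γ.s (Γ.rev f) := congrArg Path.start h1
  exact h.ne (this.trans (Γ.s_rev f))

theorem IsTwoCycle.clm_ext {f : E} (h : Γ.IsTwoCycle f) {S T : Γ.L2 →L[ℂ] Γ.L2}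
    (h1 : ∀ n, S (Γ.pathVec f n) = T (Γ.pathVec f n))
    (h2 : ∀ n, S (Γ.pathVec (Γ.rev f) n) = T (Γ.pathVec (Γ.rev f) n)) : S = T := by
  refine eq_of_forall_delta fun ξ => ?_
  obtain ⟨g, n, rfl⟩ := h.exists_altPath ξ
  rcases h.edge g with rfl | rfl
  · exact h1 n
  · exact h2 n

theorem IsTwoCycle.eq_zero {f : E} (h : Γ.IsTwoCycle f) {x : Γ.L2}
    (h1 : ∀ n, (inner ℂ (Γ.pathVec f n) x : ℂ) = 0)
    (h2 : ∀ n, (inner ℂ (Γ.pathVec (Γ.rev f) n) x : ℂ) = 0) : x = 0 := by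
  refine eq_zero_of_inner_delta x fun ξ => ?_
  obtain ⟨g, n, rfl⟩ := h.exists_altPath ξ
  rcases h.edge g with rfl | rfl
  · exact h1 n
  · exact h2 n

theorem toL2_altPath (f : E) (n : ℕ) : Γ.toL2 (basisElem (Γ.altPath f n)) =
    ((√(Γ.μ (Γ.s f) * Γ.μ (Γ.s (Γ.rev^[n] f))) : ℝ) : ℂ) • Γ.pathVec f n := by
  rw [toL2_basisElem, pathNorm, altPath_rng]
  rfl

theorem vertexPath_eq (f : E) : Γ.vertexPath (Γ.s f) = Γ.altPath f 0 := rfl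

theorem lam_pathVec (x : Γ.PathSpace) (f : E) (n : ℕ) : Γ.lam x (Γ.pathVec f n) =
    ((√(Γ.μ (Γ.s f) * Γ.μ (Γ.s (Γ.rev^[n] f))) : ℝ) : ℂ)⁻¹ •
      Γ.toL2 (Γ.mul x (basisElem (Γ.altPath f n))) := by
  have h0 : ((√(Γ.μ (Γ.s f) * Γ.μ (Γ.s (Γ.rev^[n] f))) : ℝ) : ℂ) ≠ 0 :=
    Complex.ofReal_ne_zero.2 (Real.sqrt_pos.2 (mul_pos (Γ.μ_pos _) (Γ.μ_pos _))).ne'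
  rw [eq_inv_smul_iff₀ h0, ← map_smul, ← toL2_altPath, lam_toL2]

theorem vertexProj_pathVec (f : E) (n : ℕ) :
    Γ.vertexProj (Γ.s f) (Γ.pathVec f n) = Γ.pathVec f n := by
  have h0 : ((√(Γ.μ (Γ.s f) * Γ.μ (Γ.s (Γ.rev^[n] f))) : ℝ) : ℂ) ≠ 0 :=
    Complex.ofReal_ne_zero.2 (Real.sqrt_pos.2 (mul_pos (Γ.μ_pos _) (Γ.μ_pos _))).ne'
  rw [vertexProj, lam_pathVec, mul_basisElem, mulBasis_vertexPath_left,
    if_pos (show Γ.s f = (Γ.altPath f n).src from rfl), toL2_altPath, inv_smul_smul₀ h0]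

theorem vertexProj_pathVec_of_ne {u : V} {f : E} (h : u ≠ Γ.s f) (n : ℕ) :
    Γ.vertexProj u (Γ.pathVec f n) = 0 := by
  rw [vertexProj, lam_pathVec, mul_basisElem, mulBasis_vertexPath_left,
    if_neg (show ¬ u = (Γ.altPath f n).src from h), map_zero, smul_zero]

variable (Γ) in
/-- The number `α = (μ(s(f)) / μ(r(f)))^{1/2}`. -/
def ratio (f : E) : ℝ := √(Γ.μ (Γ.s f) / Γ.μ (Γ.r f))

theorem ratio_pos (f : E) : 0 < Γ.ratio f := Real.sqrt_pos.2 (div_pos (Γ.μ_pos _) (Γ.μ_pos _))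

theorem ratio_rev (f : E) : Γ.ratio (Γ.rev f) = (Γ.ratio f)⁻¹ := by
  rw [ratio, ratio, Γ.s_rev, Γ.r_rev, ← Real.sqrt_inv, inv_div]

theorem ratio_sq (f : E) : Γ.ratio f ^ 2 = Γ.μ (Γ.s f) / Γ.μ (Γ.r f) :=
  Real.sq_sqrt (div_pos (Γ.μ_pos _) (Γ.μ_pos _)).le

theorem rev_iterate_add_two (f : E) (n : ℕ) : Γ.rev^[n + 2] f = Γ.rev^[n] f := by
  rw [Function.iterate_add_apply]
  congr 1
  exact Γ.rev_rev f

/-- The edge either lengthens an alternating path or cancels its first edge. -/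
theorem edgeOp_pathVec_rev (f : E) (n : ℕ) : Γ.edgeOp f (Γ.pathVec (Γ.rev f) n) =
    (Γ.ratio f : ℂ) • Γ.pathVec f (n + 1) +
      if n = 0 then 0 else ((Γ.ratio f)⁻¹ : ℂ) • Γ.pathVec f (n - 1) := by
  have hs := (Real.sqrt_pos.2 (Γ.μ_pos (Γ.s f))).ne'
  have hr := (Real.sqrt_pos.2 (Γ.μ_pos (Γ.r f))).ne'
  have he := (Real.sqrt_pos.2 (Γ.μ_pos (Γ.s (Γ.rev^[n + 1] f)))).ne'
  rw [edgeOp, lam_pathVec, mul_basisElem, mulBasis_edgePath, map_add, smul_add, toL2_altPath,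
    smul_smul, ← Function.iterate_succ_apply, Γ.s_rev, ← Complex.ofReal_inv, ← Complex.ofReal_inv,
    ← Complex.ofReal_mul, ratio, Real.sqrt_mul (Γ.μ_pos _).le, Real.sqrt_mul (Γ.μ_pos _).le,
    Real.sqrt_div (Γ.μ_pos _).le]
  congr 1
  · congr 2
    field_simp
  · rcases n with _ | n
    · simp
    · rw [if_neg (Nat.succ_ne_zero n), if_neg (Nat.succ_ne_zero n), map_smul, Nat.add_sub_cancel,
        toL2_altPath, smul_smul, smul_smul, ← Complex.ofReal_mul, ← Complex.ofReal_mul,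
        Real.sqrt_mul (Γ.μ_pos _).le, rev_iterate_add_two]
      rw [rev_iterate_add_two] at he
      congr 2
      have h1 := Real.mul_self_sqrt (Γ.μ_pos (Γ.s f)).le
      have h2 := Real.mul_self_sqrt (Γ.μ_pos (Γ.r f)).le
      have h3 := (Γ.μ_pos (Γ.s f)).ne'
      field_simp
      linear_combination Γ.μ (Γ.r f) * h1 - Γ.μ (Γ.s f) * h2

theorem IsTwoCycle.edgeOp_pathVec {f : E} (h : Γ.IsTwoCycle f) (n : ℕ) :
    Γ.edgeOp f (Γ.pathVec f n) = 0 := by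
  rw [edgeOp, lam_pathVec, mul_basisElem, mulBasis_eq_zero, map_zero, smul_zero]
  exact h.ne.symm

/-- The involution of `F(Γ)` corresponds to taking adjoints: `λ(f)* = λ(f̃)`. -/
theorem IsTwoCycle.adjoint_edgeOp {f : E} (h : Γ.IsTwoCycle f) :
    adjoint (Γ.edgeOp f) = Γ.edgeOp (Γ.rev f) := by
  have key := edgeOp_pathVec_rev (Γ := Γ) (Γ.rev f)
  rw [Γ.rev_rev, ratio_rev] at key
  have key0 := h.symm.edgeOp_pathVec
  have hf : ∀ m n, (inner ℂ (Γ.pathVec (Γ.rev f) m) (Γ.pathVec f n) : ℂ) = 0 := by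
    simpa [Γ.rev_rev] using h.symm.inner_pathVec_rev
  have hd := h.edgeOp_pathVec
  have hv := h.inner_pathVec_rev
  have hk := edgeOp_pathVec_rev (Γ := Γ) f
  have hc : starRingEnd ℂ (Γ.ratio f : ℂ) = Γ.ratio f := Complex.conj_ofReal _
  simp only [Complex.ofReal_inv, inv_inv] at key
  generalize (Γ.ratio f : ℂ) = α at hc hk key
  refine h.clm_ext (fun n => ?_) fun n => ?_
  · rw [← sub_eq_zero]
    refine h.eq_zero (fun m => ?_) fun m => ?_
    · rw [inner_sub_right, adjoint_inner_right, hd, key, inner_zero_left, inner_add_right]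
      split_ifs <;> simp [inner_smul_right, hv]
    · rw [inner_sub_right, adjoint_inner_right, hk, key, inner_add_right, inner_add_left]
      rcases m with _ | m <;> rcases n with _ | n <;>
        simp [inner_smul_left, inner_smul_right, inner_pathVec_self, hc]
      · simp [eq_comm (a := 0)]
      · ring
  · rw [← sub_eq_zero, key0]
    refine h.eq_zero (fun m => ?_) fun m => ?_
    · rw [sub_zero, adjoint_inner_right, hd, inner_zero_left]
    · rw [sub_zero, adjoint_inner_right, hk, inner_add_left]
      split_ifs <;> simp [inner_smul_left, hv]

theorem IsTwoCycle.adjoint_vertexProj {f : E} (h : Γ.IsTwoCycle f) :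
    adjoint (Γ.vertexProj (Γ.s f)) = Γ.vertexProj (Γ.s f) := by
  have h1 := vertexProj_pathVec (Γ := Γ) f
  have h2 : ∀ n, Γ.vertexProj (Γ.s f) (Γ.pathVec (Γ.rev f) n) = 0 :=
    vertexProj_pathVec_of_ne (by rw [Γ.s_rev]; exact h.ne)
  have hv := h.inner_pathVec_rev
  have hf : ∀ m n, (inner ℂ (Γ.pathVec (Γ.rev f) m) (Γ.pathVec f n) : ℂ) = 0 := by
    simpa [Γ.rev_rev] using h.symm.inner_pathVec_rev
  refine h.clm_ext (fun n => ?_) fun n => ?_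
  · rw [← sub_eq_zero]
    refine h.eq_zero (fun m => ?_) fun m => ?_
    · rw [inner_sub_right, adjoint_inner_right, h1, h1, sub_self]
    · rw [inner_sub_right, adjoint_inner_right, h1, h2, inner_zero_left, hf, sub_zero]
  · rw [← sub_eq_zero]
    refine h.eq_zero (fun m => ?_) fun m => ?_
    · rw [inner_sub_right, adjoint_inner_right, h1, h2, inner_zero_right, hv, sub_zero]
    · rw [inner_sub_right, adjoint_inner_right, h2, h2, inner_zero_left, inner_zero_right, sub_zero]

theorem IsTwoCycle.vertexProj_add {f : E} (h : Γ.IsTwoCycle f) :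
    Γ.vertexProj (Γ.s f) + Γ.vertexProj (Γ.r f) = 1 := by
  have h1 := vertexProj_pathVec (Γ := Γ) f
  have h2 := vertexProj_pathVec (Γ := Γ) (Γ.rev f)
  rw [Γ.s_rev] at h2
  refine h.clm_ext (fun n => ?_) fun n => ?_
  · simp [h1, vertexProj_pathVec_of_ne h.ne.symm]
  · have h3 : Γ.s f ≠ Γ.s (Γ.rev f) := by rw [Γ.s_rev]; exact h.ne
    simp [h2, vertexProj_pathVec_of_ne h3]

theorem IsTwoCycle.lam_altPath_succ {f : E} (h : Γ.IsTwoCycle f) (g : E) (m : ℕ) :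
    Γ.edgeOp g * Γ.lam (basisElem (Γ.altPath (Γ.rev g) m)) =
      Γ.lam (basisElem (Γ.altPath g (m + 1)) + if m = 0 then 0 else
        ((Γ.μ (Γ.r g) / Γ.μ (Γ.s g) : ℝ) : ℂ) • basisElem (Γ.altPath g (m - 1))) := by
  refine Γ.lam_unique _ _ fun y => ?_
  rw [mul_apply_eq_comp, edgeOp, lam_toL2, lam_toL2]
  congr 1
  induction y using Finsupp.induction_linear with
  | zero => simp
  | add y y' hy hy' => simp only [map_add, hy, hy']
  | single η b =>
    rw [← mul_one b, ← smul_eq_mul, ← Finsupp.smul_single]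
    simp only [map_smul]
    congr 1
    have h2 : Γ.mul (if m = 0 then 0 else ((Γ.μ (Γ.r g) / Γ.μ (Γ.s g) : ℝ) : ℂ) •
        basisElem (Γ.altPath g (m - 1))) (basisElem η) = if m = 0 then 0 else
        ((Γ.μ (Γ.r g) / Γ.μ (Γ.s g) : ℝ) : ℂ) • mulBasis (Γ.altPath g (m - 1)) η := by
      split_ifs
      · simp
      · rw [map_smul, LinearMap.smul_apply, mul_basisElem]
    rw [map_add, LinearMap.add_apply, mul_basisElem, mul_basisElem, h2]
    obtain ⟨g', n, rfl⟩ := h.exists_altPath η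
    by_cases hg : Γ.s (Γ.rev^[m + 1] g) = Γ.s g'
    · obtain rfl := h.eq_of_s_eq hg
      exact Γ.mul_edgePath_mul g m n
    · have e1 : mulBasis (Γ.altPath (Γ.rev g) m) (Γ.altPath g' n) = 0 :=
        Γ.mulBasis_eq_zero (by rw [altPath_rng]; exact hg)
      have e2 : mulBasis (Γ.altPath g (m + 1)) (Γ.altPath g' n) = 0 :=
        Γ.mulBasis_eq_zero (by rw [altPath_rng]; exact hg)
      rw [e1, e2, map_zero, zero_add]
      rcases m with _ | m
      · simp
      · have e3 : mulBasis (Γ.altPath g m) (Γ.altPath g' n) = 0 :=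
          Γ.mulBasis_eq_zero (by rw [altPath_rng, ← rev_iterate_add_two]; exact hg)
        simp [e3]

theorem lam_add (x y : Γ.PathSpace) : Γ.lam (x + y) = Γ.lam x + Γ.lam y :=
  (Γ.lam_unique _ _ fun z => by simp [lam_toL2]).symm

theorem lam_smul (c : ℂ) (x : Γ.PathSpace) : Γ.lam (c • x) = c • Γ.lam x :=
  (Γ.lam_unique _ _ fun z => by simp [lam_toL2]).symm

theorem lam_zero : Γ.lam 0 = 0 :=
  (Γ.lam_unique _ _ fun z => by simp).symm

/-- The algebra `λ(F(Γ))` is generated by the vertices and edges. -/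
theorem IsTwoCycle.commute_lam {f : E} (h : Γ.IsTwoCycle f) {X : Γ.L2 →L[ℂ] Γ.L2}
    (h1 : ∀ u, Commute X (Γ.vertexProj u)) (h2 : ∀ g, Commute X (Γ.edgeOp g)) (x : Γ.PathSpace) :
    Commute X (Γ.lam x) := by
  have key : ∀ n g, Commute X (Γ.lam (basisElem (Γ.altPath g n))) := by
    intro n
    induction n using Nat.strong_induction_on with
    | _ n ih =>
      intro g
      rcases n with _ | m
      · exact h1 (Γ.s g)
      · have e := h.lam_altPath_succ g m
        rw [lam_add, ← sub_eq_iff_eq_add] at e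
        rw [← e]
        refine ((h2 g).mul_right (ih m (Nat.lt_succ_self m) _)).sub_right ?_
        split_ifs with hm
        · rw [lam_zero]
          exact Commute.zero_right X
        · rw [lam_smul]
          exact (ih (m - 1) (by omega) g).smul_right _
  induction x using Finsupp.induction_linear with
  | zero => rw [lam_zero]; exact Commute.zero_right X
  | add x y hx hy => rw [lam_add]; exact hx.add_right hy
  | single ξ b =>
    rw [← mul_one b, ← smul_eq_mul, ← Finsupp.smul_single, lam_smul]
    obtain ⟨g, n, rfl⟩ := h.exists_altPath ξ
    exact (key n g).smul_right b

theorem IsTwoCycle.mem_vN_iff {f : E} (h : Γ.IsTwoCycle f) (T : Γ.L2 →L[ℂ] Γ.L2) :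
    T ∈ Γ.vN ↔ ∀ X, Commute X (Γ.vertexProj (Γ.s f)) → Commute X (Γ.vertexProj (Γ.r f)) →
      Commute X (Γ.edgeOp f) → Commute X (Γ.edgeOp (Γ.rev f)) → Commute X T := by
  rw [vN, mem_generatedVN_iff]
  have hs : star (Γ.vertexProj (Γ.s f)) = Γ.vertexProj (Γ.s f) := h.adjoint_vertexProj
  have hr : star (Γ.vertexProj (Γ.r f)) = Γ.vertexProj (Γ.r f) := by
    rw [← Γ.s_rev]; exact h.symm.adjoint_vertexProj
  have he : star (Γ.edgeOp f) = Γ.edgeOp (Γ.rev f) := h.adjoint_edgeOp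
  have he' : star (Γ.edgeOp (Γ.rev f)) = Γ.edgeOp f := by rw [← he, star_star]
  constructor
  · intro hT X h1 h2 h3 h4
    refine hT X ?_
    rintro _ ⟨x, rfl⟩
    have hX : ∀ Y : Γ.L2 →L[ℂ] Γ.L2, Commute Y (Γ.vertexProj (Γ.s f)) →
        Commute Y (Γ.vertexProj (Γ.r f)) → Commute Y (Γ.edgeOp f) →
        Commute Y (Γ.edgeOp (Γ.rev f)) → ∀ x, Commute Y (Γ.lam x) := by
      intro Y h1 h2 h3 h4 x
      refine h.commute_lam (fun u => ?_) (fun g => ?_) x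
      · rcases h.vertex u with rfl | rfl <;> assumption
      · rcases h.edge g with rfl | rfl <;> assumption
    refine ⟨(hX X h1 h2 h3 h4 x).symm, ?_⟩
    have := (hX (star X) (by simpa [hs] using h1.star_star) (by simpa [hr] using h2.star_star)
      (by simpa [he'] using h4.star_star) (by simpa [he] using h3.star_star) x).star_star
    rw [star_star] at this
    exact this.symm
  · intro hT X hX
    exact hT X (hX _ ⟨_, rfl⟩).1.symm (hX _ ⟨_, rfl⟩).1.symm (hX _ ⟨_, rfl⟩).1.symm
      (hX _ ⟨_, rfl⟩).1.symm

end WeightedGraph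

/-! ### Polar decomposition of an injective operator and the associated frame -/

section InjectivePolar

open ContinuousLinearMap (adjoint)

variable {L K H : Type*} [NormedAddCommGroup L] [InnerProductSpace ℂ L] [CompleteSpace L]
  [NormedAddCommGroup K] [InnerProductSpace ℂ K] [CompleteSpace K]
  [NormedAddCommGroup H] [InnerProductSpace ℂ H] [CompleteSpace H]

theorem adjoint_comp_self_nonneg (t : K →L[ℂ] H) : 0 ≤ adjoint t ∘L t :=
  ContinuousLinearMap.nonneg_iff_isPositive _ |>.2 (ContinuousLinearMap.isPositive_adjoint_comp_self t)

theorem opAbs_nonneg (t : K →L[ℂ] H) : 0 ≤ opAbs t := CFC.sqrt_nonneg _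

theorem norm_opAbs_apply (t : K →L[ℂ] H) (x : K) : ‖opAbs t x‖ = ‖t x‖ := by
  have hsa : adjoint (opAbs t) = opAbs t := (IsSelfAdjoint.of_nonneg (opAbs_nonneg t)).star_eq
  have hsq : opAbs t * opAbs t = adjoint t ∘L t :=
    CFC.sqrt_mul_sqrt_self _ (adjoint_comp_self_nonneg t)
  have h : (inner ℂ (opAbs t x) (opAbs t x) : ℂ) = inner ℂ (t x) (t x) := by
    rw [← ContinuousLinearMap.adjoint_inner_right, hsa, ← ContinuousLinearMap.adjoint_inner_right t]
    exact congrArg (fun T => inner ℂ x (T x)) hsq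
  rw [inner_self_eq_norm_sq_to_K, inner_self_eq_norm_sq_to_K] at h
  exact (sq_eq_sq₀ (norm_nonneg _) (norm_nonneg _)).1 (by exact_mod_cast h)

/-- The polar decomposition of an injective operator. -/
theorem exists_isPolarDecomposition (t : K →L[ℂ] H) (hinj : ∀ x, t x = 0 → x = 0) :
    ∃ u : K →ₗᵢ[ℂ] H, IsPolarDecomposition t u.toContinuousLinearMap ∧
      LinearMap.range (u.toContinuousLinearMap : K →ₗ[ℂ] H) =
        (LinearMap.range (t : K →ₗ[ℂ] H)).topologicalClosure := by
  have hd : DenseRange (opAbs t) := denseRange_of_nonneg_of_injective (opAbs_nonneg t) fun y hy =>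
    hinj y (norm_eq_zero.1 (by rw [← norm_opAbs_apply, hy, norm_zero]))
  obtain ⟨u, hu⟩ := exists_isometry_comp hd fun x => (norm_opAbs_apply t x).symm
  refine ⟨u, ⟨ContinuousLinearMap.ext hu, fun x _ => u.norm_map x, fun x hx => ?_⟩, ?_⟩
  · rw [hinj x hx, map_zero]
  · apply le_antisymm
    · rintro _ ⟨x, rfl⟩
      refine closure_mono ?_ (image_closure_subset_closure_image u.continuous ⟨x, hd x, rfl⟩)
      rintro _ ⟨_, ⟨y, rfl⟩, rfl⟩
      exact ⟨y, hu y⟩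
    · refine Submodule.topologicalClosure_minimal _ ?_ ?_
      · rintro _ ⟨y, rfl⟩
        exact ⟨opAbs t y, (hu y).symm⟩
      · rw [LinearMap.coe_range]
        exact u.isometry.isClosedEmbedding.isClosed_range

variable {κ : Type*} [Fintype κ] [DecidableEq κ] {I : κ → L →L[ℂ] K}

theorem IsDecomposition.adjoint_comp_self_eq (hI : IsDecomposition I) {t : K →L[ℂ] H}
    {a : L →L[ℂ] L} (h : ∀ j x, adjoint t (t (I j x)) = I j (a (a x))) :
    adjoint t ∘L t = hI.inflate (a * a) :=
  hI.ext fun j x => by rw [hI.inflate_apply_apply]; exact h j x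

theorem IsDecomposition.opAbs_eq (hI : IsDecomposition I) {t : K →L[ℂ] H}
    {a : L →L[ℂ] L} (ha : 0 ≤ a) (h : ∀ j x, adjoint t (t (I j x)) = I j (a (a x))) :
    opAbs t = hI.inflate a := by
  rw [opAbs, hI.adjoint_comp_self_eq h, map_mul]
  exact CFC.sqrt_unique rfl (hI.inflate_nonneg ha)

end InjectivePolar

section CornerFrame

open ContinuousLinearMap (adjoint)

variable {L H : Type*} [NormedAddCommGroup L] [InnerProductSpace ℂ L] [CompleteSpace L]
  [NormedAddCommGroup H] [InnerProductSpace ℂ H] [CompleteSpace H]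
  {A B : Submodule ℂ H} [CompleteSpace A] [CompleteSpace B]

variable (A B) in
/-- The isometries of `L` into `H = A ⊕ B` obtained from isometries `I_j : L → B` and `u : B → A`. -/
def cornerFrame (u : B →L[ℂ] A) (I : Fin 2 → L →L[ℂ] B) : Fin 2 → Fin 2 → L →L[ℂ] H :=
  ![fun j => A.subtypeL ∘L u ∘L I j, fun j => B.subtypeL ∘L I j]

theorem adjoint_cornerFrame_zero (u : B →L[ℂ] A) (I : Fin 2 → L →L[ℂ] B) (j : Fin 2) (v : H) :
    adjoint (cornerFrame A B u I 0 j) v =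
      adjoint (I j) (adjoint u (A.orthogonalProjectionOnto v)) := by
  change adjoint (A.subtypeL ∘L u ∘L I j) v = _
  simp [ContinuousLinearMap.adjoint_comp, Submodule.adjoint_subtypeL]

theorem adjoint_cornerFrame_one (u : B →L[ℂ] A) (I : Fin 2 → L →L[ℂ] B) (j : Fin 2) (v : H) :
    adjoint (cornerFrame A B u I 1 j) v = adjoint (I j) (B.orthogonalProjectionOnto v) := by
  change adjoint (B.subtypeL ∘L I j) v = _
  simp [ContinuousLinearMap.adjoint_comp, Submodule.adjoint_subtypeL]

theorem cornerFrame_zero_apply (u : B →L[ℂ] A) (I : Fin 2 → L →L[ℂ] B) (j : Fin 2) (x : L) :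
    cornerFrame A B u I 0 j x = u (I j x) := rfl

theorem cornerFrame_one_apply (u : B →L[ℂ] A) (I : Fin 2 → L →L[ℂ] B) (j : Fin 2) (x : L) :
    cornerFrame A B u I 1 j x = I j x := rfl

theorem corner_apply (T : B →L[ℂ] A) (v : H) :
    corner A B T v = T (B.orthogonalProjectionOnto v) := rfl

theorem star_corner (T : B →L[ℂ] A) : star (corner A B T) = corner B A (adjoint T) := by
  simp only [corner, ContinuousLinearMap.star_eq_adjoint, ContinuousLinearMap.adjoint_comp,
    Submodule.adjoint_subtypeL, Submodule.adjoint_orthogonalProjectionOnto,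
    ContinuousLinearMap.comp_assoc]

theorem isSelfAdjoint_corner_starProjection (S : Submodule ℂ A) [S.HasOrthogonalProjection] :
    IsSelfAdjoint (corner A A S.starProjection) := by
  rw [IsSelfAdjoint, star_corner, ← ContinuousLinearMap.star_eq_adjoint,
    (isSelfAdjoint_starProjection _).star_eq]

theorem corner_starProjection_idem (S : Submodule ℂ A) [S.HasOrthogonalProjection] (x : H) :
    corner A A S.starProjection (corner A A S.starProjection x) =
      corner A A S.starProjection x := by
  rw [corner_apply, corner_apply, Submodule.orthogonalProjectionOnto_mem_subspace_eq_self]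
  congr 1
  exact Submodule.starProjection_eq_self_iff.2 (Submodule.starProjection_apply_mem _ _)

theorem corner_starProjection_eq_self_iff (S : Submodule ℂ A) [S.HasOrthogonalProjection] (x : H) :
    corner A A S.starProjection x = x ↔ ∃ y ∈ S, (y : H) = x := by
  constructor
  · intro hx
    exact ⟨_, Submodule.starProjection_apply_mem _ _, hx⟩
  · rintro ⟨y, hy, rfl⟩
    rw [corner_apply, Submodule.orthogonalProjectionOnto_mem_subspace_eq_self,
      Submodule.starProjection_eq_self_iff.2 hy]

variable {I : Fin 2 → L →L[ℂ] B} {u : B →L[ℂ] A}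

theorem amp_cornerFrame_upperRight (hI : IsDecomposition I) (q : L →L[ℂ] L) :
    amp (cornerFrame A B u I) !![0, q; 0, 0] = corner A B (u ∘L hI.inflate q) := by
  ext v
  rw [amp_eq_of_cons, corner_apply, ContinuousLinearMap.comp_apply, hI.inflate_apply]
  simp [adjoint_cornerFrame_one, cornerFrame_zero_apply]

theorem amp_cornerFrame_lowerRight (hI : IsDecomposition I) (q : L →L[ℂ] L) :
    amp (cornerFrame A B u I) !![0, 0; 0, q] = corner B B (hI.inflate q) := by
  ext v
  rw [amp_eq_of_cons, corner_apply, hI.inflate_apply]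
  simp [adjoint_cornerFrame_one, cornerFrame_one_apply]

theorem amp_cornerFrame_upperLeft (hI : IsDecomposition I) :
    amp (cornerFrame A B u I) !![1, 0; 0, 0] = corner A A (u ∘L adjoint u) := by
  ext v
  rw [amp_eq_of_cons, corner_apply, ContinuousLinearMap.comp_apply,
    ← hI.total (adjoint u (A.orthogonalProjectionOnto v))]
  simp [adjoint_cornerFrame_zero, cornerFrame_zero_apply]

/-- The projection onto the cokernel and the final projection of an isometry onto the closure of the
range add up to the identity. -/
theorem starProjection_add_isometry {K K' : Type*} [NormedAddCommGroup K] [InnerProductSpace ℂ K]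
    [CompleteSpace K] [NormedAddCommGroup K'] [InnerProductSpace ℂ K'] [CompleteSpace K']
    {R : Submodule ℂ K'} {u : K →L[ℂ] K'} (hu : ∀ x, ‖u x‖ = ‖x‖)
    (hR : LinearMap.range (u : K →ₗ[ℂ] K') = R.topologicalClosure) :
    (∀ x, Rᗮ.starProjection (u x) = 0) ∧ ∀ y, y = Rᗮ.starProjection y + u (adjoint u y) := by
  have hmem : ∀ x, u x ∈ R.topologicalClosure := fun x => hR ▸ ⟨x, rfl⟩
  have huu : ∀ x, adjoint u (u x) = x := by
    have := (ContinuousLinearMap.norm_map_iff_adjoint_comp_self u).1 hu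
    exact fun x => congrArg (fun T => T x) this
  have h0 : ∀ x, Rᗮ.starProjection (u x) = 0 := by
    intro x
    rw [Submodule.starProjection_apply_eq_zero_iff, Submodule.orthogonal_orthogonal_eq_closure]
    exact hmem x
  refine ⟨h0, fun y => ?_⟩
  have h1 : y - Rᗮ.starProjection y ∈ R.topologicalClosure := by
    rw [← Submodule.orthogonal_orthogonal_eq_closure]
    exact Submodule.sub_starProjection_mem_orthogonal y
  rw [← hR] at h1
  obtain ⟨x, hx⟩ := h1
  have hx' : u x = y - Rᗮ.starProjection y := hx
  have h2 : adjoint u (Rᗮ.starProjection y) = 0 := by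
    refine ext_inner_left ℂ fun x => ?_
    rw [inner_zero_right, ContinuousLinearMap.adjoint_inner_right,
      Submodule.inner_starProjection_left_eq_right .. |>.symm, h0, inner_zero_left]
  have h3 : adjoint u y = x := by
    rw [← huu x, hx', map_sub, h2, sub_zero]
  rw [h3, hx']
  abel

theorem corner_starProjection_add_amp (hI : IsDecomposition I) (hu : ∀ x, ‖u x‖ = ‖x‖)
    {R : Submodule ℂ A} (hR : LinearMap.range (u : B →ₗ[ℂ] A) = R.topologicalClosure) (v : H) :
    (corner A A Rᗮ.starProjection + amp (cornerFrame A B u I) !![1, 0; 0, 0]) v =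
      A.orthogonalProjectionOnto v := by
  rw [amp_cornerFrame_upperLeft hI, _root_.add_apply, corner_apply, corner_apply,
    ← Submodule.coe_add]
  exact congrArg _ ((starProjection_add_isometry hu hR).2 _).symm

theorem isMatrixFrame_cornerFrame (hI : IsDecomposition I) (hu : ∀ x, ‖u x‖ = ‖x‖)
    (hAB : ∀ v : H, (A.orthogonalProjectionOnto v : H) + B.orthogonalProjectionOnto v = v)
    {R : Submodule ℂ A} (hR : LinearMap.range (u : B →ₗ[ℂ] A) = R.topologicalClosure)
    (hcomp : ∀ T : H →L[ℂ] H, ∃ c : ℂ, ∀ v, corner A A Rᗮ.starProjection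
      (T (corner A A Rᗮ.starProjection v)) = c • corner A A Rᗮ.starProjection v) :
    IsMatrixFrame (corner A A Rᗮ.starProjection) (cornerFrame A B u I) := by
  obtain ⟨h0, h1⟩ := starProjection_add_isometry hu hR
  have hA : ∀ b : B, A.orthogonalProjectionOnto (b : H) = 0 := by
    intro b
    have := hAB b
    rw [Submodule.orthogonalProjectionOnto_mem_subspace_eq_self, add_eq_right] at this
    exact_mod_cast this
  have hB : ∀ a : A, B.orthogonalProjectionOnto (a : H) = 0 := by
    intro a
    have := hAB a
    rw [Submodule.orthogonalProjectionOnto_mem_subspace_eq_self, add_eq_left] at this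
    exact_mod_cast this
  have huu : ∀ x, adjoint u (u x) = x := by
    have := (ContinuousLinearMap.norm_map_iff_adjoint_comp_self u).1 hu
    exact fun x => congrArg (fun T => T x) this
  refine ⟨fun i j k l x => ?_, fun i j x => ?_, ?_, fun v => ?_, hcomp⟩
  · fin_cases i <;> fin_cases k <;>
      simp [adjoint_cornerFrame_zero, adjoint_cornerFrame_one, cornerFrame_zero_apply,
        cornerFrame_one_apply, hA, hB, huu, hI.ortho]
  · fin_cases i <;> simp [corner_apply, cornerFrame_zero_apply, cornerFrame_one_apply, hA, h0]
  · exact isSelfAdjoint_corner_starProjection _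
  · have e1 := amp_cornerFrame_upperLeft (u := u) hI
    have e2 := amp_cornerFrame_lowerRight (u := u) hI 1
    conv_lhs => rw [← hAB v, h1 (A.orthogonalProjectionOnto v)]
    simp only [Fin.sum_univ_two, adjoint_cornerFrame_zero, adjoint_cornerFrame_one,
      cornerFrame_zero_apply, cornerFrame_one_apply, corner_apply]
    have t1 := hI.total (adjoint u (A.orthogonalProjectionOnto v))
    have t2 := hI.total (B.orthogonalProjectionOnto v)
    rw [Fin.sum_univ_two] at t1 t2
    rw [← t1, ← t2]
    simp [hI.ortho, add_assoc]

/-- A projection whose range is separated by a single coordinate has rank at most one. -/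
theorem exists_compress_eq_smul {z : H →L[ℂ] H} (hz : IsSelfAdjoint z) (hzz : ∀ v, z (z v) = z v)
    {δ : H} (hδ : ∀ x, z x = x → (inner ℂ δ x : ℂ) = 0 → x = 0) :
    (∀ x y, z x = x → z y = y → (inner ℂ δ y : ℂ) • x = (inner ℂ δ x : ℂ) • y) ∧
      ∀ T : H →L[ℂ] H, ∃ c : ℂ, ∀ v, z (T (z v)) = c • z v := by
  have h1 : ∀ x y, z x = x → z y = y → (inner ℂ δ y : ℂ) • x = (inner ℂ δ x : ℂ) • y := by
    intro x y hx hy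
    rw [← sub_eq_zero]
    refine hδ _ (by rw [map_sub, map_smul, map_smul, hx, hy]) ?_
    rw [inner_sub_right, inner_smul_right, inner_smul_right, mul_comm, sub_self]
  refine ⟨h1, fun T => ?_⟩
  by_cases h0 : (inner ℂ δ (z δ) : ℂ) = 0
  · have h2 : z δ = 0 := hδ _ (hzz δ) h0
    have h3 : ∀ v, z v = 0 := by
      intro v
      refine hδ _ (hzz v) ?_
      rw [← ContinuousLinearMap.adjoint_inner_left, ← ContinuousLinearMap.star_eq_adjoint,
        hz.star_eq, h2, inner_zero_left]
    exact ⟨0, fun v => by rw [h3, zero_smul]⟩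
  · refine ⟨inner ℂ δ (z (T (z δ))) / inner ℂ δ (z δ), fun v => ?_⟩
    have e1 := h1 _ _ (hzz v) (hzz δ)
    have e2 := h1 _ _ (hzz (T (z δ))) (hzz δ)
    have e3 := congrArg (fun x => z (T x)) e1
    simp only [map_smul] at e3
    refine smul_right_injective H h0 ?_
    simp only
    rw [e3, smul_smul, mul_div_cancel₀ _ h0]
    refine smul_right_injective H h0 ?_
    change (inner ℂ δ (z δ) : ℂ) • (inner ℂ δ (z v) : ℂ) • z (T (z δ)) =
      (inner ℂ δ (z δ) : ℂ) • (inner ℂ δ (z (T (z δ))) : ℂ) • z v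
    rw [smul_comm, e2, smul_comm _ _ (z v), e1, smul_comm]

end CornerFrame

/-! ### The decomposition of the Hilbert space of the two-edge graph -/

namespace WeightedGraph

open EllTwo ContinuousLinearMap

variable {V E : Type*} [Fintype V] {Γ : WeightedGraph V E} {f : E}

theorem mem_vertexSpace_iff (u : V) (x : Γ.L2) : x ∈ Γ.vertexSpace u ↔ Γ.vertexProj u x = x :=
  ⟨fun ⟨y, hy⟩ => hy ▸ congrArg (fun T => T y) (Γ.isIdempotentElem_vertexProj u),
    fun h => ⟨x, h⟩⟩

theorem IsTwoCycle.coe_orthogonalProjectionOnto (h : Γ.IsTwoCycle f) (x : Γ.L2) :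
    ((Γ.vertexSpace (Γ.s f)).orthogonalProjectionOnto x : Γ.L2) = Γ.vertexProj (Γ.s f) x := by
  refine Submodule.eq_starProjection_of_mem_of_inner_eq_zero ⟨x, rfl⟩ fun y hy => ?_
  rw [← (mem_vertexSpace_iff _ y).1 hy, ← adjoint_inner_left, h.adjoint_vertexProj, map_sub,
    show Γ.vertexProj (Γ.s f) (Γ.vertexProj (Γ.s f) x) = _ from
      congrArg (fun T => T x) (Γ.isIdempotentElem_vertexProj (Γ.s f)), sub_self, inner_zero_left]

theorem IsTwoCycle.coe_orthogonalProjectionOnto' (h : Γ.IsTwoCycle f) (x : Γ.L2) :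
    ((Γ.vertexSpace (Γ.r f)).orthogonalProjectionOnto x : Γ.L2) = Γ.vertexProj (Γ.r f) x := by
  have := h.symm.coe_orthogonalProjectionOnto x
  rwa [Γ.s_rev] at this

theorem IsTwoCycle.vertexProj_mul_edgeOp (h : Γ.IsTwoCycle f) :
    Γ.vertexProj (Γ.s f) * Γ.edgeOp f = Γ.edgeOp f := by
  refine h.clm_ext (fun n => ?_) fun n => ?_
  · simp [h.edgeOp_pathVec]
  · rw [mul_apply_eq_comp, edgeOp_pathVec_rev, map_add, map_smul, vertexProj_pathVec]
    split_ifs <;> simp [vertexProj_pathVec]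

theorem IsTwoCycle.edgeOp_mul_vertexProj (h : Γ.IsTwoCycle f) :
    Γ.edgeOp f * Γ.vertexProj (Γ.r f) = Γ.edgeOp f := by
  have h1 := vertexProj_pathVec (Γ := Γ) (Γ.rev f)
  rw [Γ.s_rev] at h1
  refine h.clm_ext (fun n => ?_) fun n => ?_
  · simp [h.edgeOp_pathVec, vertexProj_pathVec_of_ne h.ne.symm]
  · simp [h1]

theorem IsTwoCycle.edgeOp_mem (h : Γ.IsTwoCycle f) (x : Γ.L2) :
    Γ.edgeOp f x ∈ Γ.vertexSpace (Γ.s f) :=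
  ⟨Γ.edgeOp f x, congrArg (fun T => T x) h.vertexProj_mul_edgeOp⟩

theorem IsTwoCycle.edgeOp_rev_mem (h : Γ.IsTwoCycle f) (x : Γ.L2) :
    Γ.edgeOp (Γ.rev f) x ∈ Γ.vertexSpace (Γ.r f) := Γ.s_rev f ▸ h.symm.edgeOp_mem x

/-- The entry of `λ(f)` as an operator between the subspaces of the two vertices. -/
def edgeEntry (Γ : WeightedGraph V E) (f : E) :
    Γ.vertexSpace (Γ.r f) →L[ℂ] Γ.vertexSpace (Γ.s f) :=
  blockEntry (Γ.vertexSpace (Γ.s f)) (Γ.vertexSpace (Γ.r f)) (Γ.edgeOp f)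

theorem IsTwoCycle.coe_edgeEntry (h : Γ.IsTwoCycle f) (x : Γ.vertexSpace (Γ.r f)) :
    (Γ.edgeEntry f x : Γ.L2) = Γ.edgeOp f x := by
  change (((Γ.vertexSpace (Γ.s f)).orthogonalProjectionOnto (Γ.edgeOp f x) : _) : Γ.L2) = _
  rw [h.coe_orthogonalProjectionOnto]
  exact congrArg (fun T => T (x : Γ.L2)) h.vertexProj_mul_edgeOp

theorem IsTwoCycle.coe_adjoint_edgeEntry (h : Γ.IsTwoCycle f) (y : Γ.vertexSpace (Γ.s f)) :
    (adjoint (Γ.edgeEntry f) y : Γ.L2) = Γ.edgeOp (Γ.rev f) y := by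
  have : adjoint (Γ.edgeEntry f) y = ⟨Γ.edgeOp (Γ.rev f) y, h.edgeOp_rev_mem _⟩ := by
    refine ext_inner_left ℂ fun x => ?_
    rw [adjoint_inner_right, Submodule.coe_inner, Submodule.coe_inner, h.coe_edgeEntry,
      ← adjoint_inner_right, h.adjoint_edgeOp]
  rw [this]

theorem IsTwoCycle.edgeOp_eq_corner (h : Γ.IsTwoCycle f) :
    Γ.edgeOp f = corner (Γ.vertexSpace (Γ.s f)) (Γ.vertexSpace (Γ.r f)) (Γ.edgeEntry f) := by
  ext1 x
  rw [corner_apply, h.coe_edgeEntry, h.coe_orthogonalProjectionOnto']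
  exact (congrArg (fun T => T x) h.edgeOp_mul_vertexProj).symm

/-! ### Coordinates of the kernels -/

theorem IsTwoCycle.inner_edgeOp (h : Γ.IsTwoCycle f) (n : ℕ) (x : Γ.L2) :
    (inner ℂ (Γ.pathVec f n) (Γ.edgeOp f x) : ℂ) =
      (Γ.ratio f : ℂ)⁻¹ * inner ℂ (Γ.pathVec (Γ.rev f) (n + 1)) x +
        if n = 0 then 0 else (Γ.ratio f : ℂ) * inner ℂ (Γ.pathVec (Γ.rev f) (n - 1)) x := by
  have key := edgeOp_pathVec_rev (Γ := Γ) (Γ.rev f) n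
  rw [Γ.rev_rev, ratio_rev] at key
  rw [← adjoint_inner_left, h.adjoint_edgeOp, key, inner_add_left, inner_smul_left,
    Complex.conj_ofReal, Complex.ofReal_inv, inv_inv]
  split_ifs
  · rw [inner_zero_left]
  · rw [inner_smul_left, Complex.conj_ofReal]

theorem IsTwoCycle.inner_add_two (h : Γ.IsTwoCycle f) {x : Γ.L2} (n : ℕ)
    (hx : (inner ℂ (Γ.pathVec f (n + 1)) (Γ.edgeOp f x) : ℂ) = 0) :
    (inner ℂ (Γ.pathVec (Γ.rev f) (n + 2)) x : ℂ) =
      -(Γ.ratio f : ℂ) ^ 2 * inner ℂ (Γ.pathVec (Γ.rev f) n) x := by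
  have h0 : (Γ.ratio f : ℂ) ≠ 0 := Complex.ofReal_ne_zero.2 (ratio_pos f).ne'
  rw [h.inner_edgeOp, if_neg (Nat.succ_ne_zero n), Nat.add_sub_cancel] at hx
  field_simp at hx
  linear_combination hx

theorem IsTwoCycle.inner_odd_eq_zero (h : Γ.IsTwoCycle f) {x : Γ.L2}
    (hx : ∀ k, (inner ℂ (Γ.pathVec f (2 * k)) (Γ.edgeOp f x) : ℂ) = 0) (k : ℕ) :
    (inner ℂ (Γ.pathVec (Γ.rev f) (2 * k + 1)) x : ℂ) = 0 := by
  induction k with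
  | zero =>
    have h0 : (Γ.ratio f : ℂ) ≠ 0 := Complex.ofReal_ne_zero.2 (ratio_pos f).ne'
    have := hx 0
    rw [h.inner_edgeOp, if_pos (mul_zero 2), add_zero, mul_zero, zero_add] at this
    exact (mul_eq_zero.1 this).resolve_left (inv_ne_zero h0)
  | succ k ih =>
    have := h.inner_add_two (2 * k + 1) (hx (k + 1))
    rw [ih, mul_zero] at this
    exact this

theorem IsTwoCycle.inner_even (h : Γ.IsTwoCycle f) {x : Γ.L2}
    (hx : ∀ k, (inner ℂ (Γ.pathVec f (2 * k + 1)) (Γ.edgeOp f x) : ℂ) = 0) (k : ℕ) :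
    (inner ℂ (Γ.pathVec (Γ.rev f) (2 * k)) x : ℂ) =
      (-(Γ.ratio f : ℂ) ^ 2) ^ k * inner ℂ (Γ.pathVec (Γ.rev f) 0) x := by
  induction k with
  | zero => simp
  | succ k ih =>
    have := h.inner_add_two (2 * k) (hx k)
    rw [ih, ← mul_assoc, ← pow_succ'] at this
    exact this

theorem inner_pathVec_tendsto_zero (f : E) (x : Γ.L2) :
    Filter.Tendsto (fun n => (inner ℂ (Γ.pathVec f n) x : ℂ)) Filter.atTop (nhds 0) := by
  have ho : Orthonormal ℂ (Γ.pathVec f) :=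
    orthonormal_delta.comp (Γ.altPath f) (Γ.altPath_injective f)
  have h1 := (ho.inner_products_summable x).tendsto_atTop_zero
  have h2 := h1.sqrt
  simp only [Real.sqrt_sq (norm_nonneg _), Real.sqrt_zero] at h2
  exact tendsto_zero_iff_norm_tendsto_zero.2 h2

/-- If `α ≥ 1` then the coordinates at the even paths do not decrease in absolute value, and square
summability forces them to vanish. -/
theorem IsTwoCycle.inner_zero_eq_zero (h : Γ.IsTwoCycle f) (hα : 1 ≤ Γ.ratio f) {x : Γ.L2}
    (hx : ∀ k, (inner ℂ (Γ.pathVec f (2 * k + 1)) (Γ.edgeOp f x) : ℂ) = 0) :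
    (inner ℂ (Γ.pathVec (Γ.rev f) 0) x : ℂ) = 0 := by
  have h1 := ((inner_pathVec_tendsto_zero (Γ.rev f) x).comp
    (Filter.tendsto_id.const_mul_atTop' (r := 2) two_pos)).norm
  rw [norm_zero] at h1
  refine norm_le_zero_iff.1 (ge_of_tendsto' h1 fun k => ?_)
  simp only [Function.comp_apply, id_eq]
  rw [h.inner_even hx, norm_mul, norm_pow, norm_neg, norm_pow, Complex.norm_real, Real.norm_eq_abs,
    abs_of_pos (ratio_pos f)]
  exact le_mul_of_one_le_left (norm_nonneg _) (one_le_pow₀ (one_le_pow₀ hα))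

theorem IsTwoCycle.inner_eq_zero_of_mem (h : Γ.IsTwoCycle f) {x : Γ.L2}
    (hx : x ∈ Γ.vertexSpace (Γ.r f)) (n : ℕ) : (inner ℂ (Γ.pathVec f n) x : ℂ) = 0 := by
  rw [← (mem_vertexSpace_iff _ x).1 hx, ← adjoint_inner_left, ← Γ.s_rev,
    h.symm.adjoint_vertexProj, Γ.s_rev, vertexProj_pathVec_of_ne h.ne.symm, inner_zero_left]

/-- A vector in the kernel of `λ(f)` is determined by its first coordinate. -/
theorem IsTwoCycle.eq_zero_of_edgeOp_eq_zero (h : Γ.IsTwoCycle f) {x : Γ.L2}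
    (hx : x ∈ Γ.vertexSpace (Γ.r f)) (hf : Γ.edgeOp f x = 0)
    (h0 : (inner ℂ (Γ.pathVec (Γ.rev f) 0) x : ℂ) = 0) : x = 0 := by
  refine h.eq_zero (h.inner_eq_zero_of_mem hx) fun n => ?_
  obtain ⟨k, rfl | rfl⟩ := Nat.even_or_odd' n
  · rw [h.inner_even (fun k => by rw [hf, inner_zero_right]), h0, mul_zero]
  · exact h.inner_odd_eq_zero (fun k => by rw [hf, inner_zero_right]) k

theorem IsTwoCycle.edgeOp_injective (h : Γ.IsTwoCycle f) (hα : 1 ≤ Γ.ratio f) {x : Γ.L2}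
    (hx : x ∈ Γ.vertexSpace (Γ.r f)) (hf : Γ.edgeOp f x = 0) : x = 0 :=
  h.eq_zero_of_edgeOp_eq_zero hx hf
    (h.inner_zero_eq_zero hα fun k => by rw [hf, inner_zero_right])

/-! ### Copies of `ℓ²(ℤ)` in the Hilbert space -/

variable (Γ) in
/-- The number `α² + α⁻²`. -/
def spectralShift (f : E) : ℝ := Γ.ratio f ^ 2 + (Γ.ratio f ^ 2)⁻¹

theorem two_le_spectralShift (f : E) : 2 ≤ Γ.spectralShift f := by
  have h : 0 < Γ.ratio f ^ 2 := pow_pos (ratio_pos f) 2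
  have h1 : Γ.ratio f ^ 2 * (Γ.ratio f ^ 2)⁻¹ = 1 := mul_inv_cancel₀ h.ne'
  have h2 : 0 < (Γ.ratio f ^ 2)⁻¹ := inv_pos.2 h
  unfold spectralShift
  nlinarith [sq_nonneg (Γ.ratio f ^ 2 - (Γ.ratio f ^ 2)⁻¹)]

theorem spectralShift_rev (f : E) : Γ.spectralShift (Γ.rev f) = Γ.spectralShift f := by
  rw [spectralShift, spectralShift, ratio_rev, inv_pow, inv_inv, add_comm]

theorem altPath_odd_injective (f : E) :
    Function.Injective fun k : ℕ => Γ.altPath f (2 * k + 1) := fun k l hkl => by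
  simpa using Γ.altPath_injective f hkl

variable (Γ) in
/-- The isometry of `ℓ²(ℤ)` onto the span of the paths of odd length beginning with `f`, which maps
the sine basis to the path basis. -/
def oddIsometry (f : E) : EllTwo (Multiplicative ℤ) →ₗᵢ[ℂ] Γ.L2 :=
  (mapInj _ (altPath_odd_injective f)).comp (sineBasis fourierEquiv).repr.toLinearIsometry

theorem oddIsometry_sineVec (f : E) (k : ℕ) :
    Γ.oddIsometry f (sineVec fourierEquiv k) = Γ.pathVec f (2 * k + 1) := by
  classical
  have h : (sineBasis fourierEquiv).repr (sineVec fourierEquiv k) = delta k := by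
    rw [← sineBasis_apply, HilbertBasis.repr_self]
    unfold delta
    congr!
  exact (congrArg (mapInj _ (altPath_odd_injective f)) h).trans
    (mapInj_delta _ (altPath_odd_injective f) k)

theorem clm_ext_sineVec {F : Type*} [NormedAddCommGroup F] [NormedSpace ℂ F]
    {S T : EllTwo (Multiplicative ℤ) →L[ℂ] F}
    (h : ∀ k, S (sineVec fourierEquiv k) = T (sineVec fourierEquiv k)) : S = T := by
  refine ContinuousLinearMap.ext_on (s := Set.range (sineBasis fourierEquiv)) ?_ ?_
  · rw [Submodule.dense_iff_topologicalClosure_eq_top]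
    exact (sineBasis fourierEquiv).dense_span
  · rintro _ ⟨k, rfl⟩
    rw [sineBasis_apply]
    exact h k

/-- On the paths of odd length, `λ(f)*λ(f)` acts as the Jacobi matrix of the model operator. -/
theorem edgeOp_edgeOp_oddIsometry (f : E) (x : EllTwo (Multiplicative ℤ)) :
    Γ.edgeOp (Γ.rev f) (Γ.edgeOp f (Γ.oddIsometry (Γ.rev f) x)) =
      Γ.oddIsometry (Γ.rev f) (modelLZ (Γ.spectralShift f) (modelLZ (Γ.spectralShift f) x)) := by
  have key := edgeOp_pathVec_rev (Γ := Γ) (Γ.rev f)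
  simp only [Γ.rev_rev, ratio_rev, Complex.ofReal_inv, inv_inv] at key
  have h0 : (Γ.ratio f : ℂ) ≠ 0 := Complex.ofReal_ne_zero.2 (ratio_pos f).ne'
  suffices hs : Γ.edgeOp (Γ.rev f) ∘L Γ.edgeOp f ∘L (Γ.oddIsometry (Γ.rev f)).toContinuousLinearMap =
      (Γ.oddIsometry (Γ.rev f)).toContinuousLinearMap ∘L (modelLZ (Γ.spectralShift f)) ∘L
        (modelLZ (Γ.spectralShift f)) from congrArg (fun T => T x) hs
  refine clm_ext_sineVec fun k => ?_
  change Γ.edgeOp (Γ.rev f) (Γ.edgeOp f (Γ.oddIsometry (Γ.rev f) _)) =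
    Γ.oddIsometry (Γ.rev f) (modelLZ _ (modelLZ _ _))
  rw [modelLZ, modelOp_sq_sineVec _ (two_le_spectralShift f), oddIsometry_sineVec, map_add, map_add,
    map_smul, oddIsometry_sineVec, oddIsometry_sineVec, edgeOp_pathVec_rev,
    if_neg (Nat.succ_ne_zero _), map_add, map_smul, map_smul, key, key,
    if_neg (Nat.succ_ne_zero _)]
  have hc : ((Γ.spectralShift f : ℝ) : ℂ) = (Γ.ratio f : ℂ) * Γ.ratio f +
      (Γ.ratio f : ℂ)⁻¹ * (Γ.ratio f : ℂ)⁻¹ := by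
    rw [spectralShift]
    push_cast
    field_simp
  rw [hc]
  clear hc key
  generalize (Γ.ratio f : ℂ) = α at h0
  rcases k with _ | k
  · rw [show 2 * (0 + 1) + 1 = 2 * 0 + 1 + 1 + 1 from rfl]
    simp only [if_pos, add_zero, mul_zero, zero_add, map_zero, Nat.add_sub_cancel]
    match_scalars <;> field_simp
  · have i1 : 2 * (k + 1) + 1 - 1 + 1 = 2 * (k + 1) + 1 := by omega
    have i2 : 2 * (k + 1) + 1 - 1 - 1 = 2 * k + 1 := by omega
    rw [if_neg (Nat.succ_ne_zero _), if_neg (by omega), oddIsometry_sineVec,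
      Nat.add_sub_cancel (2 * (k + 1) + 1) 1, Nat.add_sub_cancel k 1, i1, i2,
      show 2 * (k + 1 + 1) + 1 = 2 * (k + 1) + 1 + 1 + 1 from rfl]
    match_scalars <;> field_simp

end WeightedGraph

/-! ### The space of the range vertex as a sum of copies of `ℓ²(ℤ)` -/

namespace WeightedGraph

open EllTwo ContinuousLinearMap

variable {V E : Type*} [Fintype V] {Γ : WeightedGraph V E} {e : E}

/-- The edge `e` maps odd paths to even paths, which are orthogonal to the odd ones. -/
theorem inner_oddIsometry_edgeOp (e : E)
    (x y : EllTwo (Multiplicative ℤ)) :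
    (inner ℂ (Γ.oddIsometry e x) (Γ.edgeOp e (Γ.oddIsometry (Γ.rev e) y)) : ℂ) = 0 := by
  have h1 : ∀ k l, (inner ℂ (Γ.edgeOp e (Γ.pathVec (Γ.rev e) (2 * k + 1)))
      (Γ.pathVec e (2 * l + 1)) : ℂ) = 0 := by
    intro k l
    rw [edgeOp_pathVec_rev, if_neg (Nat.succ_ne_zero _), inner_add_left, inner_smul_left,
      inner_smul_left, inner_pathVec_self, inner_pathVec_self, if_neg (by omega), if_neg (by omega)]
    simp
  have h2 : ∀ k, innerSL ℂ (Γ.edgeOp e (Γ.pathVec (Γ.rev e) (2 * k + 1))) ∘L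
      (Γ.oddIsometry e).toContinuousLinearMap = 0 := fun k => clm_ext_sineVec fun l => by
    change inner ℂ _ (Γ.oddIsometry e _) = (0 : ℂ)
    rw [oddIsometry_sineVec, h1]
  have h3 : innerSL ℂ (Γ.oddIsometry e x) ∘L Γ.edgeOp e ∘L
      (Γ.oddIsometry (Γ.rev e)).toContinuousLinearMap = 0 := clm_ext_sineVec fun k => by
    change inner ℂ _ (Γ.edgeOp e (Γ.oddIsometry (Γ.rev e) _)) = (0 : ℂ)
    rw [oddIsometry_sineVec, inner_eq_zero_symm]
    exact congrArg (fun T => T x) (h2 k)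
  exact congrArg (fun T => T y) h3

/-- The space of the vertex of smaller weight is the sum of two copies of `ℓ²(ℤ)`, spanned by the
paths of odd and of even length, on which `t*t` acts as the square of the model operator. -/
theorem IsTwoCycle.exists_isDecomposition (h : Γ.IsTwoCycle e) (hα : 1 ≤ Γ.ratio e) :
    ∃ I : Fin 2 → EllTwo (Multiplicative ℤ) →L[ℂ] Γ.vertexSpace (Γ.r e), IsDecomposition I ∧
      ∀ j x, adjoint (Γ.edgeEntry e) (Γ.edgeEntry e (I j x)) =
        I j (modelLZ (Γ.spectralShift e) (modelLZ (Γ.spectralShift e) x)) := by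
  have h2 := two_le_spectralShift (Γ := Γ) e
  have k1 := edgeOp_edgeOp_oddIsometry (Γ := Γ) e
  have k2 := edgeOp_edgeOp_oddIsometry (Γ := Γ) (Γ.rev e)
  rw [Γ.rev_rev, spectralShift_rev] at k2
  have hpos := modelLZ_nonneg h2
  set a := modelLZ (Γ.spectralShift e) with ha
  have hsa : adjoint a = a := (IsSelfAdjoint.of_nonneg hpos).star_eq
  have hd : DenseRange a := denseRange_of_nonneg_of_injective hpos fun y hy =>
    modelOp_injective fourierEquiv h2 hy
  -- the odd paths at the other vertex are mapped onto the even paths at this vertex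
  obtain ⟨J, hJ⟩ := exists_isometry_comp hd
    (s := Γ.edgeOp (Γ.rev e) ∘L (Γ.oddIsometry e).toContinuousLinearMap) fun x => by
      have h3 : (inner ℂ (Γ.edgeOp (Γ.rev e) (Γ.oddIsometry e x))
          (Γ.edgeOp (Γ.rev e) (Γ.oddIsometry e x)) : ℂ) = inner ℂ (a x) (a x) := by
        rw [← adjoint_inner_right, h.symm.adjoint_edgeOp, Γ.rev_rev, k2,
          LinearIsometry.inner_map_map, ← adjoint_inner_left, hsa]
      rw [inner_self_eq_norm_sq_to_K, inner_self_eq_norm_sq_to_K] at h3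
      exact (sq_eq_sq₀ (norm_nonneg _) (norm_nonneg _)).1 (by exact_mod_cast h3)
  have hJ' : ∀ x, J (a x) = Γ.edgeOp (Γ.rev e) (Γ.oddIsometry e x) := fun x => (hJ x).symm
  have k3 : ∀ y, Γ.edgeOp (Γ.rev e) (Γ.edgeOp e (J y)) = J (a (a y)) := by
    refine congrFun (hd.equalizer (by fun_prop) (by fun_prop) (funext fun x => ?_))
    simp only [Function.comp_apply]
    rw [hJ', k2, hJ']
  have m1 : ∀ x, Γ.oddIsometry (Γ.rev e) x ∈ Γ.vertexSpace (Γ.r e) := by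
    have : Γ.vertexProj (Γ.r e) ∘L (Γ.oddIsometry (Γ.rev e)).toContinuousLinearMap =
        (Γ.oddIsometry (Γ.rev e)).toContinuousLinearMap := clm_ext_sineVec fun k => by
      change Γ.vertexProj (Γ.r e) (Γ.oddIsometry (Γ.rev e) _) = Γ.oddIsometry (Γ.rev e) _
      rw [oddIsometry_sineVec, ← Γ.s_rev, vertexProj_pathVec]
    exact fun x => ⟨_, congrArg (fun T => T x) this⟩
  have m2 : ∀ x, J x ∈ Γ.vertexSpace (Γ.r e) := by
    have : (fun x => Γ.vertexProj (Γ.r e) (J x)) = fun x => J x := by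
      refine hd.equalizer (by fun_prop) (by fun_prop) (funext fun x => ?_)
      simp only [Function.comp_apply]
      rw [hJ']
      exact (mem_vertexSpace_iff _ _).1 (h.edgeOp_rev_mem _)
    exact fun x => ⟨_, congrFun this x⟩
  have o1 : ∀ x y, (inner ℂ (Γ.oddIsometry (Γ.rev e) y) (J x) : ℂ) = 0 := by
    intro x y
    refine congrFun (hd.equalizer (g := fun x => (inner ℂ (Γ.oddIsometry (Γ.rev e) y) (J x) : ℂ))
      (h := fun _ => 0) (by fun_prop) (by fun_prop) (funext fun x => ?_)) x
    simp only [Function.comp_apply]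
    rw [hJ', ← h.adjoint_edgeOp, adjoint_inner_right, inner_eq_zero_symm,
      inner_oddIsometry_edgeOp]
  let I : Fin 2 → EllTwo (Multiplicative ℤ) →L[ℂ] Γ.vertexSpace (Γ.r e) :=
    ![(Γ.oddIsometry (Γ.rev e)).toContinuousLinearMap.codRestrict _ m1,
      J.toContinuousLinearMap.codRestrict _ m2]
  have i0 : ∀ x, (I 0 x : Γ.L2) = Γ.oddIsometry (Γ.rev e) x := fun x => rfl
  have i1 : ∀ x, (I 1 x : Γ.L2) = J x := fun x => rfl
  have hO : ∀ j l x, adjoint (I j) (I l x) = if j = l then x else 0 := by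
    intro j l x
    refine ext_inner_left ℂ fun y => ?_
    rw [adjoint_inner_right, Submodule.coe_inner]
    fin_cases j <;> fin_cases l
    · change inner ℂ (I 0 y : Γ.L2) (I 0 x : Γ.L2) = _
      simp [i0]
    · change inner ℂ (I 0 y : Γ.L2) (I 1 x : Γ.L2) = _
      simp [i0, i1, o1]
    · change inner ℂ (I 1 y : Γ.L2) (I 0 x : Γ.L2) = _
      rw [i0, i1, inner_eq_zero_symm.1 (o1 y x)]
      simp
    · change inner ℂ (I 1 y : Γ.L2) (I 1 x : Γ.L2) = _
      simp [i1]
  have htot : ∀ v : Γ.vertexSpace (Γ.r e), (∀ j, adjoint (I j) v = 0) → v = 0 := by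
    intro v hv
    have e0 : ∀ k, (inner ℂ (Γ.pathVec (Γ.rev e) (2 * k + 1)) (v : Γ.L2) : ℂ) = 0 := by
      intro k
      rw [← oddIsometry_sineVec, ← i0, ← Submodule.coe_inner, ← adjoint_inner_right, hv,
        inner_zero_right]
    have e1 : ∀ k, (inner ℂ (Γ.pathVec e (2 * k + 1)) (Γ.edgeOp e (v : Γ.L2)) : ℂ) = 0 := by
      intro k
      rw [← oddIsometry_sineVec, ← adjoint_inner_left, h.adjoint_edgeOp, ← hJ', ← i1,
        ← Submodule.coe_inner, ← adjoint_inner_right, hv, inner_zero_right]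
    refine Subtype.ext (h.eq_zero (h.inner_eq_zero_of_mem v.2) fun n => ?_)
    obtain ⟨k, rfl | rfl⟩ := Nat.even_or_odd' n
    · rw [h.inner_even e1, h.inner_zero_eq_zero hα e1, mul_zero]
    · exact e0 k
  refine ⟨I, ⟨hO, fun v => ?_⟩, fun j x => Subtype.ext ?_⟩
  · rw [← sub_eq_zero]
    refine htot _ fun j => ?_
    rw [map_sub, map_sum, Finset.sum_eq_single j]
    · rw [hO, if_pos rfl, sub_self]
    · intro l _ hl
      rw [hO, if_neg (Ne.symm hl)]
    · simp
  · rw [h.coe_adjoint_edgeEntry, h.coe_edgeEntry]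
    fin_cases j
    · exact k1 x
    · exact k3 x

/-! ### The projection onto the cokernel -/

/-- The projection onto the orthogonal complement of the range of the entry of `λ(e)`. -/
def cokerProj (Γ : WeightedGraph V E) (e : E) : Γ.L2 →L[ℂ] Γ.L2 :=
  corner (Γ.vertexSpace (Γ.s e)) (Γ.vertexSpace (Γ.s e))
    (LinearMap.range (Γ.edgeEntry e : Γ.vertexSpace (Γ.r e) →ₗ[ℂ] Γ.vertexSpace (Γ.s e)))ᗮ.starProjection

/-- A shortcut for instance search. -/
instance (e : E) : (LinearMap.range (Γ.edgeEntry e :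
    Γ.vertexSpace (Γ.r e) →ₗ[ℂ] Γ.vertexSpace (Γ.s e)))ᗮ.HasOrthogonalProjection :=
  Submodule.HasOrthogonalProjection.ofCompleteSpace _

theorem isSelfAdjoint_cokerProj (e : E) : IsSelfAdjoint (Γ.cokerProj e) :=
  isSelfAdjoint_corner_starProjection _

theorem cokerProj_cokerProj (e : E) (x : Γ.L2) :
    Γ.cokerProj e (Γ.cokerProj e x) = Γ.cokerProj e x :=
  corner_starProjection_idem _ x

theorem IsTwoCycle.cokerProj_eq_self_iff (h : Γ.IsTwoCycle e) (x : Γ.L2) :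
    Γ.cokerProj e x = x ↔ x ∈ Γ.vertexSpace (Γ.s e) ∧ Γ.edgeOp (Γ.rev e) x = 0 := by
  have hker : ∀ y : Γ.vertexSpace (Γ.s e), y ∈ (LinearMap.range (Γ.edgeEntry e :
      Γ.vertexSpace (Γ.r e) →ₗ[ℂ] Γ.vertexSpace (Γ.s e)))ᗮ ↔ Γ.edgeOp (Γ.rev e) y = 0 := by
    intro y
    rw [ContinuousLinearMap.orthogonal_range, ← h.coe_adjoint_edgeEntry]
    exact (Submodule.coe_eq_zero (x := adjoint (Γ.edgeEntry e) y)).symm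
  refine (corner_starProjection_eq_self_iff _ x).trans ⟨?_, ?_⟩
  · rintro ⟨y, hy, rfl⟩
    exact ⟨y.2, (hker y).1 hy⟩
  · rintro ⟨hx, h0⟩
    exact ⟨⟨x, hx⟩, (hker _).2 h0, rfl⟩

theorem IsTwoCycle.eq_zero_of_cokerProj (h : Γ.IsTwoCycle e) (x : Γ.L2) (hx : Γ.cokerProj e x = x)
    (h0 : (inner ℂ (Γ.pathVec e 0) x : ℂ) = 0) : x = 0 := by
  rw [h.cokerProj_eq_self_iff] at hx
  refine h.symm.eq_zero_of_edgeOp_eq_zero ?_ hx.2 ?_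
  · rw [Γ.r_rev]
    exact hx.1
  · rw [Γ.rev_rev]
    exact h0

theorem IsTwoCycle.cokerProj_eq_zero (h : Γ.IsTwoCycle e) (hα : Γ.ratio e ≤ 1) :
    Γ.cokerProj e = 0 := by
  ext1 x
  have h1 := (h.cokerProj_eq_self_iff _).1 (cokerProj_cokerProj e x)
  refine h.symm.edgeOp_injective ?_ ?_ h1.2
  · rw [ratio_rev]
    exact (one_le_inv₀ (ratio_pos e)).2 hα
  · rw [Γ.r_rev]
    exact h1.1

/-- For `α > 1` the kernel of `t*` is spanned by `∑ (-α⁻²)^j δ_{2j}`. -/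
theorem IsTwoCycle.inner_cokerProj (h : Γ.IsTwoCycle e) (hα : 1 < Γ.ratio e) :
    (inner ℂ (Γ.pathVec e 0) (Γ.cokerProj e (Γ.pathVec e 0)) : ℂ) =
      ((1 - (Γ.ratio e ^ 4)⁻¹ : ℝ) : ℂ) := by
  set β : ℝ := -(Γ.ratio e ^ 2)⁻¹ with hβ
  have hα2 : 1 < Γ.ratio e ^ 2 := one_lt_pow₀ hα two_ne_zero
  have hβ1 : |β| < 1 := by
    rw [hβ, abs_neg, abs_of_pos (inv_pos.2 (by linarith))]
    exact inv_lt_one_of_one_lt₀ hα2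
  have hβ2 : β ^ 2 = (Γ.ratio e ^ 4)⁻¹ := by rw [hβ]; ring
  have hsum : Summable fun j : ℕ => ((β ^ j : ℝ) : ℂ) • Γ.pathVec e (2 * j) := by
    refine Summable.of_norm ?_
    have hn : ∀ n, ‖Γ.pathVec e n‖ = 1 := fun n => orthonormal_delta.1 _
    simp only [norm_smul, hn, mul_one, Complex.norm_real, norm_pow, Real.norm_eq_abs]
    exact summable_geometric_of_lt_one (abs_nonneg β) hβ1
  obtain ⟨k, hk⟩ := hsum
  have hev : ∀ i, (inner ℂ (Γ.pathVec e (2 * i)) k : ℂ) = ((β ^ i : ℝ) : ℂ) := by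
    intro i
    have h1 := hk.mapL (innerSL ℂ (Γ.pathVec e (2 * i)))
    refine h1.unique ?_
    refine (hasSum_ite_eq i ((β ^ i : ℝ) : ℂ)).congr_fun fun j => ?_
    rw [innerSL_apply_apply, inner_smul_right, inner_pathVec_self]
    by_cases hij : j = i
    · simp [hij]
    · rw [if_neg (by omega), if_neg hij, mul_zero]
  have hod : ∀ i, (inner ℂ (Γ.pathVec e (2 * i + 1)) k : ℂ) = 0 := by
    intro i
    have h1 := hk.mapL (innerSL ℂ (Γ.pathVec e (2 * i + 1)))
    refine h1.unique ?_
    refine hasSum_zero.congr_fun fun j => ?_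
    rw [innerSL_apply_apply, inner_smul_right, inner_pathVec_self, if_neg (by omega), mul_zero]
  have hv : Γ.vertexProj (Γ.s e) k = k := by
    refine (hk.mapL (Γ.vertexProj (Γ.s e))).unique ?_
    simpa only [map_smul, vertexProj_pathVec] using hk
  have h0 : Γ.ratio e ≠ 0 := (ratio_pos e).ne'
  have hker : Γ.edgeOp (Γ.rev e) k = 0 := by
    have hin := h.symm.inner_edgeOp (x := k)
    simp only [Γ.rev_rev, ratio_rev, Complex.ofReal_inv, inv_inv] at hin
    refine h.symm.eq_zero (fun n => ?_) fun n => ?_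
    · obtain ⟨i, rfl | rfl⟩ := Nat.even_or_odd' n
      · rw [hin, hod]
        rcases i with _ | i
        · simp
        · rw [if_neg (by omega), show 2 * (i + 1) - 1 = 2 * i + 1 by omega, hod]
          simp
      · rw [hin, show 2 * i + 1 + 1 = 2 * (i + 1) by ring, hev, if_neg (Nat.succ_ne_zero _),
          Nat.add_sub_cancel, hev, ← Complex.ofReal_inv, ← Complex.ofReal_mul,
          ← Complex.ofReal_mul, ← Complex.ofReal_add, Complex.ofReal_eq_zero, pow_succ,
          show β ^ i * β = -(Γ.ratio e ^ 2)⁻¹ * β ^ i from mul_comm _ _]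
        generalize β ^ i = b
        field_simp
        rw [neg_add_cancel, mul_zero, mul_zero]
    · rw [← h.adjoint_edgeOp, adjoint_inner_right, Γ.rev_rev, h.edgeOp_pathVec, inner_zero_left]
  have hzk : Γ.cokerProj e k = k := (h.cokerProj_eq_self_iff k).2 ⟨⟨k, hv⟩, hker⟩
  have hz := isSelfAdjoint_cokerProj (Γ := Γ) e
  have hprop := (exists_compress_eq_smul hz (cokerProj_cokerProj e) h.eq_zero_of_cokerProj).1 _ k
    (cokerProj_cokerProj e (Γ.pathVec e 0)) hzk
  have hk0 : (inner ℂ (Γ.pathVec e 0) k : ℂ) = 1 := by simpa using hev 0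
  rw [hk0, one_smul] at hprop
  have hkq : (inner ℂ k (Γ.cokerProj e (Γ.pathVec e 0)) : ℂ) = 1 := by
    rw [← adjoint_inner_left, ← star_eq_adjoint, hz.star_eq, hzk, ← inner_conj_symm, hk0, map_one]
  have hkk : (inner ℂ k k : ℂ) = (((1 - β ^ 2)⁻¹ : ℝ) : ℂ) := by
    have h1 := hk.mapL (innerSL ℂ k)
    refine h1.unique ?_
    have hb : |β ^ 2| < 1 := by
      rw [abs_pow]
      exact pow_lt_one₀ (abs_nonneg β) hβ1 two_ne_zero
    have h2 := (hasSum_geometric_of_abs_lt_one hb)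
    have h3 := Complex.hasSum_ofReal.2 h2
    refine h3.congr_fun fun j => ?_
    rw [innerSL_apply_apply, inner_smul_right, ← inner_conj_symm, hev, Complex.conj_ofReal,
      ← Complex.ofReal_mul, ← mul_pow, sq]
  rw [hprop, inner_smul_right, hkk] at hkq
  have hne : (1 - β ^ 2 : ℝ) ≠ 0 := by
    have := sq_lt_one_iff_abs_lt_one β |>.2 hβ1
    linarith
  rw [← hβ2]
  rwa [Complex.ofReal_inv, ← div_eq_mul_inv, div_eq_one_iff_eq (Complex.ofReal_ne_zero.2 hne)]
    at hkq

theorem IsTwoCycle.trace_cokerProj (h : Γ.IsTwoCycle e) (hμ : Γ.μ (Γ.r e) ≤ Γ.μ (Γ.s e)) :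
    Γ.trace (Γ.cokerProj e) = ((Γ.μ (Γ.s e) ^ 2 - Γ.μ (Γ.r e) ^ 2 : ℝ) : ℂ) := by
  classical
  have hr := Γ.μ_pos (Γ.r e)
  have hs := Γ.μ_pos (Γ.s e)
  have huniv : (Finset.univ : Finset V) = {Γ.s e, Γ.r e} := by
    ext x
    simpa using h.vertex x
  have hΩ : Γ.toL2 (∑ u, basisElem (Γ.vertexPath u)) =
      (Γ.μ (Γ.s e) : ℂ) • Γ.pathVec e 0 + (Γ.μ (Γ.r e) : ℂ) • Γ.pathVec (Γ.rev e) 0 := by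
    rw [huniv, Finset.sum_pair h.ne, map_add, vertexPath_eq, ← Γ.s_rev, vertexPath_eq, toL2_altPath,
      toL2_altPath, Function.iterate_zero, id_eq, id_eq, Real.sqrt_mul_self (Γ.μ_pos _).le,
      Real.sqrt_mul_self (Γ.μ_pos _).le]
  have hw : Γ.cokerProj e (Γ.pathVec (Γ.rev e) 0) = 0 := by
    have : (Γ.vertexSpace (Γ.s e)).orthogonalProjectionOnto (Γ.pathVec (Γ.rev e) 0) = 0 := by
      refine Subtype.ext ?_
      rw [h.coe_orthogonalProjectionOnto, vertexProj_pathVec_of_ne (by rw [Γ.s_rev]; exact h.ne)]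
      rfl
    rw [cokerProj, corner_apply, this, map_zero]
    rfl
  have hw' : (inner ℂ (Γ.pathVec (Γ.rev e) 0) (Γ.cokerProj e (Γ.pathVec e 0)) : ℂ) = 0 := by
    rw [← adjoint_inner_left, ← star_eq_adjoint, (isSelfAdjoint_cokerProj e).star_eq, hw,
      inner_zero_left]
  rw [trace, hΩ, map_add, map_smul, map_smul, hw, smul_zero, add_zero, inner_smul_right,
    inner_add_left, inner_smul_left, inner_smul_left, hw', mul_zero, add_zero, Complex.conj_ofReal]
  have h4 : Γ.ratio e ^ 4 = (Γ.μ (Γ.s e) / Γ.μ (Γ.r e)) ^ 2 := by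
    rw [← ratio_sq]; ring
  rcases hμ.eq_or_lt with heq | hlt
  · rw [h.cokerProj_eq_zero, zero_apply, inner_zero_right, heq]
    · simp
    · rw [ratio, heq, div_self hs.ne', Real.sqrt_one]
  · rw [h.inner_cokerProj, ← Complex.ofReal_mul, ← Complex.ofReal_mul, h4]
    · congr 1
      field_simp
    · rw [ratio, Real.lt_sqrt zero_le_one, one_pow, one_lt_div hr]
      exact hlt

end WeightedGraph

/-! ### Existence and uniqueness of the isomorphism -/

section MatrixIso

variable {L H : Type*} [NormedAddCommGroup L] [InnerProductSpace ℂ L] [CompleteSpace L]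
  [NormedAddCommGroup H] [InnerProductSpace ℂ H] [CompleteSpace H]
  {N : VonNeumannAlgebra L} {M : VonNeumannAlgebra H} {W : Fin 2 → Fin 2 → L →L[ℂ] H}

/-- The algebra of a frame with a nonzero projection is `ℂ ⊕ M₂(N)`, by an isomorphism which is
determined by the images of the operators of the frame. -/
theorem existsUnique_starAlgEquiv_prod {z : H →L[ℂ] H} (hW : IsMatrixFrame z W) (hz : z ≠ 0)
    (hM : ∀ T, T ∈ M ↔ ∃ (c : ℂ) (y : Matrix (Fin 2) (Fin 2) (L →L[ℂ] L)),
      (∀ i k, y i k ∈ N) ∧ T = c • z + amp W y) {a : N.toStarSubalgebra}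
    (hA : ∀ θ : N.toStarSubalgebra ≃⋆ₐ[ℂ] N.toStarSubalgebra, θ a = a → ∀ b, θ b = b)
    {pv pw z' u t : M.toStarSubalgebra} (hpv : (pv : H →L[ℂ] H) = z + amp W !![1, 0; 0, 0])
    (hpw : (pw : H →L[ℂ] H) = amp W !![0, 0; 0, 1]) (hz' : (z' : H →L[ℂ] H) = z)
    (hu : (u : H →L[ℂ] H) = amp W !![0, 1; 0, 0])
    (ht : (t : H →L[ℂ] H) = amp W !![0, 0; 0, (a : L →L[ℂ] L)]) :
    ∃! Φ : M.toStarSubalgebra ≃⋆ₐ[ℂ] ℂ × Matrix (Fin 2) (Fin 2) N.toStarSubalgebra,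
      Φ pv = (1, !![1, 0; 0, 0]) ∧ Φ pw = (0, !![0, 0; 0, 1]) ∧ Φ z' = (1, 0) ∧
        Φ u = (0, !![0, 1; 0, 0]) ∧ Φ t = (0, !![0, 0; 0, a]) := by
  obtain ⟨Ψ, hΨ⟩ := exists_starAlgEquiv_prod hW hz hM
  have key : ∀ (T : M.toStarSubalgebra) (c : ℂ) (p q r s : N.toStarSubalgebra),
      (T : H →L[ℂ] H) = c • z + amp W !![(p : L →L[ℂ] L), q; r, s] →
      Ψ.symm T = (c, !![p, q; r, s]) := by
    intro T c p q r s hT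
    rw [StarAlgEquiv.symm_apply_eq]
    refine Subtype.ext ?_
    rw [hΨ, hT, matVal_cons]
  have h3 : Ψ.symm z' = (1, 0) := by
    rw [StarAlgEquiv.symm_apply_eq]
    refine Subtype.ext ?_
    rw [hΨ, hz', one_smul]
    exact (add_eq_left.2 (amp_zero W)).symm
  have h4 := key u 0 0 1 0 0 (by rw [zero_smul, zero_add]; exact hu)
  have h5 := key t 0 0 0 0 a (by rw [zero_smul, zero_add]; exact ht)
  exact ⟨Ψ.symm, ⟨key pv 1 1 0 0 0 (by rw [one_smul]; exact hpv),
    key pw 0 0 0 0 1 (by rw [zero_smul, zero_add]; exact hpw), h3, h4, h5⟩,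
    fun Φ' hΦ' => starAlgEquiv_prod_unique hA h3 h4 h5 hΦ'.2.2.1 hΦ'.2.2.2.1 hΦ'.2.2.2.2⟩

/-- The algebra of a frame without a projection is `M₂(N)`. -/
theorem existsUnique_starAlgEquiv_matrix (hW : IsMatrixFrame 0 W)
    (hM : ∀ T, T ∈ M ↔ ∃ (c : ℂ) (y : Matrix (Fin 2) (Fin 2) (L →L[ℂ] L)),
      (∀ i k, y i k ∈ N) ∧ T = c • (0 : H →L[ℂ] H) + amp W y) {a : N.toStarSubalgebra}
    (hA : ∀ θ : N.toStarSubalgebra ≃⋆ₐ[ℂ] N.toStarSubalgebra, θ a = a → ∀ b, θ b = b)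
    {pv pw u t : M.toStarSubalgebra} (hpv : (pv : H →L[ℂ] H) = 0 + amp W !![1, 0; 0, 0])
    (hpw : (pw : H →L[ℂ] H) = amp W !![0, 0; 0, 1])
    (hu : (u : H →L[ℂ] H) = amp W !![0, 1; 0, 0])
    (ht : (t : H →L[ℂ] H) = amp W !![0, 0; 0, (a : L →L[ℂ] L)]) :
    ∃! Φ : M.toStarSubalgebra ≃⋆ₐ[ℂ] Matrix (Fin 2) (Fin 2) N.toStarSubalgebra,
      Φ pv = !![1, 0; 0, 0] ∧ Φ pw = !![0, 0; 0, 1] ∧ Φ u = !![0, 1; 0, 0] ∧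
        Φ t = !![0, 0; 0, a] := by
  obtain ⟨Ψ, hΨ⟩ := exists_starAlgEquiv_matrix hW hM
  have key : ∀ (T : M.toStarSubalgebra) (p q r s : N.toStarSubalgebra),
      (T : H →L[ℂ] H) = amp W !![(p : L →L[ℂ] L), q; r, s] → Ψ.symm T = !![p, q; r, s] := by
    intro T p q r s hT
    rw [StarAlgEquiv.symm_apply_eq]
    refine Subtype.ext ?_
    rw [hΨ, hT, matVal_cons]
  have h4 := key u 0 1 0 0 hu
  have h5 := key t 0 0 0 a ht
  exact ⟨Ψ.symm, ⟨key pv 1 0 0 0 (by rw [hpv, zero_add]; rfl), key pw 0 0 0 1 hpw, h4, h5⟩,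
    fun Φ' hΦ' => starAlgEquiv_matrix_unique hA h4 h5 hΦ'.2.2.1 hΦ'.2.2.2⟩

end MatrixIso

/-! ### The von Neumann algebra of the two-edge graph -/

namespace WeightedGraph

open ContinuousLinearMap

variable {V E : Type*} [Fintype V] {Γ : WeightedGraph V E} {e : E}

theorem one_le_ratio (h : Γ.μ (Γ.r e) ≤ Γ.μ (Γ.s e)) : 1 ≤ Γ.ratio e := by
  rw [ratio, Real.one_le_sqrt, one_le_div (Γ.μ_pos _)]
  exact h

theorem IsTwoCycle.edgeEntry_injective (h : Γ.IsTwoCycle e) (hα : 1 ≤ Γ.ratio e)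
    (x : Γ.vertexSpace (Γ.r e)) (hx : Γ.edgeEntry e x = 0) : x = 0 := by
  refine Subtype.ext (h.edgeOp_injective hα x.2 ?_)
  rw [← h.coe_edgeEntry, hx]
  rfl

/-- A frame of copies of `ℓ²(ℤ)` which expresses the generators of the von Neumann algebra and the
isometry `u` of the polar decomposition as matrices over `Lℤ`. -/
structure IsEdgeFrame (Γ : WeightedGraph V E) (e : E)
    (u : Γ.vertexSpace (Γ.r e) →L[ℂ] Γ.vertexSpace (Γ.s e))
    (W : Fin 2 → Fin 2 → EllTwo (Multiplicative ℤ) →L[ℂ] Γ.L2) : Prop where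
  isMatrixFrame : IsMatrixFrame (Γ.cokerProj e) W
  vertexProj_source : Γ.vertexProj (Γ.s e) = Γ.cokerProj e + amp W !![1, 0; 0, 0]
  vertexProj_range : Γ.vertexProj (Γ.r e) = amp W !![0, 0; 0, 1]
  isometry : corner (Γ.vertexSpace (Γ.s e)) (Γ.vertexSpace (Γ.r e)) u = amp W !![0, 1; 0, 0]
  abs : corner (Γ.vertexSpace (Γ.r e)) (Γ.vertexSpace (Γ.r e)) (opAbs (Γ.edgeEntry e)) =
    amp W !![0, 0; 0, modelLZ (Γ.spectralShift e)]
  mem_iff : ∀ T, T ∈ Γ.vN ↔ ∃ (c : ℂ) (y : Matrix (Fin 2) (Fin 2) _), (∀ i k, y i k ∈ LZ) ∧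
    T = c • Γ.cokerProj e + amp W y

/-- The copies of `ℓ²(ℤ)` in the space of the range vertex and their images under `u` form a frame.
In it the edge is the matrix unit `e₁₂` times `a`, so the double commutant of the generators is
the algebra of the frame. -/
theorem IsTwoCycle.isEdgeFrame (h : Γ.IsTwoCycle e)
    {I : Fin 2 → EllTwo (Multiplicative ℤ) →L[ℂ] Γ.vertexSpace (Γ.r e)} (hI : IsDecomposition I)
    (ht : ∀ j x, adjoint (Γ.edgeEntry e) (Γ.edgeEntry e (I j x)) =
        I j (modelLZ (Γ.spectralShift e) (modelLZ (Γ.spectralShift e) x)))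
    {u : Γ.vertexSpace (Γ.r e) →L[ℂ] Γ.vertexSpace (Γ.s e)} (hu : ∀ x, ‖u x‖ = ‖x‖)
    (hpol : IsPolarDecomposition (Γ.edgeEntry e) u)
    (hR : LinearMap.range (u : Γ.vertexSpace (Γ.r e) →ₗ[ℂ] Γ.vertexSpace (Γ.s e)) =
      (LinearMap.range (Γ.edgeEntry e :
        Γ.vertexSpace (Γ.r e) →ₗ[ℂ] Γ.vertexSpace (Γ.s e))).topologicalClosure) :
    Γ.IsEdgeFrame e u (cornerFrame (Γ.vertexSpace (Γ.s e)) (Γ.vertexSpace (Γ.r e)) u I) := by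
  have h2 := two_le_spectralShift (Γ := Γ) e
  have hpos := modelLZ_nonneg h2
  have habs := hI.opAbs_eq hpos ht
  have hAB : ∀ x : Γ.L2, ((Γ.vertexSpace (Γ.s e)).orthogonalProjectionOnto x : Γ.L2) +
      (Γ.vertexSpace (Γ.r e)).orthogonalProjectionOnto x = x := by
    intro x
    rw [h.coe_orthogonalProjectionOnto, h.coe_orthogonalProjectionOnto']
    exact congrArg (fun T => T x) h.vertexProj_add
  have hW : IsMatrixFrame (Γ.cokerProj e) _ := isMatrixFrame_cornerFrame hI hu hAB hR
    (exists_compress_eq_smul (isSelfAdjoint_cokerProj e) (cokerProj_cokerProj e)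
      h.eq_zero_of_cokerProj).2
  set a := modelLZ (Γ.spectralShift e)
  set W := cornerFrame (Γ.vertexSpace (Γ.s e)) (Γ.vertexSpace (Γ.r e)) u I
  have ev : Γ.vertexProj (Γ.s e) = Γ.cokerProj e + amp W !![1, 0; 0, 0] := by
    ext1 x
    rw [← h.coe_orthogonalProjectionOnto]
    exact (corner_starProjection_add_amp hI hu hR x).symm
  have ew : Γ.vertexProj (Γ.r e) = amp W !![0, 0; 0, 1] := by
    ext1 x
    rw [amp_cornerFrame_lowerRight hI, map_one, ← h.coe_orthogonalProjectionOnto']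
    rfl
  have ee : Γ.edgeOp e = amp W !![0, a; 0, 0] := by
    rw [amp_cornerFrame_upperRight hI, ← habs, ← hpol.eq_comp, h.edgeOp_eq_corner]
  have er : Γ.edgeOp (Γ.rev e) = amp W !![0, 0; a, 0] := by
    rw [← h.adjoint_edgeOp, ee, ← star_eq_adjoint, star_amp]
    congr 1
    ext i k : 2
    fin_cases i <;> fin_cases k <;>
      simp [Matrix.star_apply, (IsSelfAdjoint.of_nonneg hpos).star_eq]
  refine ⟨hW, ev, ew, ?_, ?_, ?_⟩
  · rw [amp_cornerFrame_upperRight hI, map_one]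
    rfl
  · rw [amp_cornerFrame_lowerRight hI, habs]
  · refine hW.mem_iff hpos (fun y => modelOp_injective fourierEquiv h2)
      (mem_LZ_iff_commute_modelLZ h2) (fun X hX Y hY => commute_of_mem_LZ hX hY) fun T => ?_
    rw [h.mem_vN_iff, ev, ew, ee, er]
    exact ⟨fun H X hX => H X hX.1 hX.2.1 hX.2.2.1 hX.2.2.2,
      fun H X h1 h2 h3 h4 => H X ⟨h1, h2, h3, h4⟩⟩

theorem IsEdgeFrame.amp_mem {u : Γ.vertexSpace (Γ.r e) →L[ℂ] Γ.vertexSpace (Γ.s e)}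
    {W : Fin 2 → Fin 2 → EllTwo (Multiplicative ℤ) →L[ℂ] Γ.L2} (hW : Γ.IsEdgeFrame e u W)
    (p q r s : LZ.toStarSubalgebra) :
    amp W !![(p : EllTwo (Multiplicative ℤ) →L[ℂ] EllTwo (Multiplicative ℤ)), q; r, s] ∈ Γ.vN := by
  rw [hW.mem_iff, ← matVal_cons]
  exact ⟨0, matVal !![p, q; r, s], fun i k => (!![p, q; r, s] i k).2, by rw [zero_smul, zero_add]⟩

theorem IsEdgeFrame.mem_cokerProj {u : Γ.vertexSpace (Γ.r e) →L[ℂ] Γ.vertexSpace (Γ.s e)}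
    {W : Fin 2 → Fin 2 → EllTwo (Multiplicative ℤ) →L[ℂ] Γ.L2} (hW : Γ.IsEdgeFrame e u W) :
    Γ.cokerProj e ∈ Γ.vN :=
  (hW.mem_iff _).2 ⟨1, 0, fun _ _ => (0 : LZ.toStarSubalgebra).2, by
    rw [amp_zero, one_smul, add_zero]⟩

theorem IsEdgeFrame.mem_corner {u : Γ.vertexSpace (Γ.r e) →L[ℂ] Γ.vertexSpace (Γ.s e)}
    {W : Fin 2 → Fin 2 → EllTwo (Multiplicative ℤ) →L[ℂ] Γ.L2} (hW : Γ.IsEdgeFrame e u W) :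
    corner (Γ.vertexSpace (Γ.s e)) (Γ.vertexSpace (Γ.r e)) u ∈ Γ.vN :=
  hW.isometry ▸ hW.amp_mem 0 1 0 0

theorem IsEdgeFrame.mem_opAbs {u : Γ.vertexSpace (Γ.r e) →L[ℂ] Γ.vertexSpace (Γ.s e)}
    {W : Fin 2 → Fin 2 → EllTwo (Multiplicative ℤ) →L[ℂ] Γ.L2} (hW : Γ.IsEdgeFrame e u W) :
    corner (Γ.vertexSpace (Γ.r e)) (Γ.vertexSpace (Γ.r e)) (opAbs (Γ.edgeEntry e)) ∈ Γ.vN :=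
  hW.abs ▸ hW.amp_mem 0 0 0 ⟨_, modelLZ_mem (two_le_spectralShift e)⟩

theorem IsTwoCycle.exists_frame (h : Γ.IsTwoCycle e) (hα : 1 ≤ Γ.ratio e) :
    ∃ u : Γ.vertexSpace (Γ.r e) →L[ℂ] Γ.vertexSpace (Γ.s e),
      IsPolarDecomposition (Γ.edgeEntry e) u ∧ (∀ x, ‖u x‖ = ‖x‖) ∧
      LinearMap.range (u : Γ.vertexSpace (Γ.r e) →ₗ[ℂ] Γ.vertexSpace (Γ.s e)) =
        (LinearMap.range (Γ.edgeEntry e :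
          Γ.vertexSpace (Γ.r e) →ₗ[ℂ] Γ.vertexSpace (Γ.s e))).topologicalClosure ∧
      ∃ W, Γ.IsEdgeFrame e u W := by
  obtain ⟨I, hI, ht⟩ := h.exists_isDecomposition hα
  obtain ⟨u, hpol, hR⟩ := exists_isPolarDecomposition (Γ.edgeEntry e) (h.edgeEntry_injective hα)
  exact ⟨u.toContinuousLinearMap, hpol, u.norm_map, hR, _, h.isEdgeFrame hI ht u.norm_map hpol hR⟩

theorem isPositive_modelLZ {c : ℝ} (hc : 2 ≤ c) : (modelLZ c).IsPositive :=
  (ContinuousLinearMap.nonneg_iff_isPositive _).1 (modelLZ_nonneg hc)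

theorem IsTwoCycle.cokerProj_eq_zero_of_eq (h : Γ.IsTwoCycle e) (hμ : Γ.μ (Γ.r e) = Γ.μ (Γ.s e)) :
    Γ.cokerProj e = 0 :=
  h.cokerProj_eq_zero <| by rw [ratio, hμ, div_self (Γ.μ_pos _).ne', Real.sqrt_one]

theorem IsTwoCycle.hasAbsContSpectrum_edgeEntry (h : Γ.IsTwoCycle e) (hα : 1 ≤ Γ.ratio e) :
    HasAbsContSpectrum (adjoint (Γ.edgeEntry e) ∘L Γ.edgeEntry e) := by
  obtain ⟨I, hI, ht⟩ := h.exists_isDecomposition hα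
  rw [hI.adjoint_comp_self_eq ht]
  exact hI.hasAbsContSpectrum
    (hasAbsContSpectrum_modelOp_mul_self fourierEquiv (two_le_spectralShift e))

theorem IsTwoCycle.nonempty_starAlgEquiv (h : Γ.IsTwoCycle e) (hα : 1 ≤ Γ.ratio e) :
    Nonempty ((generatedVN {opAbs (Γ.edgeEntry e)}).toStarSubalgebra ≃⋆ₐ[ℂ]
      LZ.toStarSubalgebra) := by
  obtain ⟨I, hI, ht⟩ := h.exists_isDecomposition hα
  have h2 := two_le_spectralShift (Γ := Γ) e
  have hpos := modelLZ_nonneg h2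
  rw [hI.opAbs_eq hpos ht]
  exact hI.nonempty_starAlgEquiv (IsSelfAdjoint.of_nonneg hpos) (mem_LZ_iff_commute_modelLZ h2)
    fun X hX Y hY => commute_of_mem_LZ hX hY

theorem IsTwoCycle.cokerProj_ne_zero (h : Γ.IsTwoCycle e) (hμ : Γ.μ (Γ.r e) < Γ.μ (Γ.s e)) :
    Γ.cokerProj e ≠ 0 := by
  intro h0
  have htr := h.trace_cokerProj hμ.le
  rw [h0] at htr
  have h3 : (0 : ℂ) = ((Γ.μ (Γ.s e) ^ 2 - Γ.μ (Γ.r e) ^ 2 : ℝ) : ℂ) := by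
    rw [← htr]
    simp [trace]
  have h4 : Γ.μ (Γ.r e) ^ 2 < Γ.μ (Γ.s e) ^ 2 :=
    pow_lt_pow_left₀ hμ (Γ.μ_pos _).le two_ne_zero
  have h5 : (0 : ℝ) = Γ.μ (Γ.s e) ^ 2 - Γ.μ (Γ.r e) ^ 2 := by exact_mod_cast h3
  linarith

end WeightedGraph

open WeightedGraph in
theorem mainTheorem5 {V E : Type*} [Fintype V] (Γ : WeightedGraph V E) (v w : V) (e : E)
    (hvw : v ≠ w) (hV : ∀ x : V, x = v ∨ x = w) (hE : ∀ f : E, f = e ∨ f = Γ.rev e)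
    (hs : Γ.s e = v) (hr : Γ.r e = w) (hμ : Γ.μ w ≤ Γ.μ v) :
    let Hv := Γ.vertexSpace v
    let Hw := Γ.vertexSpace w
    -- the `v`-`w` entry of `λ(e)`, its polar decomposition, and its cokernel projection
    let t : Hw →L[ℂ] Hv := blockEntry Hv Hw (Γ.edgeOp e)
    let absT : Γ.L2 →L[ℂ] Γ.L2 := corner Hw Hw (opAbs t)
    let z : Γ.L2 →L[ℂ] Γ.L2 :=
      corner Hv Hv (LinearMap.range (t : Hw →ₗ[ℂ] Hv))ᗮ.starProjection
    Γ.edgeOp e = corner Hv Hw t ∧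
    HasAbsContSpectrum (ContinuousLinearMap.adjoint t ∘L t) ∧
    Nonempty ((generatedVN {opAbs t}).toStarSubalgebra ≃⋆ₐ[ℂ] LZ.toStarSubalgebra) ∧
    Γ.trace z = ((Γ.μ v ^ 2 - Γ.μ w ^ 2 : ℝ) : ℂ) ∧
    ∃ u₀ : Hw →L[ℂ] Hv, IsPolarDecomposition t u₀ ∧
      (∀ x, ‖u₀ x‖ = ‖x‖) ∧
      LinearMap.range (u₀ : Hw →ₗ[ℂ] Hv) =
        (LinearMap.range (t : Hw →ₗ[ℂ] Hv)).topologicalClosure ∧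
      ∃ (hz : z ∈ Γ.vN) (hu : corner Hv Hw u₀ ∈ Γ.vN) (habs : absT ∈ Γ.vN),
        let pv : Γ.vN.toStarSubalgebra := ⟨Γ.vertexProj v, Γ.lam_mem _⟩
        let pw : Γ.vN.toStarSubalgebra := ⟨Γ.vertexProj w, Γ.lam_mem _⟩
        let z' : Γ.vN.toStarSubalgebra := ⟨z, hz⟩
        let u : Γ.vN.toStarSubalgebra := ⟨corner Hv Hw u₀, hu⟩
        let abs' : Γ.vN.toStarSubalgebra := ⟨absT, habs⟩
        (Γ.μ w < Γ.μ v →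
          ∃ a : LZ.toStarSubalgebra, a.1.IsPositive ∧ HasAbsContSpectrum a.1 ∧
            generatedVN {a.1} = LZ ∧
            ∃! Φ : Γ.vN.toStarSubalgebra ≃⋆ₐ[ℂ] ℂ × Matrix (Fin 2) (Fin 2) LZ.toStarSubalgebra,
              Φ pv = (1, !![1, 0; 0, 0]) ∧ Φ pw = (0, !![0, 0; 0, 1]) ∧ Φ z' = (1, 0) ∧
              Φ u = (0, !![0, 1; 0, 0]) ∧ Φ abs' = (0, !![0, 0; 0, a])) ∧
        (Γ.μ w = Γ.μ v → z = 0 ∧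
          ∃ a : LZ.toStarSubalgebra, a.1.IsPositive ∧ HasAbsContSpectrum a.1 ∧
            generatedVN {a.1} = LZ ∧
            ∃! Φ : Γ.vN.toStarSubalgebra ≃⋆ₐ[ℂ] Matrix (Fin 2) (Fin 2) LZ.toStarSubalgebra,
              Φ pv = !![1, 0; 0, 0] ∧ Φ pw = !![0, 0; 0, 1] ∧
              Φ u = !![0, 1; 0, 0] ∧ Φ abs' = !![0, 0; 0, a]) := by
  subst hs hr
  have h : Γ.IsTwoCycle e := ⟨hvw, hV, hE⟩
  have hα := one_le_ratio hμ
  refine ⟨h.edgeOp_eq_corner, h.hasAbsContSpectrum_edgeEntry hα, h.nonempty_starAlgEquiv hα,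
    h.trace_cokerProj hμ, (h.exists_frame hα).imp fun u₀ H => ⟨H.1, H.2.1, H.2.2.1, ?_⟩⟩
  refine H.2.2.2.elim fun W HW => ⟨HW.mem_cokerProj, HW.mem_corner, HW.mem_opAbs, ?_, ?_⟩
  · exact fun hlt => ⟨⟨modelLZ (Γ.spectralShift e), modelLZ_mem (two_le_spectralShift e)⟩,
      isPositive_modelLZ (two_le_spectralShift e),
      hasAbsContSpectrum_modelOp fourierEquiv (two_le_spectralShift e),
      generatedVN_modelLZ (two_le_spectralShift e),
      existsUnique_starAlgEquiv_prod HW.isMatrixFrame (h.cokerProj_ne_zero hlt) HW.mem_iff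
        (starAlgEquiv_LZ_apply_eq (two_le_spectralShift e)) HW.vertexProj_source
        HW.vertexProj_range rfl HW.isometry HW.abs⟩
  · exact fun heq => ⟨h.cokerProj_eq_zero_of_eq heq,
      ⟨modelLZ (Γ.spectralShift e), modelLZ_mem (two_le_spectralShift e)⟩,
      isPositive_modelLZ (two_le_spectralShift e),
      hasAbsContSpectrum_modelOp fourierEquiv (two_le_spectralShift e),
      generatedVN_modelLZ (two_le_spectralShift e),
      existsUnique_starAlgEquiv_matrix (h.cokerProj_eq_zero_of_eq heq ▸ HW.isMatrixFrame)
        (h.cokerProj_eq_zero_of_eq heq ▸ HW.mem_iff)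
        (starAlgEquiv_LZ_apply_eq (two_le_spectralShift e))
        (h.cokerProj_eq_zero_of_eq heq ▸ HW.vertexProj_source)
        HW.vertexProj_range HW.isometry HW.abs⟩
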